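/- **Setting.** Let $N\ge 1$ be an integer, $\eta>0$, and let $q:\mathbb R\to\mathbb R$ be piecewise continuous with $\eta\,\mathbf 1_{[-1/2,1/2]}\le q\le \eta^{-1}\mathbf 1_{[-N,N]}$. For $\omega=(\omega_n)_{n\in\mathbb Z}\in\mathbb R^{\mathbb Z}$ put $V_\omega(x)=\sum_{n\in\mathbb Z}\omega_n q(x-n)$, and for $l\in\mathbb N$ let $H_\omega(\Lambda_l)=-\frac{d^2}{dx^2}+V_\omega$ on $L^2(-l,l)$ with Dirichlet boundary conditions, with eigenvalues $E_0(\omega)<E_1(\omega)<\cdots$ (all simple). Write $\langle f,g\rangle_q=\int_{-N}^N fgq$ and $\|f\|_q=\langle f,f\rangle_q^{1/2}$. Fix real numbers $F\neq G$. For $n\in\mathbb Z$ and $\bullet\in\{F,G\}$ let $\Psi,\Phi$ be the solutions of $-y''(x)+V_\omega(n+x)y(x)=\bullet\, y(x)$ on $(-N,N)$ with $\Psi(0)=1,\Psi'(0)=0$ and $\Phi(0)=0,\Phi'(0)=1$, and put $e^n_{1,\bullet}=\Psi/\|\Psi\|_q$, $\tilde\Phi=\Phi-\langle\Phi,e^n_{1,\bullet}\rangle_q\,e^n_{1,\bullet}$,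 $e^n_{2,\bullet}=\tilde\Phi/\|\tilde\Phi\|_q$. If $u$ is a real eigenfunction of $H_\omega(\Lambda_l)$ for $E_j(\omega)$ with $\int_{-l}^l u^2=1$, let $(A_n,B_n)$ be the unique pair such that $x\mapsto u(n+x)-A_ne^n_{1,F}(x)-B_ne^n_{2,F}(x)$ vanishes together with its derivative at $x=0$. Let $\mathcal N=\sum_{n=-l}^{l}|\partial_{\omega_n}E_j(\omega)|$ and define $r_u(n)>0$, $\theta_u(n)\in[0,2\pi)$ by $\mathcal N^{-1/2}(A_n,B_n)=r_u(n)(\sin\theta_u(n),\cos\theta_u(n))$, and $t_u(n)=\operatorname{sgn}(\tan\theta_u(n))\min(|\tan\theta_u(n)|,|\cot\theta_u(n)|)$. For an eigenfunction $v$ for $E_k(\omega)$ define $r_v,\theta_v,t_v$ in the same way, with $G$ and $E_k$ in place of $F$ and $E_j$. **Lemma.** There exist nine real analytic functions $f_0,\dots,f_8$ on $\mathbb R^{16N+1}$, depending only on $q,N,F,G$ and not all identically zero, such that the following holds. For $x\in\mathbb R^{16N+1}$ write $$\mathcal R_{x}(X)=\sum_{i=0}^8 f_i(x)X^i,\qquad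 \mathcal Q_{x}(X)=\sum_{i=0}^8 f_{8-i}(x)X^i .$$ 1. If $\omega_0\ge 0$ and $\omega_0\eta>\max(F,G)$, then $\mathcal R_{(\omega_0,\dots,\omega_0)}$ is not the zero polynomial. 2. Let $\beta>1/2$, $l\in\mathbb N$, $\omega\in\mathbb R^{\mathbb Z}$, let $u$, $v$ be $L^2(-l,l)$-normalized eigenfunctions of $H_\omega(\Lambda_l)$ for eigenvalues $E_j(\omega)\in[F-e^{-l^\beta},F+e^{-l^\beta}]$ and $E_k(\omega)\in[G-e^{-l^\beta},G+e^{-l^\beta}]$, and let $n_0\in\mathbb Z\cap(-l+8N,l-8N)$ be such that $r_u(n_0)\ge e^{-l^\beta/4}$ and $|r_u(m)-r_v(m)|\le e^{-l^\beta/2}$ for all integers $m\in[n_0-7N,n_0+7N]$. Put $\hat\omega=(\omega_{n_0-8N},\dots,\omega_{n_0+8N})$. If there is $g\in\{\tan,\cot\}$ with both $t_v(n_0)=g(\theta_v(n_0))$ and $t_u(n_0)=g(\theta_u(n_0))$, then $|\mathcal R_{\hat\omega}(t_v(n_0))|\le e^{-l^\beta/4}$; otherwise $|\mathcal Q_{\hat\omega}(t_v(n_0))|\le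 e^{-l^\beta/4}$. -/

import Mathlib

open Set Filter Topology

noncomputable section

namespace Alloy

/-- Piecewise continuity: finitely many exceptional points, at each of which both one-sided limits
exist and are finite. -/
def PiecewiseContinuous (q : ℝ → ℝ) : Prop :=
  ∃ S : Finset ℝ, (∀ x ∉ S, ContinuousAt q x) ∧
    ∀ x ∈ S, (∃ a, Tendsto q (𝓝[<] x) (𝓝 a)) ∧ (∃ b, Tendsto q (𝓝[>] x) (𝓝 b))

/-- The assumptions on the single-site potential: `q` is piecewise continuous and
`η 1_[-1/2,1/2] ≤ q ≤ η⁻¹ 1_[-N,N]` with `η > 0` and an integer `N ≥ 1`. -/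
structure SingleSite (q : ℝ → ℝ) (N : ℕ) (η : ℝ) : Prop where
  one_le_N : 1 ≤ N
  eta_pos : 0 < η
  piecewise : PiecewiseContinuous q
  lower : ∀ x, (Icc (-1 / 2 : ℝ) (1 / 2)).indicator (fun _ => η) x ≤ q x
  upper : ∀ x, q x ≤ (Icc (-(N : ℝ)) N).indicator (fun _ => 1 / η) x

/-- The alloy-type potential `V_ω(x) = ∑ ω_n q(x - n)`; for a compactly supported `q` only finitely
many terms are nonzero. -/
def potential (q : ℝ → ℝ) (ω : ℤ → ℝ) (x : ℝ) : ℝ := ∑' n : ℤ, ω n * q (x - n)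

/-- `y` is an `H²` solution of `-y'' + W y = E y` on `[a, b]`: `y` is `C¹` on `[a, b]`, and `y'` is
the primitive of `(W - E) y`. (This is the usual notion of solution for a bounded measurable, possibly
discontinuous, `W`.) -/
structure IsSolutionOn (W : ℝ → ℝ) (E a b : ℝ) (y : ℝ → ℝ) : Prop where
  contDiffOn : ContDiffOn ℝ 1 y (Icc a b)
  deriv_eq : ∀ x ∈ Icc a b,
    derivWithin y (Icc a b) x = derivWithin y (Icc a b) a + ∫ t in a..x, (W t - E) * y t

/-! ### The Dirichlet operator on `[-l, l]` -/

/-- The set of eigenvalues of `-d²/dx² + W` on `L²(-l, l)` with Dirichlet boundary conditions. -/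
def dirichletSpectrum (W : ℝ → ℝ) (l : ℕ) : Set ℝ :=
  {E | ∃ y, IsSolutionOn W E (-(l : ℝ)) l y ∧ y (-(l : ℝ)) = 0 ∧ y l = 0 ∧
    ∃ x ∈ Icc (-(l : ℝ)) l, y x ≠ 0}

/-- The Dirichlet eigenvalues in increasing order, `j = 0, 1, 2, …`; all of them are simple. The
`j`-th one is the only eigenvalue with exactly `j` eigenvalues below it. -/
def eigenvalue (W : ℝ → ℝ) (l j : ℕ) : ℝ :=
  sInf {E | E ∈ dirichletSpectrum W l ∧ {E' | E' ∈ dirichletSpectrum W l ∧ E' < E}.Finite ∧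
    {E' | E' ∈ dirichletSpectrum W l ∧ E' < E}.ncard = j}

/-- `E_j(ω)`, the `j`-th eigenvalue of `H_ω(Λ_l)`, `Λ_l = [-l, l]`. -/
def energy (q : ℝ → ℝ) (l j : ℕ) (ω : ℤ → ℝ) : ℝ := eigenvalue (potential q ω) l j

/-- The `ℓ¹` norm of the gradient `(∂E_j/∂ω_n)_{-l ≤ n ≤ l}`. -/
def gradNorm (q : ℝ → ℝ) (l j : ℕ) (ω : ℤ → ℝ) : ℝ :=
  ∑ n ∈ Finset.Icc (-(l : ℤ)) l, |deriv (fun s => energy q l j (Function.update ω n s)) (ω n)|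

/-- `u` is an eigenfunction of `H_ω(Λ_l)` for the eigenvalue `E`, normalized in `L²(-l, l)`. -/
structure IsNormalizedEigenfunction (q : ℝ → ℝ) (ω : ℤ → ℝ) (l : ℕ) (E : ℝ) (u : ℝ → ℝ) : Prop where
  solution : IsSolutionOn (potential q ω) E (-(l : ℝ)) l u
  left : u (-(l : ℝ)) = 0
  right : u l = 0
  normalized : ∫ x in (-(l : ℝ))..l, u x ^ 2 = 1

/-! ### The local `q`-orthonormal bases -/

/-- `⟨f, g⟩_q`, the integral of `f g q` over `(-N, N)`. -/
def qInner (q : ℝ → ℝ) (N : ℕ) (f g : ℝ → ℝ) : ℝ := ∫ t in (-(N : ℝ))..N, f t * g t * q t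

/-- `‖f‖_q`. -/
def qNorm (q : ℝ → ℝ) (N : ℕ) (f : ℝ → ℝ) : ℝ := √(qInner q N f f)

/-- The solution of `-y'' + W y = E y` on `[-N, N]` with `y 0 = c₀` and `y' 0 = c₁`. It exists and is
unique on `[-N, N]`; its values elsewhere play no role. -/
def solutionAt (W : ℝ → ℝ) (E : ℝ) (N : ℕ) (c₀ c₁ : ℝ) : ℝ → ℝ :=
  Classical.epsilon fun y => IsSolutionOn W E (-(N : ℝ)) N y ∧ y 0 = c₀ ∧ deriv y 0 = c₁

/-- The potential seen from the site `n`, `x ↦ V_ω(n + x)`. -/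
def shiftedPotential (q : ℝ → ℝ) (ω : ℤ → ℝ) (n : ℤ) (x : ℝ) : ℝ := potential q ω (n + x)

/-- First basis function at the site `n` and the energy `E`: `Ψ / ‖Ψ‖_q`, where `Ψ` solves the
equation seen from `n` with `Ψ(0) = 1` and `Ψ'(0) = 0`. -/
def basis₁ (q : ℝ → ℝ) (N : ℕ) (ω : ℤ → ℝ) (E : ℝ) (n : ℤ) (x : ℝ) : ℝ :=
  solutionAt (shiftedPotential q ω n) E N 1 0 x /
    qNorm q N (solutionAt (shiftedPotential q ω n) E N 1 0)

/-- `Φ - ⟨Φ, e₁⟩_q e₁`, where `Φ` solves the equation seen from `n` with `Φ(0) = 0`, `Φ'(0) = 1`. -/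
def orthPart (q : ℝ → ℝ) (N : ℕ) (ω : ℤ → ℝ) (E : ℝ) (n : ℤ) (x : ℝ) : ℝ :=
  solutionAt (shiftedPotential q ω n) E N 0 1 x -
    qInner q N (solutionAt (shiftedPotential q ω n) E N 0 1) (basis₁ q N ω E n) *
      basis₁ q N ω E n x

/-- Second basis function at the site `n` and the energy `E` (Gram–Schmidt). -/
def basis₂ (q : ℝ → ℝ) (N : ℕ) (ω : ℤ → ℝ) (E : ℝ) (n : ℤ) (x : ℝ) : ℝ :=
  orthPart q N ω E n x / qNorm q N (orthPart q N ω E n)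

/-- The coefficients `(A_n, B_n)` of `u` at the site `n`, relative to the basis at the energy `E`:
the unique pair for which the remainder `u(n + x) - A_n e₁(x) - B_n e₂(x)` vanishes together with its
derivative at `x = 0`. -/
def coeffs (q : ℝ → ℝ) (N : ℕ) (ω : ℤ → ℝ) (E : ℝ) (u : ℝ → ℝ) (n : ℤ) : Fin 2 → ℝ :=
  Matrix.mulVec
    (!![basis₁ q N ω E n 0, basis₂ q N ω E n 0;
        deriv (basis₁ q N ω E n) 0, deriv (basis₂ q N ω E n) 0])⁻¹
    ![u n, deriv u n]

/-- The vector `U(n) = (A_n, B_n) / √𝒩`, where the normalization `𝒩` is the `ℓ¹` norm of the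
gradient of the eigenvalue `E_j(ω)` to which `u` belongs. -/
def pruferVector (q : ℝ → ℝ) (N : ℕ) (ω : ℤ → ℝ) (E : ℝ) (l j : ℕ) (u : ℝ → ℝ) (n : ℤ) :
    Fin 2 → ℝ :=
  fun i => coeffs q N ω E u n i / √(gradNorm q l j ω)

/-! ### Prüfer variables -/

/-- The Prüfer radius of `U = r (sin θ, cos θ)`. -/
def radius (U : Fin 2 → ℝ) : ℝ := √(U 0 ^ 2 + U 1 ^ 2)

/-- The Prüfer angle `θ ∈ [0, 2π)` of `U = r (sin θ, cos θ)`. -/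
def angle (U : Fin 2 → ℝ) : ℝ := toIcoMod Real.two_pi_pos 0 (Complex.arg ⟨U 1, U 0⟩)

/-- `t = sgn(tan θ) min(|tan θ|, |cot θ|)` for the Prüfer angle `θ`. (When `tan θ` or `cot θ` is
infinite this gives `t = 0`.) -/
def slope (U : Fin 2 → ℝ) : ℝ :=
  Real.sign (Real.tan (angle U)) * min |Real.tan (angle U)| |Real.cot (angle U)|

/-- `t = tan θ`, with `tan θ` finite. -/
def SlopeIsTan (U : Fin 2 → ℝ) : Prop :=
  Real.cos (angle U) ≠ 0 ∧ slope U = Real.tan (angle U)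

/-- `t = cot θ`, with `cot θ` finite. -/
def SlopeIsCot (U : Fin 2 → ℝ) : Prop :=
  Real.sin (angle U) ≠ 0 ∧ slope U = Real.cot (angle U)

/-! ### The polynomials -/

/-- `ω̂ = (ω_{n₀-8N}, …, ω_{n₀+8N})`. -/
def window (N : ℕ) (ω : ℤ → ℝ) (n₀ : ℤ) : Fin (16 * N + 1) → ℝ :=
  fun k => ω (n₀ - 8 * (N : ℤ) + (k : ℕ))

/-- `R_x(X) = f₀(x) + f₁(x) X + ⋯ + f₈(x) X⁸`. -/
def polyR {N : ℕ} (f : Fin 9 → (Fin (16 * N + 1) → ℝ) → ℝ) (x : Fin (16 * N + 1) → ℝ) :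
    Polynomial ℝ :=
  ∑ i : Fin 9, Polynomial.C (f i x) * Polynomial.X ^ (i : ℕ)

/-- `Q_x(X) = f₈(x) + f₇(x) X + ⋯ + f₀(x) X⁸`. -/
def polyQ {N : ℕ} (f : Fin 9 → (Fin (16 * N + 1) → ℝ) → ℝ) (x : Fin (16 * N + 1) → ℝ) :
    Polynomial ℝ :=
  ∑ i : Fin 9, Polynomial.C (f (Fin.rev i) x) * Polynomial.X ^ (i : ℕ)

end Alloy

end

/-!
For a solution `y` of the equation at the energy `E`, the integral `∫ y(m + t)² q(t) dt` is a
quadratic form `q^E_m` in the Cauchy data of `y` at `n₀`. Parseval's identity for the local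
orthonormal bases (`coeffs_sq_add_sq`) says that, up to the common normalization and errors of the
order of the distance between the energies, `r_u(n₀ + m)²` and `r_v(n₀ + m)²` are the values of
`q^F_m` and `q^G_m` at the Cauchy data of `u` and `v` (`siteForm_compare`,
`exists_data_pruferVector`).

Quadratic forms in two variables span a space of dimension three, so the four forms `q^F_0, …,
q^F_3` satisfy a linear relation `∑ κ_m q^F_m = 0` whose coefficients are cofactors, hence analytic
in the couplings. Therefore `∑ κ_m r_u(n₀ + m)²` is small, and since the radii of `u` and `v` agree,
so is `∑ κ_m r_v(n₀ + m)²`; that is, the form `∑ κ_m q^G_m`, written as `d₀ A² + d₁ A B + d₂ B²` in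
the coordinates `(A, B) = r_v(n₀) (sin θ, cos θ)`, is small compared with `r_v(n₀)²`
(`abs_form_le`). Division by `B²` or `A²`, whichever is larger, shows that the slope `t_v` almost
annihilates `d₀ X² + d₁ X + d₂` or `d₂ X² + d₁ X + d₀`. The product of these two polynomials with
`X²` has the palindromic coefficients `f₀, …, f₈`, for which `R` and `Q` coincide, so the angle of
`u` need not be known. The constants in the estimates grow with the couplings, but they are bounded
by an analytic function, and a positive analytic factor absorbs them
(`AnalyticallyBounded.exists_damping`).

Analyticity in the couplings comes from the Volterra equation `y = z + K_b y`: its operator depends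
affinely on the couplings and is quasi-nilpotent, and inversion is analytic.

It remains to see that the form at the energy `G` does not vanish for constant couplings `ω₀` with
`F, G < ω₀ η`. There `y'' = b y` with a positive 1-periodic `b`, and `y y'` is strictly increasing
for every nontrivial solution; hence the monodromy matrix has trace `τ > 2`, and Floquet solutions
have no zeros. The Gram matrices at consecutive sites obey a recurrence with the characteristic
roots `λ²`, `1`, `λ⁻²` (`Hyperbolic.gram_recurrence`), three of them are linearly independent by a
Vandermonde determinant (`Hyperbolic.minor_ne_zero`), and so `κ` is a nonzero multiple of the
coefficients of the recurrence at `F`. On a Floquet solution at `G` the form is then a nonzero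
multiple of `τ_F² - τ_G²`, and the traces differ by a Wronskian argument (`Hyperbolic.trace_ne`).
-/

noncomputable section

namespace Alloy

open MeasureTheory BoundedContinuousFunction

/-! ### Bounded measurable coefficients -/

/-- A bounded measurable coefficient, with an explicit bound. -/
structure BddMeas (b : ℝ → ℝ) (B : ℝ) : Prop where
  meas : Measurable b
  bound : ∀ t, |b t| ≤ B

lemma BddMeas.nonneg {b : ℝ → ℝ} {B : ℝ} (hb : BddMeas b B) : 0 ≤ B :=
  (abs_nonneg _).trans (hb.bound 0)

lemma BddMeas.intervalIntegrable {b : ℝ → ℝ} {B : ℝ} (hb : BddMeas b B) (s t : ℝ) :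
    IntervalIntegrable b volume s t :=
  (intervalIntegrable_const (c := B)).mono_fun hb.meas.aestronglyMeasurable
    (Eventually.of_forall fun x => by
      simpa using (hb.bound x).trans (le_abs_self B))

lemma BddMeas.intervalIntegrable_mul {b : ℝ → ℝ} {B : ℝ} (hb : BddMeas b B) {y : ℝ → ℝ} {s t : ℝ}
    (hy : ContinuousOn y (uIcc s t)) : IntervalIntegrable (fun x => b x * y x) volume s t :=
  (hb.intervalIntegrable s t).mul_continuousOn hy

lemma BddMeas.comp_add {b : ℝ → ℝ} {B : ℝ} (hb : BddMeas b B) (m : ℝ) :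
    BddMeas (fun t => b (m + t)) B :=
  ⟨hb.meas.comp (measurable_const_add m), fun _ => hb.bound _⟩

/-! ### The Volterra operator of the second-order equation -/

lemma isUnit_one_sub_of_norm_pow_le {A : Type*} [NormedRing A] [CompleteSpace A] {x : A} {c : ℝ}
    (h : ∀ n : ℕ, ‖x ^ n‖ ≤ c ^ n / n.factorial) : IsUnit (1 - x) := by
  have hs : Summable fun n : ℕ => x ^ n :=
    Summable.of_norm_bounded (Real.summable_pow_div_factorial c) h
  exact isUnit_iff_exists.2 ⟨_, hs.one_sub_mul_tsum_pow, hs.tsum_pow_mul_one_sub⟩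

lemma norm_inverse_one_sub_le {A : Type*} [NormedRing A] [CompleteSpace A] {x : A} {c : ℝ}
    (h : ∀ n : ℕ, ‖x ^ n‖ ≤ c ^ n / n.factorial) : ‖Ring.inverse (1 - x)‖ ≤ Real.exp c := by
  have hs : Summable fun n : ℕ => x ^ n :=
    Summable.of_norm_bounded (Real.summable_pow_div_factorial c) h
  have hu := isUnit_one_sub_of_norm_pow_le h
  have h1 : Ring.inverse (1 - x) = ∑' n : ℕ, x ^ n := by
    refine hu.mul_left_cancel ?_
    rw [hs.one_sub_mul_tsum_pow, Ring.mul_inverse_cancel _ hu]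
  rw [h1, Real.exp_eq_exp_ℝ, NormedSpace.exp_eq_tsum_div]
  exact tsum_of_norm_bounded (Real.summable_pow_div_factorial c).hasSum h

/-- The projection of the real line onto `[-L, L]`. -/
def clamp (L x : ℝ) : ℝ := max (-L) (min x L)

lemma clamp_continuous (L : ℝ) : Continuous (clamp L) := by unfold clamp; fun_prop

lemma clamp_of_mem {L x : ℝ} (hx : x ∈ Icc (-L) L) : clamp L x = x := by
  unfold clamp; rw [min_eq_left hx.2, max_eq_right hx.1]

lemma clamp_mem {L : ℝ} (hL : 0 ≤ L) (x : ℝ) : clamp L x ∈ Icc (-L) L := by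
  unfold clamp
  exact ⟨le_max_left _ _, max_le (by linarith) (min_le_right _ _)⟩

lemma abs_clamp_le {L : ℝ} (hL : 0 ≤ L) (x : ℝ) : |clamp L x| ≤ L := abs_le.2 (clamp_mem hL x)

/-- The function `clamp L` as a bounded continuous function. -/
def clampFun (L : ℝ) : ℝ →ᵇ ℝ :=
  BoundedContinuousFunction.ofNormedAddCommGroup (clamp L) (clamp_continuous L) |L| (fun x => by
    rcases le_total 0 L with h | h
    · rw [abs_of_nonneg h]; exact abs_clamp_le h x
    · have : clamp L x = -L := by
        unfold clamp; exact max_eq_left ((min_le_right _ _).trans (by linarith))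
      simp [this])

@[simp] lemma clampFun_apply (L x : ℝ) : clampFun L x = clamp L x := rfl

lemma continuous_inner_primitive {b : ℝ → ℝ} {B : ℝ} (hb : BddMeas b B) (y : ℝ →ᵇ ℝ) :
    Continuous fun s => ∫ t in (0 : ℝ)..s, b t * y t :=
  intervalIntegral.continuous_primitive
    (fun _ _ => hb.intervalIntegrable_mul y.continuous.continuousOn) 0

lemma continuous_iterated_primitive {b : ℝ → ℝ} {B : ℝ} (hb : BddMeas b B) (y : ℝ →ᵇ ℝ) :
    Continuous fun x => ∫ s in (0 : ℝ)..x, ∫ t in (0 : ℝ)..s, b t * y t :=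
  intervalIntegral.continuous_primitive
    (fun _ _ => (continuous_inner_primitive hb y).intervalIntegrable _ _) 0

/-- A pointwise bound of a function by a multiple of `|t| ^ n` is integrated once. -/
lemma abs_integral_le_pow {f : ℝ → ℝ} {A : ℝ} {n : ℕ} {x : ℝ}
    (hf : ∀ t ∈ uIoc 0 x, |f t| ≤ A * |t| ^ n / n.factorial) :
    |∫ t in (0 : ℝ)..x, f t| ≤ A * |x| ^ (n + 1) / (n + 1).factorial := by
  have h1 : ‖∫ t in (0 : ℝ)..x, f t‖ ≤ ∫ t in uIoc 0 x, A / n.factorial * |t - 0| ^ n := by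
    rw [intervalIntegral.norm_integral_eq_norm_integral_uIoc]
    refine MeasureTheory.norm_integral_le_of_norm_le ?_ ?_
    · have : IntervalIntegrable (fun t : ℝ => A / n.factorial * |t - 0| ^ n) volume 0 x :=
        Continuous.intervalIntegrable (by fun_prop) _ _
      exact (intervalIntegrable_iff.1 this)
    · refine (ae_restrict_iff' measurableSet_uIoc).2 (Eventually.of_forall fun t ht => ?_)
      have := hf t ht
      rw [Real.norm_eq_abs, sub_zero]
      calc _ ≤ _ := this
        _ = _ := by ring
  rw [MeasureTheory.integral_const_mul, integral_pow_abs_sub_uIoc] at h1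
  rw [← Real.norm_eq_abs]
  refine h1.trans (le_of_eq ?_)
  rw [sub_zero, Nat.factorial_succ]
  push_cast
  field_simp

lemma abs_iterated_le {b : ℝ → ℝ} {B : ℝ} (hb : BddMeas b B) {L : ℝ} (hL : 0 ≤ L) {y : ℝ → ℝ}
    {A : ℝ} {n : ℕ} (hy : ∀ t, |y t| ≤ A * |clamp L t| ^ n / n.factorial) (x : ℝ) :
    |∫ s in (0 : ℝ)..clamp L x, ∫ t in (0 : ℝ)..s, b t * y t|
      ≤ B * A * |clamp L x| ^ (n + 2) / (n + 2).factorial := by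
  have hsub : ∀ s ∈ Icc (-L) L, ∀ t ∈ uIoc 0 s, t ∈ Icc (-L) L := by
    intro s hs t ht
    have h1 : t ∈ uIcc 0 s := uIoc_subset_uIcc ht
    exact (uIcc_subset_Icc ⟨by linarith, hL⟩ hs) h1
  refine abs_integral_le_pow fun s hs => ?_
  have hs' := hsub _ (clamp_mem hL x) s hs
  refine abs_integral_le_pow fun t ht => ?_
  have ht' := hsub _ hs' t ht
  have := hy t
  rw [clamp_of_mem ht'] at this
  rw [abs_mul]
  calc |b t| * |y t| ≤ B * (A * |t| ^ n / n.factorial) :=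
        mul_le_mul (hb.bound t) this (abs_nonneg _) hb.nonneg
    _ = _ := by ring

lemma abs_iterated_le_norm {b : ℝ → ℝ} {B : ℝ} (hb : BddMeas b B) {L : ℝ} (hL : 0 ≤ L)
    (y : ℝ →ᵇ ℝ) (x : ℝ) :
    |∫ s in (0 : ℝ)..clamp L x, ∫ t in (0 : ℝ)..s, b t * y t| ≤ B * L ^ 2 * ‖y‖ := by
  have h := abs_iterated_le hb hL (y := y) (A := ‖y‖) (n := 0)
    (fun t => by simpa using y.norm_coe_le_norm t) x
  have h2 : |clamp L x| ^ 2 ≤ L ^ 2 := pow_le_pow_left₀ (abs_nonneg _) (abs_clamp_le hL x) 2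
  have hB := hb.nonneg
  have hy := norm_nonneg y
  refine h.trans ?_
  have h3 : B * ‖y‖ * |clamp L x| ^ 2 ≤ B * ‖y‖ * L ^ 2 := by gcongr
  have h4 : 0 ≤ B * ‖y‖ * L ^ 2 := by positivity
  simp only [zero_add, Nat.factorial_two]
  push_cast
  linarith

open Classical in
/-- The operator `y ↦ ∫₀ˣ ∫₀ˢ b(t) y(t) dt ds` on bounded continuous functions, cut off outside
`[-L, L]` so that the whole line can serve as the domain of the functions; it is `0` unless `b` is
bounded and measurable and `0 ≤ L`. -/
def volterra (L : ℝ) (b : ℝ → ℝ) : (ℝ →ᵇ ℝ) →L[ℝ] (ℝ →ᵇ ℝ) :=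
  if h : 0 ≤ L ∧ ∃ B, BddMeas b B then
    LinearMap.mkContinuous
      { toFun := fun y => BoundedContinuousFunction.ofNormedAddCommGroup
          (fun x => ∫ s in (0 : ℝ)..clamp L x, ∫ t in (0 : ℝ)..s, b t * y t)
          ((continuous_iterated_primitive h.2.choose_spec y).comp (clamp_continuous L))
          (h.2.choose * L ^ 2 * ‖y‖) (abs_iterated_le_norm h.2.choose_spec h.1 y)
        map_add' := fun y z => by
          ext x
          have hb := h.2.choose_spec
          simp only [BoundedContinuousFunction.coe_ofNormedAddCommGroup,
            BoundedContinuousFunction.coe_add, Pi.add_apply, mul_add]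
          rw [← intervalIntegral.integral_add
            ((continuous_inner_primitive hb y).intervalIntegrable _ _)
            ((continuous_inner_primitive hb z).intervalIntegrable _ _)]
          congr 1
          ext s
          rw [← intervalIntegral.integral_add
            (hb.intervalIntegrable_mul y.continuous.continuousOn)
            (hb.intervalIntegrable_mul z.continuous.continuousOn)]
        map_smul' := fun c y => by
          ext x
          simp only [BoundedContinuousFunction.coe_ofNormedAddCommGroup,
            BoundedContinuousFunction.coe_smul, smul_eq_mul, RingHom.id_apply, mul_left_comm _ c,
            intervalIntegral.integral_const_mul] }
      (h.2.choose * L ^ 2)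
      (fun y => (BoundedContinuousFunction.norm_le
        (by have := h.2.choose_spec.nonneg; positivity)).2
        (abs_iterated_le_norm h.2.choose_spec h.1 y))
  else 0

lemma volterra_apply {L : ℝ} (hL : 0 ≤ L) {b : ℝ → ℝ} {B : ℝ} (hb : BddMeas b B) (y : ℝ →ᵇ ℝ)
    (x : ℝ) :
    volterra L b y x = ∫ s in (0 : ℝ)..clamp L x, ∫ t in (0 : ℝ)..s, b t * y t := by
  have h : 0 ≤ L ∧ ∃ B, BddMeas b B := ⟨hL, B, hb⟩
  unfold volterra
  rw [dif_pos h]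
  rfl

lemma norm_volterra_le {L : ℝ} (hL : 0 ≤ L) {b : ℝ → ℝ} {B : ℝ} (hb : BddMeas b B) :
    ‖volterra L b‖ ≤ B * L ^ 2 := by
  have hB := hb.nonneg
  refine ContinuousLinearMap.opNorm_le_bound _ (by positivity) fun y => ?_
  refine (BoundedContinuousFunction.norm_le (by positivity)).2 fun x => ?_
  rw [volterra_apply hL hb]
  exact abs_iterated_le_norm hb hL y x

lemma abs_volterra_pow_apply_le {L : ℝ} (hL : 0 ≤ L) {b : ℝ → ℝ} {B : ℝ} (hb : BddMeas b B)
    (y : ℝ →ᵇ ℝ) (n : ℕ) (x : ℝ) :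
    |(volterra L b ^ n) y x| ≤ B ^ n * ‖y‖ * |clamp L x| ^ (2 * n) / (2 * n).factorial := by
  induction n generalizing x with
  | zero => simpa using y.norm_coe_le_norm x
  | succ n ih =>
    rw [pow_succ', mul_apply_eq_comp, volterra_apply hL hb]
    refine (abs_iterated_le hb hL ih x).trans (le_of_eq ?_)
    rw [show 2 * (n + 1) = 2 * n + 2 by ring]
    ring

lemma norm_volterra_pow_le {L : ℝ} (hL : 0 ≤ L) {b : ℝ → ℝ} {B : ℝ} (hb : BddMeas b B) (n : ℕ) :
    ‖volterra L b ^ n‖ ≤ (B * L ^ 2) ^ n / n.factorial := by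
  have hB := hb.nonneg
  refine ContinuousLinearMap.opNorm_le_bound _ (by positivity) fun y => ?_
  refine (BoundedContinuousFunction.norm_le (by positivity)).2 fun x => ?_
  refine (abs_volterra_pow_apply_le hL hb y n x).trans ?_
  have h1 : |clamp L x| ^ (2 * n) ≤ L ^ (2 * n) :=
    pow_le_pow_left₀ (abs_nonneg _) (abs_clamp_le hL x) _
  have h2 : (n.factorial : ℝ) ≤ ((2 * n).factorial : ℝ) := by
    exact_mod_cast Nat.factorial_le (by lia)
  have h3 : (0 : ℝ) < n.factorial := by exact_mod_cast Nat.factorial_pos n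
  calc _ ≤ B ^ n * ‖y‖ * L ^ (2 * n) / n.factorial := by gcongr
    _ = _ := by rw [mul_pow, ← pow_mul]; ring

/-- The solution operator `(1 - K_b)⁻¹` of the Volterra equation `y = z + K_b y`. -/
def solOp (L : ℝ) (b : ℝ → ℝ) : (ℝ →ᵇ ℝ) →L[ℝ] (ℝ →ᵇ ℝ) := Ring.inverse (1 - volterra L b)

/-- Volterra operators are quasi-nilpotent, so `1 - K_b` is invertible without any smallness
assumption. -/
lemma isUnit_one_sub_volterra {L : ℝ} (hL : 0 ≤ L) {b : ℝ → ℝ} {B : ℝ} (hb : BddMeas b B) :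
    IsUnit (1 - volterra L b) :=
  isUnit_one_sub_of_norm_pow_le (A := (ℝ →ᵇ ℝ) →L[ℝ] (ℝ →ᵇ ℝ)) (norm_volterra_pow_le hL hb)

lemma norm_solOp_le {L : ℝ} (hL : 0 ≤ L) {b : ℝ → ℝ} {B : ℝ} (hb : BddMeas b B) :
    ‖solOp L b‖ ≤ Real.exp (B * L ^ 2) :=
  norm_inverse_one_sub_le (A := (ℝ →ᵇ ℝ) →L[ℝ] (ℝ →ᵇ ℝ)) (norm_volterra_pow_le hL hb)

lemma solOp_eq {L : ℝ} (hL : 0 ≤ L) {b : ℝ → ℝ} {B : ℝ} (hb : BddMeas b B) (z : ℝ →ᵇ ℝ) :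
    solOp L b z = z + volterra L b (solOp L b z) := by
  have h := Ring.mul_inverse_cancel _ (isUnit_one_sub_volterra hL hb)
  have h2 := congrArg (fun T : (ℝ →ᵇ ℝ) →L[ℝ] (ℝ →ᵇ ℝ) => T z) h
  simp only [mul_apply_eq_comp, _root_.sub_apply,
    one_apply_eq_self] at h2
  exact sub_eq_iff_eq_add.1 h2

lemma eq_solOp {L : ℝ} (hL : 0 ≤ L) {b : ℝ → ℝ} {B : ℝ} (hb : BddMeas b B) {y z : ℝ →ᵇ ℝ}
    (hy : y = z + volterra L b y) : y = solOp L b z := by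
  have h := Ring.inverse_mul_cancel _ (isUnit_one_sub_volterra hL hb)
  have h2 := congrArg (fun T : (ℝ →ᵇ ℝ) →L[ℝ] (ℝ →ᵇ ℝ) => T y) h
  simp only [mul_apply_eq_comp, _root_.sub_apply,
    one_apply_eq_self] at h2
  rw [← h2]
  unfold solOp
  rw [sub_eq_iff_eq_add.2 hy]

/-- Stability of the solution under a perturbation of the coefficient. -/
lemma norm_solOp_sub_le {L : ℝ} (hL : 0 ≤ L) {b b' : ℝ → ℝ} {B δ : ℝ} (hb : BddMeas b B)
    (hb' : BddMeas b' B) (hδ : ∀ t, |b t - b' t| ≤ δ) (z : ℝ →ᵇ ℝ) :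
    ‖solOp L b z - solOp L b' z‖
      ≤ Real.exp (B * L ^ 2) * (δ * L ^ 2 * (Real.exp (B * L ^ 2) * ‖z‖)) := by
  set y := solOp L b z with hy
  set y' := solOp L b' z with hy'
  have hd : BddMeas (fun t => b t - b' t) δ := ⟨hb.meas.sub hb'.meas, hδ⟩
  have hK : volterra L b y' - volterra L b' y' = volterra L (fun t => b t - b' t) y' := by
    ext x
    rw [BoundedContinuousFunction.sub_apply, volterra_apply hL hb, volterra_apply hL hb',
      volterra_apply hL hd, ← intervalIntegral.integral_sub
        ((continuous_inner_primitive hb y').intervalIntegrable _ _)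
        ((continuous_inner_primitive hb' y').intervalIntegrable _ _)]
    congr 1
    ext s
    rw [← intervalIntegral.integral_sub
      (hb.intervalIntegrable_mul y'.continuous.continuousOn)
      (hb'.intervalIntegrable_mul y'.continuous.continuousOn)]
    simp only [sub_mul]
  have h1 : y - y' = volterra L (fun t => b t - b' t) y' + volterra L b (y - y') := by
    rw [← hK, map_sub]
    have e1 := solOp_eq hL hb z
    have e2 := solOp_eq hL hb' z
    rw [← hy] at e1
    rw [← hy'] at e2
    nth_rewrite 1 [e1]
    nth_rewrite 1 [e2]
    abel
  rw [eq_solOp hL hb h1]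
  have hδ0 := hd.nonneg
  calc _ ≤ ‖solOp L b‖ * ‖volterra L (fun t => b t - b' t) y'‖ :=
        ContinuousLinearMap.le_opNorm _ _
    _ ≤ Real.exp (B * L ^ 2) * (δ * L ^ 2 * (Real.exp (B * L ^ 2) * ‖z‖)) := by
      gcongr
      · exact norm_solOp_le hL hb
      · refine (ContinuousLinearMap.le_opNorm _ _).trans ?_
        gcongr
        · exact norm_volterra_le hL hd
        · refine (ContinuousLinearMap.le_opNorm _ _).trans ?_
          gcongr
          exact norm_solOp_le hL hb'

/-! ### Solutions of `y'' = b y` as pairs `(y, y')` -/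

/-- `(y, y')` solves `y'' = b y` on `[α, β]`, in the integrated form that makes sense for a merely
bounded and measurable `b`. No base point is singled out, so that restriction and translation of
the interval are immediate. -/
structure Sol (b : ℝ → ℝ) (α β : ℝ) (y y' : ℝ → ℝ) : Prop where
  cont : ContinuousOn y (Icc α β)
  cont' : ContinuousOn y' (Icc α β)
  eq : ∀ s ∈ Icc α β, ∀ t ∈ Icc α β, y t - y s = ∫ x in s..t, y' x
  eq' : ∀ s ∈ Icc α β, ∀ t ∈ Icc α β, y' t - y' s = ∫ x in s..t, b x * y x

namespace Sol

variable {b c y y' z z' : ℝ → ℝ} {α β : ℝ}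

lemma mono (h : Sol b α β y y') {α₁ β₁ : ℝ} (h₁ : α ≤ α₁) (h₂ : β₁ ≤ β) : Sol b α₁ β₁ y y' := by
  have hs : Icc α₁ β₁ ⊆ Icc α β := Icc_subset_Icc h₁ h₂
  exact ⟨h.cont.mono hs, h.cont'.mono hs, fun s hs' t ht => h.eq s (hs hs') t (hs ht),
    fun s hs' t ht => h.eq' s (hs hs') t (hs ht)⟩

lemma congr_coeff (h : Sol b α β y y') (hbc : ∀ x ∈ Icc α β, c x = b x) : Sol c α β y y' := by
  refine ⟨h.cont, h.cont', h.eq, fun s hs t ht => ?_⟩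
  rw [h.eq' s hs t ht]
  refine intervalIntegral.integral_congr fun x hx => ?_
  simp only [hbc x (uIcc_subset_Icc hs ht hx)]

lemma shift (h : Sol b α β y y') (m : ℝ) :
    Sol (fun t => b (m + t)) (α - m) (β - m) (fun t => y (m + t)) (fun t => y' (m + t)) := by
  have hm : ∀ t ∈ Icc (α - m) (β - m), m + t ∈ Icc α β := fun t ht =>
    ⟨by linarith [ht.1], by linarith [ht.2]⟩
  refine ⟨h.cont.comp (by fun_prop) hm, h.cont'.comp (by fun_prop) hm, fun s hs t ht => ?_,
    fun s hs t ht => ?_⟩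
  · rw [h.eq _ (hm s hs) _ (hm t ht), intervalIntegral.integral_comp_add_left (fun x => y' x)]
  · rw [h.eq' _ (hm s hs) _ (hm t ht),
      intervalIntegral.integral_comp_add_left (fun x => b x * y x)]

lemma hasDerivWithinAt (h : Sol b α β y y') {x : ℝ} (hx : x ∈ Icc α β) :
    HasDerivWithinAt y (y' x) (Icc α β) x := by
  have hαβ : α ≤ β := hx.1.trans hx.2
  have hg : Continuous (IccExtend hαβ (fun t : Icc α β => y' t)) :=
    (continuousOn_iff_continuous_domRestrict.1 h.cont').Icc_extend'
  have hgx : ∀ t ∈ Icc α β, IccExtend hαβ (fun t : Icc α β => y' t) t = y' t := fun t ht => by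
    rw [IccExtend_of_mem hαβ _ ht]
  have h1 : HasDerivAt (fun u => y x + ∫ t in x..u, IccExtend hαβ (fun t : Icc α β => y' t) t)
      (y' x) x := by
    have := (hg.integral_hasStrictDerivAt x x).hasDerivAt.const_add (y x)
    rwa [hgx x hx] at this
  refine h1.hasDerivWithinAt.congr (fun t ht => ?_) (by simp)
  have h2 := h.eq x hx t ht
  rw [intervalIntegral.integral_congr
    (g := y') (fun u hu => hgx u (uIcc_subset_Icc hx ht hu))]
  linarith

lemma hasDerivAt (h : Sol b α β y y') {x : ℝ} (hx : x ∈ Ioo α β) : HasDerivAt y (y' x) x :=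
  (h.hasDerivWithinAt (Ioo_subset_Icc_self hx)).hasDerivAt (Icc_mem_nhds hx.1 hx.2)

lemma hasDerivAt' {B : ℝ} (hb : BddMeas b B) (h : Sol b α β y y') {x : ℝ} (hx : x ∈ Ioo α β)
    (hc : ContinuousAt b x) : HasDerivAt y' (b x * y x) x := by
  have hx' := Ioo_subset_Icc_self hx
  have hαβ : α ≤ β := hx'.1.trans hx'.2
  -- `y` is replaced by a globally continuous extension, to have measurability near `x`
  set g := IccExtend hαβ (fun t : Icc α β => y t) with hgdef
  have hg : Continuous g := (continuousOn_iff_continuous_domRestrict.1 h.cont).Icc_extend'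
  have hgx : ∀ t ∈ Icc α β, g t = y t := fun t ht => by rw [hgdef, IccExtend_of_mem hαβ _ ht]
  have h1 : HasDerivAt (fun u => y' x + ∫ t in x..u, b t * g t) (b x * y x) x := by
    have := (intervalIntegral.integral_hasDerivAt_right (a := x) (b := x)
      (f := fun t => b t * g t) (hb.intervalIntegrable_mul hg.continuousOn)
      ((hb.meas.mul hg.measurable).stronglyMeasurable.stronglyMeasurableAtFilter)
      (hc.mul hg.continuousAt)).const_add (y' x)
    rwa [hgx x hx'] at this
  refine h1.congr_of_eventuallyEq ?_
  filter_upwards [Icc_mem_nhds hx.1 hx.2] with t ht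
  have h2 := h.eq' x hx' t ht
  rw [intervalIntegral.integral_congr (g := fun t => b t * y t)
    (fun u hu => by simp only [hgx u (uIcc_subset_Icc hx' ht hu)])]
  linarith

/-- Integration by parts for `y' z`, the source of all Wronskian and convexity arguments below. -/
lemma integral_by_parts {B : ℝ} (hb : BddMeas b B) {S : Set ℝ} (hS : S.Countable)
    (hbS : ∀ x ∉ S, ContinuousAt b x) (h : Sol b α β y y') (k : Sol c α β z z') {s t : ℝ}
    (hs : s ∈ Icc α β) (ht : t ∈ Icc α β) :
    ∫ x in s..t, (b x * y x * z x + y' x * z' x) = y' t * z t - y' s * z s := by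
  have hsub := uIcc_subset_Icc hs ht
  refine MeasureTheory.integral_eq_of_hasDerivAt_off_countable (fun x => y' x * z x)
    (fun x => b x * y x * z x + y' x * z' x) hS
    ((h.cont'.mul k.cont).mono hsub) (fun x hx => ?_) ?_
  · have hx' : x ∈ Ioo α β :=
      ⟨(le_min hs.1 ht.1).trans_lt hx.1.1, hx.1.2.trans_le (max_le hs.2 ht.2)⟩
    exact (h.hasDerivAt' hb hx' (hbS x hx.2)).mul (k.hasDerivAt hx')
  · refine IntervalIntegrable.add ?_ ?_
    · have := hb.intervalIntegrable_mul ((h.cont.mul k.cont).mono hsub)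
      simpa only [mul_assoc, Pi.mul_apply] using this
    · exact ((h.cont'.mul k.cont').mono hsub).intervalIntegrable

end Sol

/-- The affine function `c₀ + c₁ x`, cut off outside `[-L, L]`: the solution of `y'' = 0` with
Cauchy data `(c₀, c₁)` at the origin. -/
def initFun (L c₀ c₁ : ℝ) : ℝ →ᵇ ℝ := BoundedContinuousFunction.const ℝ c₀ + c₁ • clampFun L

lemma initFun_apply (L c₀ c₁ x : ℝ) : initFun L c₀ c₁ x = c₀ + c₁ * clamp L x := by
  simp [initFun]

lemma initFun_eq (L c₀ c₁ : ℝ) : initFun L c₀ c₁ = c₀ • initFun L 1 0 + c₁ • initFun L 0 1 := by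
  ext x
  simp [initFun_apply]

lemma norm_initFun_le {L : ℝ} (hL : 0 ≤ L) (c₀ c₁ : ℝ) :
    ‖initFun L c₀ c₁‖ ≤ (1 + L) * (|c₀| + |c₁|) := by
  refine (BoundedContinuousFunction.norm_le (by positivity)).2 fun x => ?_
  rw [initFun_apply, Real.norm_eq_abs]
  have h1 := abs_add_le c₀ (c₁ * clamp L x)
  rw [abs_mul] at h1
  have h2 := mul_le_mul_of_nonneg_left (abs_clamp_le hL x) (abs_nonneg c₁)
  nlinarith [abs_nonneg c₀, abs_nonneg c₁, mul_nonneg hL (abs_nonneg c₀)]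

/-- The solution of `y'' = b y` on `[-L, L]` with Cauchy data `(c₀, c₁)` at the origin. -/
def cauchySol (L : ℝ) (b : ℝ → ℝ) (c₀ c₁ : ℝ) : ℝ →ᵇ ℝ := solOp L b (initFun L c₀ c₁)

/-- The derivative of `cauchySol` on `[-L, L]`. -/
def cauchySol' (L : ℝ) (b : ℝ → ℝ) (c₀ c₁ s : ℝ) : ℝ :=
  c₁ + ∫ t in (0 : ℝ)..s, b t * cauchySol L b c₀ c₁ t

lemma cauchySol_eq (L : ℝ) (b : ℝ → ℝ) (c₀ c₁ : ℝ) :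
    cauchySol L b c₀ c₁ = c₀ • cauchySol L b 1 0 + c₁ • cauchySol L b 0 1 := by
  unfold cauchySol
  rw [initFun_eq, map_add, map_smul, map_smul]

lemma cauchySol_apply_eq (L : ℝ) (b : ℝ → ℝ) (c₀ c₁ x : ℝ) :
    cauchySol L b c₀ c₁ x = c₀ * cauchySol L b 1 0 x + c₁ * cauchySol L b 0 1 x := by
  rw [cauchySol_eq]; simp

lemma norm_cauchySol_le {L : ℝ} (hL : 0 ≤ L) {b : ℝ → ℝ} {B : ℝ} (hb : BddMeas b B) (c₀ c₁ : ℝ) :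
    ‖cauchySol L b c₀ c₁‖ ≤ Real.exp (B * L ^ 2) * ((1 + L) * (|c₀| + |c₁|)) := by
  refine (ContinuousLinearMap.le_opNorm _ _).trans ?_
  gcongr
  · exact norm_solOp_le hL hb
  · exact norm_initFun_le hL _ _

section

variable {L : ℝ} {b : ℝ → ℝ} {B : ℝ}

lemma cauchySol_formula (hL : 0 ≤ L) (hb : BddMeas b B) (c₀ c₁ : ℝ) {x : ℝ}
    (hx : x ∈ Icc (-L) L) :
    cauchySol L b c₀ c₁ x = c₀ + ∫ s in (0 : ℝ)..x, cauchySol' L b c₀ c₁ s := by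
  have h := congrArg (fun f : ℝ →ᵇ ℝ => f x) (solOp_eq hL hb (initFun L c₀ c₁))
  simp only [BoundedContinuousFunction.add_apply, volterra_apply hL hb, initFun_apply,
    clamp_of_mem hx] at h
  unfold cauchySol'
  rw [intervalIntegral.integral_add intervalIntegrable_const
    ((continuous_inner_primitive hb _).intervalIntegrable _ _), intervalIntegral.integral_const]
  simp only [sub_zero, smul_eq_mul]
  change solOp L b (initFun L c₀ c₁) x = _
  rw [h]
  unfold cauchySol
  ring

lemma cauchySol'_continuous (hb : BddMeas b B) (c₀ c₁ : ℝ) :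
    Continuous (cauchySol' L b c₀ c₁) :=
  continuous_const.add (continuous_inner_primitive hb _)

lemma cauchySol_zero (hL : 0 ≤ L) (hb : BddMeas b B) (c₀ c₁ : ℝ) :
    cauchySol L b c₀ c₁ 0 = c₀ := by
  rw [cauchySol_formula hL hb c₀ c₁ ⟨by linarith, hL⟩]; simp

lemma cauchySol'_zero (L : ℝ) (b : ℝ → ℝ) (c₀ c₁ : ℝ) : cauchySol' L b c₀ c₁ 0 = c₁ := by
  simp [cauchySol']

lemma sol_cauchySol (hL : 0 ≤ L) (hb : BddMeas b B) (c₀ c₁ : ℝ) :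
    Sol b (-L) L (cauchySol L b c₀ c₁) (cauchySol' L b c₀ c₁) := by
  refine ⟨(cauchySol L b c₀ c₁).continuous.continuousOn,
    (cauchySol'_continuous hb c₀ c₁).continuousOn, fun s hs t ht => ?_, fun s hs t ht => ?_⟩
  · rw [cauchySol_formula hL hb c₀ c₁ hs, cauchySol_formula hL hb c₀ c₁ ht,
      add_sub_add_left_eq_sub]
    exact intervalIntegral.integral_interval_sub_left
      ((cauchySol'_continuous hb c₀ c₁).intervalIntegrable _ _)
      ((cauchySol'_continuous hb c₀ c₁).intervalIntegrable _ _)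
  · unfold cauchySol'
    rw [add_sub_add_left_eq_sub]
    exact intervalIntegral.integral_interval_sub_left
      (hb.intervalIntegrable_mul (cauchySol L b c₀ c₁).continuous.continuousOn)
      (hb.intervalIntegrable_mul (cauchySol L b c₀ c₁).continuous.continuousOn)

/-- Uniqueness: a solution on `[-L, L]` is determined by its Cauchy data at the origin. -/
lemma Sol.eq_cauchySol (hL : 0 ≤ L) (hb : BddMeas b B) {y y' : ℝ → ℝ} (h : Sol b (-L) L y y')
    {x : ℝ} (hx : x ∈ Icc (-L) L) : y x = cauchySol L b (y 0) (y' 0) x := by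
  have h0 : (0 : ℝ) ∈ Icc (-L) L := ⟨by linarith, hL⟩
  have hc : Continuous fun x => y (clamp L x) :=
    h.cont.comp_continuous (clamp_continuous L) (clamp_mem hL)
  obtain ⟨C, hC⟩ := isCompact_Icc.exists_bound_of_continuousOn h.cont
  let Y : ℝ →ᵇ ℝ := BoundedContinuousFunction.ofNormedAddCommGroup _ hc C
    (fun x => hC _ (clamp_mem hL x))
  have hY : ∀ t, Y t = y (clamp L t) := fun _ => rfl
  have hYeq : Y = initFun L (y 0) (y' 0) + volterra L b Y := by
    ext t
    have ht := clamp_mem hL t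
    rw [BoundedContinuousFunction.add_apply, volterra_apply hL hb, initFun_apply, hY]
    have e1 := h.eq 0 h0 _ ht
    have e2 : ∫ s in (0 : ℝ)..clamp L t, y' s
        = ∫ s in (0 : ℝ)..clamp L t, (y' 0 + ∫ r in (0 : ℝ)..s, b r * Y r) := by
      refine intervalIntegral.integral_congr fun s hs => ?_
      have hs' := uIcc_subset_Icc h0 ht hs
      have e3 := h.eq' 0 h0 s hs'
      have e4 : ∫ r in (0 : ℝ)..s, b r * Y r = ∫ r in (0 : ℝ)..s, b r * y r := by
        refine intervalIntegral.integral_congr fun r hr => ?_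
        simp only [hY, clamp_of_mem (uIcc_subset_Icc h0 hs' hr)]
      simp only [e4]
      linarith
    rw [e2, intervalIntegral.integral_add intervalIntegrable_const
      ((continuous_inner_primitive hb _).intervalIntegrable _ _),
      intervalIntegral.integral_const] at e1
    simp only [sub_zero, smul_eq_mul] at e1
    linarith
  have := eq_solOp hL hb hYeq
  rw [cauchySol, ← this, hY, clamp_of_mem hx]

end

/-! ### Comparison with the notion of solution on an interval -/

lemma IsSolutionOn.sol {W : ℝ → ℝ} {E α β : ℝ} {y : ℝ → ℝ} (h : IsSolutionOn W E α β y)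
    (hαβ : α < β) {b : ℝ → ℝ} {B : ℝ} (hb : BddMeas b B) (hbW : ∀ x ∈ Icc α β, b x = W x - E) :
    Sol b α β y (derivWithin y (Icc α β)) := by
  have hc' : ContinuousOn (derivWithin y (Icc α β)) (Icc α β) :=
    h.contDiffOn.continuousOn_derivWithin (uniqueDiffOn_Icc hαβ) le_rfl
  have hα : α ∈ Icc α β := left_mem_Icc.2 hαβ.le
  refine ⟨h.contDiffOn.continuousOn, hc', fun s hs t ht => ?_, fun s hs t ht => ?_⟩
  · have hsub := uIcc_subset_Icc hs ht
    refine (MeasureTheory.integral_eq_of_hasDerivAt_off_countable y _ countable_empty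
      (h.contDiffOn.continuousOn.mono hsub) (fun x hx => ?_)
      (hc'.mono hsub).intervalIntegrable).symm
    have hx' : x ∈ Ioo α β :=
      ⟨(le_min hs.1 ht.1).trans_lt hx.1.1, hx.1.2.trans_le (max_le hs.2 ht.2)⟩
    exact ((h.contDiffOn.differentiableOn one_ne_zero x
      (Ioo_subset_Icc_self hx')).hasDerivWithinAt).hasDerivAt (Icc_mem_nhds hx'.1 hx'.2)
  · have key : ∀ u ∈ Icc α β, ∫ t in α..u, (W t - E) * y t = ∫ t in α..u, b t * y t := by
      intro u hu
      refine intervalIntegral.integral_congr fun r hr => ?_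
      simp only [hbW r (uIcc_subset_Icc hα hu hr)]
    rw [h.deriv_eq s hs, h.deriv_eq t ht, add_sub_add_left_eq_sub, key s hs, key t ht]
    exact intervalIntegral.integral_interval_sub_left
      (hb.intervalIntegrable_mul (h.contDiffOn.continuousOn.mono (uIcc_subset_Icc hα ht)))
      (hb.intervalIntegrable_mul (h.contDiffOn.continuousOn.mono (uIcc_subset_Icc hα hs)))

lemma Sol.isSolutionOn {W : ℝ → ℝ} {E α β : ℝ} {y y' b : ℝ → ℝ} (h : Sol b α β y y')
    (hαβ : α < β) (hbW : ∀ x ∈ Icc α β, b x = W x - E) : IsSolutionOn W E α β y := by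
  have hu := uniqueDiffOn_Icc hαβ
  have hd : ∀ x ∈ Icc α β, derivWithin y (Icc α β) x = y' x := fun x hx =>
    (h.hasDerivWithinAt hx).derivWithin (hu x hx)
  have hα : α ∈ Icc α β := left_mem_Icc.2 hαβ.le
  refine ⟨?_, fun x hx => ?_⟩
  · rw [contDiffOn_one_iff_derivWithin hu]
    exact ⟨fun x hx => (h.hasDerivWithinAt hx).differentiableWithinAt, h.cont'.congr hd⟩
  · rw [hd x hx, hd α hα]
    have h1 := h.eq' α hα x hx
    have h2 : ∫ t in α..x, (W t - E) * y t = ∫ t in α..x, b t * y t := by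
      refine intervalIntegral.integral_congr fun r hr => ?_
      simp only [hbW r (uIcc_subset_Icc hα hx hr)]
    linarith

/-- `solutionAt` is the solution of the Cauchy problem at the origin. -/
lemma solutionAt_spec {W : ℝ → ℝ} {E : ℝ} {N : ℕ} (hN : 1 ≤ N) {b : ℝ → ℝ} {B : ℝ}
    (hb : BddMeas b B) (hbW : ∀ x ∈ Icc (-(N : ℝ)) N, b x = W x - E) (c₀ c₁ : ℝ) :
    (∀ x ∈ Icc (-(N : ℝ)) N, solutionAt W E N c₀ c₁ x = cauchySol N b c₀ c₁ x) ∧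
      HasDerivAt (solutionAt W E N c₀ c₁) c₁ 0 := by
  have hN' : (0 : ℝ) < N := by exact_mod_cast hN
  have h0 : (0 : ℝ) ∈ Ioo (-(N : ℝ)) N := ⟨by linarith, hN'⟩
  have hlt : -(N : ℝ) < N := by linarith
  have hex : ∃ y, IsSolutionOn W E (-(N : ℝ)) N y ∧ y 0 = c₀ ∧ deriv y 0 = c₁ := by
    have hs := sol_cauchySol hN'.le hb c₀ c₁
    refine ⟨_, hs.isSolutionOn hlt hbW, cauchySol_zero hN'.le hb _ _, ?_⟩
    rw [(hs.hasDerivAt h0).deriv, cauchySol'_zero]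
  obtain ⟨h1, h2, h3⟩ := Classical.epsilon_spec hex
  have hs := h1.sol hlt hb hbW
  have hd := hs.hasDerivAt h0
  have hd' := hd.deriv.symm.trans h3
  change HasDerivAt (solutionAt W E N c₀ c₁) _ 0 at hd
  rw [hd'] at hd
  refine ⟨fun x hx => ?_, hd⟩
  have := hs.eq_cauchySol hN'.le hb hx
  rw [h2, hd'] at this
  exact this

/-! ### The single-site potential -/

lemma PiecewiseContinuous.measurable {q : ℝ → ℝ} (hq : PiecewiseContinuous q) : Measurable q := by
  obtain ⟨S, hS, -⟩ := hq
  refine measurable_of_restrict_of_restrict_compl S.finite_toSet.measurableSet ?_ ?_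
  · exact measurable_of_countable _
  · refine Continuous.measurable (continuousOn_iff_continuous_domRestrict.1 fun x hx => ?_)
    exact (hS x (by simpa using hx)).continuousWithinAt

namespace SingleSite

variable {q : ℝ → ℝ} {N : ℕ} {η : ℝ}

lemma nonneg (hq : SingleSite q N η) (x : ℝ) : 0 ≤ q x := by
  refine le_trans ?_ (hq.lower x)
  exact indicator_nonneg (fun _ _ => hq.eta_pos.le) x

lemma eta_le (hq : SingleSite q N η) {x : ℝ} (hx : x ∈ Icc (-1 / 2 : ℝ) (1 / 2)) : η ≤ q x := by
  have := hq.lower x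
  rwa [indicator_of_mem hx] at this

lemma eq_zero (hq : SingleSite q N η) {x : ℝ} (hx : x ∉ Icc (-(N : ℝ)) N) : q x = 0 := by
  have := hq.upper x
  rw [indicator_of_notMem hx] at this
  exact le_antisymm this (hq.nonneg x)

lemma bddMeas (hq : SingleSite q N η) : BddMeas q (1 / η) := by
  refine ⟨hq.piecewise.measurable, fun x => ?_⟩
  rw [abs_of_nonneg (hq.nonneg x)]
  refine (hq.upper x).trans (indicator_le_self' (fun _ _ => ?_) x)
  exact (one_div_pos.2 hq.eta_pos).le

lemma one_le_cast (hq : SingleSite q N η) : (1 : ℝ) ≤ N := by exact_mod_cast hq.one_le_N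

lemma integral_pos (hq : SingleSite q N η) {g : ℝ → ℝ} (hg : ContinuousOn g (Icc (-(N : ℝ)) N))
    (h0 : ∀ x ∈ Icc (-(N : ℝ)) N, 0 ≤ g x) {x₀ : ℝ} (hx₀ : x₀ ∈ Icc (-1 / 2 : ℝ) (1 / 2))
    (hpos : 0 < g x₀) : 0 < ∫ t in (-(N : ℝ))..N, g t * q t := by
  have hN := hq.one_le_cast
  have hsub : Icc (-1 / 2 : ℝ) (1 / 2) ⊆ Icc (-(N : ℝ)) N :=
    Icc_subset_Icc (by linarith) (by linarith)
  have hle : -(N : ℝ) ≤ N := by linarith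
  have hint : IntervalIntegrable (fun t => g t * q t) volume (-(N : ℝ)) N := by
    have := hq.bddMeas.intervalIntegrable_mul (y := g) (s := -(N : ℝ)) (t := N)
      (by rwa [uIcc_of_le hle])
    simpa only [mul_comm] using this
  have hgc : ContinuousOn g (Icc (-1 / 2 : ℝ) (1 / 2)) := hg.mono hsub
  have h1 : 0 < ∫ t in (-1 / 2 : ℝ)..(1 / 2), η * g t := by
    refine intervalIntegral.integral_pos (by norm_num) (by fun_prop)
      (fun x hx => mul_nonneg hq.eta_pos.le (h0 x (hsub (Ioc_subset_Icc_self hx))))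
      ⟨x₀, hx₀, mul_pos hq.eta_pos hpos⟩
  refine h1.trans_le ?_
  have h2 : ∫ t in (-1 / 2 : ℝ)..(1 / 2), η * g t ≤ ∫ t in (-1 / 2 : ℝ)..(1 / 2), g t * q t := by
    refine intervalIntegral.integral_mono_on (by norm_num) ?_ ?_ fun x hx => ?_
    · refine ContinuousOn.intervalIntegrable ?_
      rw [uIcc_of_le (by norm_num)]
      fun_prop
    · refine hint.mono_set ?_
      rw [uIcc_of_le (by norm_num), uIcc_of_le hle]
      exact hsub
    · rw [mul_comm]
      exact mul_le_mul_of_nonneg_left (hq.eta_le hx) (h0 x (hsub hx))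
  refine h2.trans ?_
  refine intervalIntegral.integral_mono_interval (by linarith) (by norm_num) (by linarith) ?_ hint
  refine (ae_restrict_iff' measurableSet_Ioc).2 (Eventually.of_forall fun x hx => ?_)
  exact mul_nonneg (h0 x (Ioc_subset_Icc_self hx)) (hq.nonneg x)

/-- A nontrivial solution has positive `q`-norm. -/
lemma qInner_self_pos (hq : SingleSite q N η) {b y y' : ℝ → ℝ} (h : Sol b (-(N : ℝ)) N y y')
    (h0 : y 0 ≠ 0 ∨ y' 0 ≠ 0) : 0 < qInner q N y y := by
  have hN := hq.one_le_cast
  have hex : ∃ x₀ ∈ Icc (-1 / 2 : ℝ) (1 / 2), y x₀ ≠ 0 := by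
    by_contra! hcon
    rcases h0 with h0 | h0
    · exact h0 (hcon 0 (by norm_num))
    · have hd := h.hasDerivAt (x := 0) ⟨by linarith, by linarith⟩
      refine h0 (hd.unique ((hasDerivAt_const (0 : ℝ) (0 : ℝ)).congr_of_eventuallyEq ?_))
      filter_upwards [Icc_mem_nhds (show (-1 / 2 : ℝ) < 0 by norm_num)
        (show (0 : ℝ) < 1 / 2 by norm_num)] with x hx using hcon x hx
  obtain ⟨x₀, hx₀, hy⟩ := hex
  exact hq.integral_pos (g := fun t => y t * y t) (h.cont.mul h.cont)
    (fun x _ => mul_self_nonneg _) hx₀ (mul_self_pos.2 hy)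

end SingleSite

/-! ### Integration against the single-site potential -/

lemma qInner_congr {q : ℝ → ℝ} {N : ℕ} {f g f₁ g₁ : ℝ → ℝ}
    (hf : ∀ x ∈ Icc (-(N : ℝ)) N, f x = f₁ x) (hg : ∀ x ∈ Icc (-(N : ℝ)) N, g x = g₁ x) :
    qInner q N f g = qInner q N f₁ g₁ := by
  refine intervalIntegral.integral_congr fun x hx => ?_
  rw [uIcc_of_le (by have := Nat.cast_nonneg (α := ℝ) N; linarith)] at hx
  simp only [hf x hx, hg x hx]

variable {q : ℝ → ℝ} {N : ℕ} {η : ℝ}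

lemma SingleSite.intervalIntegrable_mul (hq : SingleSite q N η) {g : ℝ → ℝ}
    (hg : ContinuousOn g (Icc (-(N : ℝ)) N)) :
    IntervalIntegrable (fun t => g t * q t) volume (-(N : ℝ)) N := by
  have hN := hq.one_le_cast
  have := hq.bddMeas.intervalIntegrable_mul (y := g) (s := -(N : ℝ)) (t := N)
    (by rwa [uIcc_of_le (by linarith)])
  simpa only [mul_comm] using this

lemma qInner_lin (hq : SingleSite q N η) {f g : ℝ → ℝ} (hf : ContinuousOn f (Icc (-(N : ℝ)) N))
    (hg : ContinuousOn g (Icc (-(N : ℝ)) N)) (a b c d : ℝ) :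
    qInner q N (fun x => a * f x + b * g x) (fun x => c * f x + d * g x)
      = a * c * qInner q N f f + (a * d + b * c) * qInner q N f g + b * d * qInner q N g g := by
  unfold qInner
  have e : ∀ t, (a * f t + b * g t) * (c * f t + d * g t) * q t
      = (a * c * (f t * f t * q t) + (a * d + b * c) * (f t * g t * q t))
        + b * d * (g t * g t * q t) := fun t => by ring
  simp only [e]
  have i1 := (hq.intervalIntegrable_mul (hf.mul hf)).const_mul (a * c)
  have i2 := (hq.intervalIntegrable_mul (hf.mul hg)).const_mul (a * d + b * c)
  have i3 := (hq.intervalIntegrable_mul (hg.mul hg)).const_mul (b * d)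
  simp only [Pi.mul_apply] at i1 i2 i3
  rw [intervalIntegral.integral_add (i1.add i2) i3, intervalIntegral.integral_add i1 i2]
  simp only [intervalIntegral.integral_const_mul]

lemma abs_qInner_le (hq : SingleSite q N η) {f g : ℝ → ℝ} {P Q : ℝ}
    (hf : ∀ x ∈ Icc (-(N : ℝ)) N, |f x| ≤ P) (hg : ∀ x ∈ Icc (-(N : ℝ)) N, |g x| ≤ Q) :
    |qInner q N f g| ≤ 2 * N / η * (P * Q) := by
  have hN := hq.one_le_cast
  have hle : -(N : ℝ) ≤ N := by linarith
  have h := intervalIntegral.norm_integral_le_of_norm_le_const (a := -(N : ℝ)) (b := N)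
    (f := fun t => f t * g t * q t) (C := P * Q * (1 / η)) (fun x hx => by
      rw [uIoc_of_le hle] at hx
      have hx' := Ioc_subset_Icc_self hx
      have hP := (abs_nonneg _).trans (hf x hx')
      have hQ := (abs_nonneg _).trans (hg x hx')
      rw [Real.norm_eq_abs, abs_mul, abs_mul]
      exact mul_le_mul (mul_le_mul (hf x hx') (hg x hx') (abs_nonneg _) hP) (hq.bddMeas.bound x)
        (abs_nonneg _) (mul_nonneg hP hQ))
  rw [Real.norm_eq_abs, show (N : ℝ) - -N = 2 * N by ring,
    abs_of_nonneg (by linarith : (0 : ℝ) ≤ 2 * N)] at h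
  refine h.trans (le_of_eq ?_)
  ring

/-- A quadratic `q`-functional is Lipschitz on bounded sets. -/
lemma abs_qInner_self_sub_le (hq : SingleSite q N η) {f g : ℝ → ℝ} {P δ : ℝ}
    (hf : ContinuousOn f (Icc (-(N : ℝ)) N)) (hg : ContinuousOn g (Icc (-(N : ℝ)) N))
    (hfP : ∀ x ∈ Icc (-(N : ℝ)) N, |f x| ≤ P) (hgP : ∀ x ∈ Icc (-(N : ℝ)) N, |g x| ≤ P)
    (hfg : ∀ x ∈ Icc (-(N : ℝ)) N, |f x - g x| ≤ δ) :
    |qInner q N f f - qInner q N g g| ≤ 2 * N / η * (δ * (2 * P)) := by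
  have e : qInner q N f f - qInner q N g g
      = qInner q N (fun x => 1 * f x + (-1) * g x) (fun x => 1 * f x + 1 * g x) := by
    rw [qInner_lin hq hf hg]; ring
  rw [e]
  refine abs_qInner_le hq (fun x hx => ?_) (fun x hx => ?_)
  · rw [show 1 * f x + (-1) * g x = f x - g x by ring]; exact hfg x hx
  · have := abs_add_le (1 * f x) (1 * g x)
    rw [one_mul, one_mul] at this
    rw [one_mul, one_mul]
    linarith [hfP x hx, hgP x hx]

/-- The functional `f ↦ ∫ f(m + t) q(t) dt`, integration against the single-site potential placed
at `m`. -/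
def siteInt (hq : SingleSite q N η) (m : ℝ) : (ℝ →ᵇ ℝ) →L[ℝ] ℝ :=
  LinearMap.mkContinuous
    { toFun := fun f => ∫ t in (-(N : ℝ))..N, f (m + t) * q t
      map_add' := fun f g => by
        rw [← intervalIntegral.integral_add
          (hq.intervalIntegrable_mul (g := fun t => f (m + t))
            (f.continuous.comp (continuous_const_add m)).continuousOn)
          (hq.intervalIntegrable_mul (g := fun t => g (m + t))
            (g.continuous.comp (continuous_const_add m)).continuousOn)]
        simp only [BoundedContinuousFunction.add_apply, add_mul]
      map_smul' := fun c f => by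
        simp only [BoundedContinuousFunction.coe_smul, smul_eq_mul, RingHom.id_apply, mul_assoc,
          intervalIntegral.integral_const_mul] }
    (2 * N / η)
    (fun f => by
      have h := abs_qInner_le hq (f := fun t => f (m + t)) (g := fun _ => 1) (P := ‖f‖) (Q := 1)
        (fun x _ => f.norm_coe_le_norm _) (fun x _ => by simp)
      simp only [qInner, mul_one] at h
      exact h)

lemma siteInt_mul (hq : SingleSite q N η) (m : ℝ) (f g : ℝ →ᵇ ℝ) :
    siteInt hq m (f * g) = qInner q N (fun t => f (m + t)) (fun t => g (m + t)) := rfl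

/-! ### The potential near a site -/

/-- The potential `∑ x_k q(t - (k - 8N))` of a finite window of couplings, in the coordinate `t`
that is centred at the middle of the window. -/
def wpot (q : ℝ → ℝ) (N : ℕ) (x : Fin (16 * N + 1) → ℝ) (t : ℝ) : ℝ :=
  ∑ k, x k * q (t + 8 * N - (k : ℕ))

lemma potential_eq_wpot (hq : SingleSite q N η) (ω : ℤ → ℝ) (n₀ : ℤ) {t : ℝ}
    (ht : t ∈ Icc (-(7 * N : ℝ)) (7 * N)) :
    potential q ω (n₀ + t) = wpot q N (window N ω n₀) t := by
  unfold potential wpot window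
  rw [← Function.Injective.tsum_eq (g := fun k : Fin (16 * N + 1) => n₀ - 8 * (N : ℤ) + (k : ℕ)),
    tsum_fintype]
  · refine Finset.sum_congr rfl fun k _ => ?_
    congr 2
    push_cast
    ring
  · intro i j hij
    have : ((i : ℕ) : ℤ) = (j : ℕ) := by simpa using hij
    exact Fin.ext (by exact_mod_cast this)
  · intro n hn
    have h1 : (n₀ + t - n : ℝ) ∈ Icc (-(N : ℝ)) N := by
      by_contra h
      exact hn (by simp only [hq.eq_zero h, mul_zero])
    have h2 : ((n₀ - 8 * N : ℤ) : ℝ) ≤ n := by push_cast; linarith [h1.2, ht.1]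
    have h3 : (n : ℝ) ≤ ((n₀ + 8 * N : ℤ) : ℝ) := by push_cast; linarith [h1.1, ht.2]
    have h2' : n₀ - 8 * N ≤ n := by exact_mod_cast h2
    have h3' : n ≤ n₀ + 8 * N := by exact_mod_cast h3
    refine ⟨⟨(n - (n₀ - 8 * N)).toNat, by lia⟩, ?_⟩
    simp only
    lia

/-- A bound for the coefficient `W - E`. -/
def coeffBound (η : ℝ) (x : Fin (16 * N + 1) → ℝ) (E : ℝ) : ℝ := (∑ k, |x k|) * (1 / η) + |E|

lemma bddMeas_wpot (hq : SingleSite q N η) (x : Fin (16 * N + 1) → ℝ) (E : ℝ) :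
    BddMeas (fun t => wpot q N x t - E) (coeffBound η x E) := by
  refine ⟨?_, fun t => ?_⟩
  · unfold wpot
    refine Measurable.sub_const (Finset.measurable_fun_sum _ fun k _ => ?_) E
    exact (hq.piecewise.measurable.comp (by fun_prop)).const_mul _
  · refine (abs_sub _ _).trans (add_le_add ?_ le_rfl)
    unfold wpot
    refine (Finset.abs_sum_le_sum_abs _ _).trans ?_
    rw [Finset.sum_mul]
    refine Finset.sum_le_sum fun k _ => ?_
    rw [abs_mul]
    exact mul_le_mul_of_nonneg_left (hq.bddMeas.bound _) (abs_nonneg _)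

lemma exists_countable_continuousAt_wpot (hq : SingleSite q N η) (x : Fin (16 * N + 1) → ℝ)
    (E : ℝ) : ∃ S : Set ℝ, S.Countable ∧ ∀ t ∉ S, ContinuousAt (fun t => wpot q N x t - E) t := by
  obtain ⟨S, hS, -⟩ := hq.piecewise
  refine ⟨⋃ k : Fin (16 * N + 1), (fun t : ℝ => t + 8 * N - (k : ℕ)) ⁻¹' (S : Set ℝ), ?_, ?_⟩
  · refine countable_iUnion fun k => ?_
    refine (S.finite_toSet.preimage fun a _ b _ h => ?_).countable
    simpa using h
  · intro t ht
    simp only [mem_iUnion, mem_preimage, not_exists] at ht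
    unfold wpot
    refine ContinuousAt.sub ?_ continuousAt_const
    refine tendsto_finsetSum _ fun k _ => ?_
    refine (ContinuousAt.comp (f := fun t : ℝ => t + 8 * N - (k : ℕ)) (hS _ (ht k)) ?_).const_mul _
    fun_prop

/-! ### The Gram matrix and the Prüfer coefficients -/

/-- The first diagonal entry `∫ Ψ(m + t)² q(t) dt` of the Gram matrix of `Ψ`, `Φ`, the solutions of
`y'' = b y` on `[-L, L]` with Cauchy data `(1, 0)` and `(0, 1)` at `0`, for integration against the
single-site potential placed at `m`. -/
def gramA (hq : SingleSite q N η) (L : ℝ) (b : ℝ → ℝ) (m : ℝ) : ℝ :=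
  siteInt hq m (cauchySol L b 1 0 * cauchySol L b 1 0)

/-- The off-diagonal entry `∫ Ψ(m + t) Φ(m + t) q(t) dt`, with `Ψ`, `Φ` as in `gramA`. -/
def gramB (hq : SingleSite q N η) (L : ℝ) (b : ℝ → ℝ) (m : ℝ) : ℝ :=
  siteInt hq m (cauchySol L b 1 0 * cauchySol L b 0 1)

/-- The second diagonal entry `∫ Φ(m + t)² q(t) dt`, with `Φ` as in `gramA`. -/
def gramC (hq : SingleSite q N η) (L : ℝ) (b : ℝ → ℝ) (m : ℝ) : ℝ :=
  siteInt hq m (cauchySol L b 0 1 * cauchySol L b 0 1)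

/-- The value `∫ y(m + t)² q(t) dt` for the solution `y` with Cauchy data `(w₀, w₁)` at `0`. -/
def siteForm (hq : SingleSite q N η) (L : ℝ) (b : ℝ → ℝ) (m w₀ w₁ : ℝ) : ℝ :=
  gramA hq L b m * w₀ ^ 2 + 2 * gramB hq L b m * (w₀ * w₁) + gramC hq L b m * w₁ ^ 2

/-- The polar form of `siteForm`. -/
def siteBilin (hq : SingleSite q N η) (L : ℝ) (b : ℝ → ℝ) (m w₀ w₁ v₀ v₁ : ℝ) : ℝ :=
  gramA hq L b m * (w₀ * v₀) + gramB hq L b m * (w₀ * v₁ + w₁ * v₀) + gramC hq L b m * (w₁ * v₁)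

lemma siteBilin_eq (hq : SingleSite q N η) (L : ℝ) (b : ℝ → ℝ) (m w₀ w₁ v₀ v₁ : ℝ) :
    siteBilin hq L b m w₀ w₁ v₀ v₁ = qInner q N (fun t => cauchySol L b w₀ w₁ (m + t))
      (fun t => cauchySol L b v₀ v₁ (m + t)) := by
  have hc : ∀ c₀ c₁, ContinuousOn (fun t => cauchySol L b c₀ c₁ (m + t)) (Icc (-(N : ℝ)) N) :=
    fun c₀ c₁ => ((cauchySol L b c₀ c₁).continuous.comp (continuous_const_add m)).continuousOn
  simp only [cauchySol_apply_eq L b w₀ w₁, cauchySol_apply_eq L b v₀ v₁]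
  rw [qInner_lin hq (hc 1 0) (hc 0 1)]
  unfold siteBilin gramA gramB gramC
  rw [siteInt_mul, siteInt_mul, siteInt_mul]
  ring

lemma siteBilin_self (hq : SingleSite q N η) (L : ℝ) (b : ℝ → ℝ) (m w₀ w₁ : ℝ) :
    siteBilin hq L b m w₀ w₁ w₀ w₁ = siteForm hq L b m w₀ w₁ := by
  unfold siteBilin siteForm; ring

lemma siteForm_eq (hq : SingleSite q N η) (L : ℝ) (b : ℝ → ℝ) (m w₀ w₁ : ℝ) :
    siteForm hq L b m w₀ w₁ = qInner q N (fun t => cauchySol L b w₀ w₁ (m + t))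
      (fun t => cauchySol L b w₀ w₁ (m + t)) := by
  rw [← siteBilin_self, siteBilin_eq]

lemma siteForm_zero_pos (hq : SingleSite q N η) {L : ℝ} (hL : N ≤ L) {b : ℝ → ℝ} {B : ℝ}
    (hb : BddMeas b B) {w₀ w₁ : ℝ} (hw : w₀ ≠ 0 ∨ w₁ ≠ 0) : 0 < siteForm hq L b 0 w₀ w₁ := by
  have hN := hq.one_le_cast
  have hL0 : 0 ≤ L := by linarith
  rw [siteForm_eq]
  simp only [zero_add]
  refine hq.qInner_self_pos ((sol_cauchySol hL0 hb w₀ w₁).mono (by linarith) hL) ?_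
  rwa [cauchySol_zero hL0 hb, cauchySol'_zero]

lemma gramA_pos (hq : SingleSite q N η) {L : ℝ} (hL : N ≤ L) {b : ℝ → ℝ} {B : ℝ}
    (hb : BddMeas b B) : 0 < gramA hq L b 0 := by
  have := siteForm_zero_pos hq hL hb (w₀ := 1) (w₁ := 0) (Or.inl one_ne_zero)
  simpa [siteForm] using this

lemma gramC_pos (hq : SingleSite q N η) {L : ℝ} (hL : N ≤ L) {b : ℝ → ℝ} {B : ℝ}
    (hb : BddMeas b B) : 0 < gramC hq L b 0 := by
  have := siteForm_zero_pos hq hL hb (w₀ := 0) (w₁ := 1) (Or.inr one_ne_zero)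
  simpa [siteForm] using this

lemma gram_det_pos (hq : SingleSite q N η) {L : ℝ} (hL : N ≤ L) {b : ℝ → ℝ} {B : ℝ}
    (hb : BddMeas b B) :
    0 < gramA hq L b 0 * gramC hq L b 0 - gramB hq L b 0 ^ 2 := by
  have hA := gramA_pos hq hL hb
  have := siteForm_zero_pos hq hL hb (w₀ := -gramB hq L b 0) (w₁ := gramA hq L b 0)
    (Or.inr hA.ne')
  unfold siteForm at this
  refine pos_of_mul_pos_right (a := gramA hq L b 0) ?_ hA.le
  linarith

/-- The smallest eigenvalue of the Gram matrix is at least the determinant over the trace. -/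
lemma sq_add_sq_le_siteForm (hq : SingleSite q N η) {L : ℝ} (hL : N ≤ L) {b : ℝ → ℝ} {B : ℝ}
    (hb : BddMeas b B) (w₀ w₁ : ℝ) :
    w₀ ^ 2 + w₁ ^ 2 ≤ (gramA hq L b 0 + gramC hq L b 0) /
      (gramA hq L b 0 * gramC hq L b 0 - gramB hq L b 0 ^ 2) * siteForm hq L b 0 w₀ w₁ := by
  have hd := gram_det_pos hq hL hb
  rw [div_mul_eq_mul_div, le_div_iff₀ hd]
  unfold siteForm
  nlinarith [sq_nonneg (gramA hq L b 0 * w₀ + gramB hq L b 0 * w₁),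
    sq_nonneg (gramB hq L b 0 * w₀ + gramC hq L b 0 * w₁)]

/-- The coefficients of a function with Cauchy data `(w₀, w₁)` in the orthonormal basis obtained
from `Ψ`, `Φ` by the Gram–Schmidt process, in terms of the Gram matrix. -/
lemma coeffs_eq (hq : SingleSite q N η) {ω : ℤ → ℝ} {E : ℝ} {n : ℤ} {b : ℝ → ℝ} {B : ℝ}
    (hb : BddMeas b B)
    (hbW : ∀ x ∈ Icc (-(N : ℝ)) N, b x = shiftedPotential q ω n x - E) (u : ℝ → ℝ) :
    coeffs q N ω E u n =
      ![√(gramA hq N b 0) * (u n + gramB hq N b 0 / gramA hq N b 0 * deriv u n),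
        √(gramC hq N b 0 - gramB hq N b 0 ^ 2 / gramA hq N b 0) * deriv u n] := by
  set a := gramA hq N b 0 with ha
  set g := gramB hq N b 0 with hg
  set c := gramC hq N b 0 with hc
  have hN := hq.one_le_N
  have hN0 : (0 : ℝ) ≤ N := by positivity
  have hA : 0 < a := gramA_pos hq le_rfl hb
  have hD : 0 < c - g ^ 2 / a := by
    have h := gram_det_pos hq le_rfl hb
    rw [← ha, ← hg, ← hc] at h
    rw [sub_pos, div_lt_iff₀ hA]
    linarith
  have h0 : (0 : ℝ) ∈ Icc (-(N : ℝ)) N := ⟨by linarith, hN0⟩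
  obtain ⟨hΨ, hΨ'⟩ := solutionAt_spec hN hb hbW 1 0
  obtain ⟨hΦ, hΦ'⟩ := solutionAt_spec hN hb hbW 0 1
  set Ψ := solutionAt (shiftedPotential q ω n) E N 1 0 with hΨdef
  set Φ := solutionAt (shiftedPotential q ω n) E N 0 1 with hΦdef
  have hΨ0 : Ψ 0 = 1 := by rw [hΨ 0 h0, cauchySol_zero hN0 hb]
  have hΦ0 : Φ 0 = 0 := by rw [hΦ 0 h0, cauchySol_zero hN0 hb]
  have hΨc : ContinuousOn Ψ (Icc (-(N : ℝ)) N) :=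
    (cauchySol N b 1 0).continuous.continuousOn.congr hΨ
  have hΦc : ContinuousOn Φ (Icc (-(N : ℝ)) N) :=
    (cauchySol N b 0 1).continuous.continuousOn.congr hΦ
  have eA : qInner q N Ψ Ψ = a := by
    rw [ha, gramA, siteInt_mul]; simp only [zero_add]; exact qInner_congr hΨ hΨ
  have eB : qInner q N Ψ Φ = g := by
    rw [hg, gramB, siteInt_mul]; simp only [zero_add]; exact qInner_congr hΨ hΦ
  have eC : qInner q N Φ Φ = c := by
    rw [hc, gramC, siteInt_mul]; simp only [zero_add]; exact qInner_congr hΦ hΦ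
  have hsa : √a ≠ 0 := (Real.sqrt_pos.2 hA).ne'
  have hsd : √(c - g ^ 2 / a) ≠ 0 := (Real.sqrt_pos.2 hD).ne'
  have hsq : √a * √a = a := Real.mul_self_sqrt hA.le
  have e1 : basis₁ q N ω E n = fun x => 1 / √a * Ψ x + 0 * Φ x := by
    ext x
    simp only [basis₁, ← hΨdef, qNorm, eA]
    ring
  have e2 : orthPart q N ω E n = fun x => -(g / a) * Ψ x + 1 * Φ x := by
    ext x
    have hin : qInner q N Φ (fun x => 1 / √a * Ψ x + 0 * Φ x) = 1 / √a * g := by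
      have := qInner_lin hq hΨc hΦc 0 1 (1 / √a) 0
      simp only [zero_mul, one_mul, zero_add, mul_zero, add_zero] at this ⊢
      rw [this, eB]
    simp only [orthPart, ← hΦdef, e1]
    rw [hin]
    have : g / a = 1 / √a * g * (1 / √a) := by
      nth_rewrite 1 [← hsq]
      field_simp
    rw [this]
    ring
  have e3 : qNorm q N (orthPart q N ω E n) = √(c - g ^ 2 / a) := by
    rw [qNorm, e2, qInner_lin hq hΨc hΦc, eA, eB, eC]
    congr 1
    field_simp
    ring
  have e4 : basis₂ q N ω E n
      = fun x => (-(g / a) * Ψ x + 1 * Φ x) / √(c - g ^ 2 / a) := by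
    ext x
    simp only [basis₂, e3]
    rw [e2]
  have d1 : deriv (basis₁ q N ω E n) 0 = 0 := by
    rw [e1, ((hΨ'.const_mul (1 / √a)).fun_add (hΦ'.const_mul 0)).deriv]
    simp
  have d2 : deriv (basis₂ q N ω E n) 0 = 1 / √(c - g ^ 2 / a) := by
    rw [e4, (((hΨ'.const_mul (-(g / a))).fun_add (hΦ'.const_mul 1)).div_const _).deriv]
    simp
  have v1 : basis₁ q N ω E n 0 = 1 / √a := by rw [e1]; simp [hΨ0]
  have v2 : basis₂ q N ω E n 0 = -(g / a) / √(c - g ^ 2 / a) := by rw [e4]; simp [hΨ0, hΦ0]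
  unfold coeffs
  rw [d1, d2, v1, v2]
  generalize √(c - g ^ 2 / a) = σ at hsd
  generalize √a = τ at hsa
  have hdet : (!![1 / τ, -(g / a) / σ; 0, 1 / σ]
      : Matrix (Fin 2) (Fin 2) ℝ) *
      !![τ, τ * (g / a); 0, σ] = 1 := by
    ext i j
    fin_cases i <;> fin_cases j <;> simp [Matrix.mul_apply, Fin.sum_univ_two] <;> field_simp
    ring
  rw [Matrix.inv_eq_right_inv hdet]
  ext i
  fin_cases i <;> simp [Matrix.mulVec, dotProduct, Fin.sum_univ_two]
  ring

/-- Parseval's identity for the Prüfer coefficients. -/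
lemma coeffs_sq_add_sq (hq : SingleSite q N η) {ω : ℤ → ℝ} {E : ℝ} {n : ℤ} {b : ℝ → ℝ} {B : ℝ}
    (hb : BddMeas b B)
    (hbW : ∀ x ∈ Icc (-(N : ℝ)) N, b x = shiftedPotential q ω n x - E) (u : ℝ → ℝ) :
    coeffs q N ω E u n 0 ^ 2 + coeffs q N ω E u n 1 ^ 2
      = siteForm hq N b 0 (u n) (deriv u n) := by
  have hA := gramA_pos hq le_rfl hb
  have hD : 0 ≤ gramC hq N b 0 - gramB hq N b 0 ^ 2 / gramA hq N b 0 := by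
    have h := gram_det_pos hq le_rfl hb
    rw [sub_nonneg, div_le_iff₀ hA]
    linarith
  rw [coeffs_eq hq hb hbW]
  simp only [Matrix.cons_val_zero, Matrix.cons_val_one, mul_pow, Real.sq_sqrt hA.le,
    Real.sq_sqrt hD]
  unfold siteForm
  field_simp
  ring

/-! ### Change of the energy and of the base point -/

/-- The constant in the comparison of the quadratic forms at different sites and energies, for
coefficients bounded by `B` on an interval of half-length `L`; the factor `2 N / η` bounds `∫ q`. -/
def siteConst (η : ℝ) (N : ℕ) (L B : ℝ) : ℝ :=
  2 * N / η * (4 * L ^ 2 * (Real.exp (B * L ^ 2) * (1 + L)) ^ 5 * (2 + L * B) ^ 2)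

lemma siteConst_nonneg (hq : SingleSite q N η) {L B : ℝ} (hL : 0 ≤ L) :
    0 ≤ siteConst η N L B := by
  have := hq.eta_pos
  unfold siteConst
  positivity

/-- The solution on the longer interval `[-L', L']` restricts to the solution on `[-L, L]`. -/
lemma cauchySol_eq_of_le {L L' : ℝ} (hL : 0 ≤ L) (hLL' : L ≤ L') {b : ℝ → ℝ} {B : ℝ}
    (hb : BddMeas b B) (c₀ c₁ : ℝ) {x : ℝ} (hx : x ∈ Icc (-L) L) :
    cauchySol L b c₀ c₁ x = cauchySol L' b c₀ c₁ x := by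
  have hL' := hL.trans hLL'
  have h := ((sol_cauchySol hL' hb c₀ c₁).mono (by linarith) hLL').eq_cauchySol hL hb hx
  rw [cauchySol_zero hL' hb, cauchySol'_zero] at h
  exact h.symm

lemma siteForm_zero_eq_of_le (hq : SingleSite q N η) {L : ℝ} (hL : N ≤ L) {b : ℝ → ℝ} {B : ℝ}
    (hb : BddMeas b B) (w₀ w₁ : ℝ) : siteForm hq N b 0 w₀ w₁ = siteForm hq L b 0 w₀ w₁ := by
  rw [siteForm_eq, siteForm_eq]
  simp only [zero_add]
  exact qInner_congr (fun x hx => cauchySol_eq_of_le (Nat.cast_nonneg N) hL hb _ _ hx)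
    (fun x hx => cauchySol_eq_of_le (Nat.cast_nonneg N) hL hb _ _ hx)

lemma gram_eq_of_le (hq : SingleSite q N η) {L : ℝ} (hL : N ≤ L) {b : ℝ → ℝ} {B : ℝ}
    (hb : BddMeas b B) : gramA hq N b 0 = gramA hq L b 0 ∧ gramB hq N b 0 = gramB hq L b 0 ∧
      gramC hq N b 0 = gramC hq L b 0 := by
  unfold gramA gramB gramC
  simp only [siteInt_mul, zero_add]
  have h := fun c₀ c₁ x hx => cauchySol_eq_of_le (Nat.cast_nonneg N) hL hb c₀ c₁ (x := x) hx
  exact ⟨qInner_congr (h _ _) (h _ _), qInner_congr (h _ _) (h _ _), qInner_congr (h _ _) (h _ _)⟩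

set_option maxHeartbeats 800000 in
/-- A solution `y` at one energy, restarted at the site `m` with its own Cauchy data but at a nearby
energy, has almost the same `q`-norm near `m` as the solution at the nearby energy that is started
at `0`: both are close to the `q`-norm of `y` itself. -/
lemma siteForm_compare (hq : SingleSite q N η) {L B ε m : ℝ} {b c y y' : ℝ → ℝ}
    (hb : BddMeas b B) (hc : BddMeas c B) (hbc : ∀ t, |b t - c t| ≤ ε)
    (hm : |m| + N ≤ L) (h : Sol b (-L) L y y') :
    |siteForm hq N (fun t => c (m + t)) 0 (y m) (y' m) - siteForm hq L c m (y 0) (y' 0)|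
        ≤ siteConst η N L B * ε * (|y 0| + |y' 0|) ^ 2 ∧
      siteForm hq N (fun t => c (m + t)) 0 (y m) (y' m)
        ≤ siteConst η N L B * (|y 0| + |y' 0|) ^ 2 := by
  have hN1 := hq.one_le_cast
  have hN0 : (0 : ℝ) ≤ N := by linarith
  have hNL : (N : ℝ) ≤ L := by linarith [abs_nonneg m]
  have hL1 : 1 ≤ L := hN1.trans hNL
  have hL0 : 0 ≤ L := by linarith
  have hB := hb.nonneg
  have hε : 0 ≤ ε := (abs_nonneg _).trans (hbc 0)
  have hη := hq.eta_pos
  set w := |y 0| + |y' 0| with hw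
  have hw0 : 0 ≤ w := by positivity
  set e := Real.exp (B * L ^ 2) with he
  have he1 : 1 ≤ e := Real.one_le_exp (by positivity)
  set κ := e * (1 + L) with hκ
  have hκ1 : 1 ≤ κ := by nlinarith
  have heκ : e ≤ κ := by nlinarith
  have hmt : ∀ t ∈ Icc (-(N : ℝ)) N, m + t ∈ Icc (-L) L := by
    intro t ht
    have := neg_abs_le m
    have := le_abs_self m
    exact ⟨by linarith [ht.1], by linarith [ht.2]⟩
  have h0 : (0 : ℝ) ∈ Icc (-L) L := ⟨by linarith, hL0⟩
  have hmL : m ∈ Icc (-L) L := by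
    have := hmt 0 ⟨by linarith, hN0⟩
    rwa [add_zero] at this
  -- the solution itself and the comparison solution on the long interval
  have hy : ∀ x ∈ Icc (-L) L, y x = cauchySol L b (y 0) (y' 0) x := fun x hx =>
    h.eq_cauchySol hL0 hb hx
  have hyb : ∀ x ∈ Icc (-L) L, |y x| ≤ κ * w := by
    intro x hx
    rw [hy x hx]
    refine ((cauchySol L b (y 0) (y' 0)).norm_coe_le_norm x).trans
      ((norm_cauchySol_le hL0 hb _ _).trans (le_of_eq ?_))
    rw [hκ, hw]; ring
  have hfb : ∀ x, |cauchySol L c (y 0) (y' 0) x| ≤ κ * w := by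
    intro x
    refine ((cauchySol L c (y 0) (y' 0)).norm_coe_le_norm x).trans
      ((norm_cauchySol_le hL0 hc _ _).trans (le_of_eq ?_))
    rw [hκ, hw]; ring
  have hinit : e * ‖initFun L (y 0) (y' 0)‖ ≤ κ * w := by
    have := mul_le_mul_of_nonneg_left (norm_initFun_le hL0 (y 0) (y' 0)) (by linarith : 0 ≤ e)
    refine this.trans (le_of_eq ?_)
    rw [hκ, hw]; ring
  have hyf : ∀ x ∈ Icc (-L) L, |y x - cauchySol L c (y 0) (y' 0) x| ≤ ε * L ^ 2 * κ ^ 2 * w := by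
    intro x hx
    rw [hy x hx]
    have h1 := norm_solOp_sub_le hL0 hb hc hbc (initFun L (y 0) (y' 0))
    refine ((solOp L b (initFun L (y 0) (y' 0)) -
      solOp L c (initFun L (y 0) (y' 0))).norm_coe_le_norm x).trans (h1.trans ?_)
    calc e * (ε * L ^ 2 * (e * ‖initFun L (y 0) (y' 0)‖)) ≤ κ * (ε * L ^ 2 * (κ * w)) := by gcongr
      _ = _ := by ring
  -- the Cauchy data at `m`
  have hd0 : |y m| ≤ κ * w := hyb m hmL
  have hd1 : |y' m| ≤ w + B * L * (κ * w) := by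
    have h1 := h.eq' 0 h0 m hmL
    have h2 : ‖∫ x in (0 : ℝ)..m, b x * y x‖ ≤ B * (κ * w) * |m - 0| := by
      refine intervalIntegral.norm_integral_le_of_norm_le_const fun x hx => ?_
      rw [Real.norm_eq_abs, abs_mul]
      exact mul_le_mul (hb.bound x)
        (hyb x (uIcc_subset_Icc h0 hmL (uIoc_subset_uIcc hx))) (abs_nonneg _) hB
    have h3 : |y' m| ≤ |y' 0| + ‖∫ x in (0 : ℝ)..m, b x * y x‖ := by
      rw [← h1, Real.norm_eq_abs]
      have := abs_add_le (y' 0) (y' m - y' 0)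
      rwa [add_sub_cancel] at this
    have h4 : |m - 0| ≤ L := by rw [sub_zero]; linarith
    have h5 : B * (κ * w) * |m - 0| ≤ B * (κ * w) * L := by gcongr
    have h6 : |y' 0| ≤ w := by rw [hw]; linarith [abs_nonneg (y 0)]
    linarith
  set D := |y m| + |y' m| with hD
  have hD0 : 0 ≤ D := by positivity
  have hDw : D ≤ (2 + L * B) * κ * w := by
    have : w ≤ κ * w := le_mul_of_one_le_left hw0 hκ1
    calc D ≤ κ * w + (κ * w + B * L * (κ * w)) := by rw [hD]; linarith
      _ = (2 + L * B) * κ * w := by ring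
  -- the local problem at `m`
  have hbm := hb.comp_add m
  have hcm := hc.comp_add m
  have hloc : Sol (fun t => b (m + t)) (-(N : ℝ)) N (fun t => y (m + t)) (fun t => y' (m + t)) :=
    (h.shift m).mono (by linarith [neg_abs_le m]) (by linarith [le_abs_self m])
  have heN : Real.exp (B * N ^ 2) ≤ e := by
    rw [he]; gcongr
  have hyl : ∀ x ∈ Icc (-(N : ℝ)) N,
      y (m + x) = cauchySol N (fun t => b (m + t)) (y m) (y' m) x := fun x hx => by
    have := hloc.eq_cauchySol hN0 hbm hx
    simpa only [add_zero] using this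
  have hlb : ∀ {c' : ℝ → ℝ}, BddMeas c' B → ∀ x, |cauchySol N c' (y m) (y' m) x| ≤ κ * D := by
    intro c' hc' x
    refine ((cauchySol N c' (y m) (y' m)).norm_coe_le_norm x).trans
      ((norm_cauchySol_le hN0 hc' _ _).trans ?_)
    rw [hκ, ← hD]
    have : Real.exp (B * N ^ 2) * ((1 + N) * D) ≤ e * ((1 + L) * D) := by gcongr
    linarith
  have hzl : ∀ x ∈ Icc (-(N : ℝ)) N,
      |cauchySol N (fun t => c (m + t)) (y m) (y' m) x - y (m + x)|
        ≤ ε * L ^ 2 * κ ^ 2 * D := by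
    intro x hx
    rw [hyl x hx]
    have h1 := norm_solOp_sub_le hN0 hcm hbm
      (fun t => by rw [abs_sub_comm]; exact hbc (m + t)) (initFun N (y m) (y' m))
    refine ((solOp N (fun t => c (m + t)) (initFun N (y m) (y' m)) -
      solOp N (fun t => b (m + t)) (initFun N (y m) (y' m))).norm_coe_le_norm x).trans
        (h1.trans ?_)
    have h2 := norm_initFun_le hN0 (y m) (y' m)
    rw [← hD] at h2
    calc _ ≤ e * (ε * L ^ 2 * (e * ((1 + L) * D))) := by
          gcongr
          exact h2.trans (by gcongr)
      _ = e * (ε * L ^ 2 * (κ * D)) := by rw [hκ]; ring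
      _ ≤ κ * (ε * L ^ 2 * (κ * D)) := by gcongr
      _ = _ := by ring
  have hyc : ContinuousOn (fun t => y (m + t)) (Icc (-(N : ℝ)) N) := hloc.cont
  rw [siteForm_eq, siteForm_eq]
  simp only [zero_add]
  have c1 := abs_qInner_self_sub_le hq
    (cauchySol N (fun t => c (m + t)) (y m) (y' m)).continuous.continuousOn hyc
    (fun x _ => hlb hcm x) (fun x hx => by rw [hyl x hx]; exact hlb hbm x) hzl
  have c2 := abs_qInner_self_sub_le hq hyc
    ((cauchySol L c (y 0) (y' 0)).continuous.comp (continuous_const_add m)).continuousOn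
    (fun x hx => hyb _ (hmt x hx)) (fun x _ => hfb _) (fun x hx => hyf _ (hmt x hx))
  have c3 := abs_qInner_le hq (fun x _ => hlb hcm x) (fun x _ => hlb hcm x)
  have hT : 0 ≤ 2 * (N : ℝ) / η := by positivity
  have hX : 1 ≤ 2 + L * B := by linarith [mul_nonneg hL0 hB]
  have hDD : D ^ 2 ≤ ((2 + L * B) * κ * w) ^ 2 := by gcongr
  have hκ3 : κ ^ 3 ≤ κ ^ 5 * (2 + L * B) ^ 2 := by
    have h1 : κ ^ 3 ≤ κ ^ 5 := pow_le_pow_right₀ hκ1 (by norm_num)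
    have h2 : 1 ≤ (2 + L * B) ^ 2 := one_le_pow₀ hX
    exact h1.trans (le_mul_of_one_le_right (by positivity) h2)
  constructor
  · refine (abs_sub_le _ (qInner q N (fun t => y (m + t)) (fun t => y (m + t))) _).trans
      ((add_le_add c1 c2).trans ?_)
    calc 2 * ↑N / η * (ε * L ^ 2 * κ ^ 2 * D * (2 * (κ * D)))
        + 2 * ↑N / η * (ε * L ^ 2 * κ ^ 2 * w * (2 * (κ * w)))
        = 2 * ↑N / η * ε * L ^ 2 * (2 * κ ^ 3 * D ^ 2 + 2 * κ ^ 3 * w ^ 2) := by ring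
      _ ≤ 2 * ↑N / η * ε * L ^ 2 * (2 * κ ^ 3 * ((2 + L * B) * κ * w) ^ 2
            + 2 * (κ ^ 5 * (2 + L * B) ^ 2) * w ^ 2) := by gcongr
      _ = siteConst η N L B * ε * w ^ 2 := by unfold siteConst; rw [← he, ← hκ]; ring
  · refine (le_abs_self _).trans (c3.trans ?_)
    have hL2 : 1 ≤ L ^ 2 := one_le_pow₀ hL1
    calc 2 * ↑N / η * (κ * D * (κ * D)) = 2 * ↑N / η * κ ^ 2 * D ^ 2 := by ring
      _ ≤ 2 * ↑N / η * κ ^ 2 * ((2 + L * B) * κ * w) ^ 2 := by gcongr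
      _ = 2 * ↑N / η * (1 * κ ^ 4 * (2 + L * B) ^ 2) * w ^ 2 := by ring
      _ ≤ 2 * ↑N / η * (4 * L ^ 2 * κ ^ 5 * (2 + L * B) ^ 2) * w ^ 2 := by
        gcongr
        · linarith
        · norm_num
      _ = siteConst η N L B * w ^ 2 := by unfold siteConst; rw [← he, ← hκ]

/-! ### Radii of eigenfunctions -/

lemma exists_bddMeas_potential (hq : SingleSite q N η) (ω : ℤ → ℝ) (E : ℝ) (l : ℕ) :
    ∃ (b : ℝ → ℝ) (B : ℝ), BddMeas b B ∧
      ∀ x ∈ Icc (-(l : ℝ)) l, b x = potential q ω x - E := by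
  refine ⟨fun x => ∑ n ∈ Finset.Icc (-(l : ℤ) - N) (l + N), ω n * q (x - n) - E,
    ∑ n ∈ Finset.Icc (-(l : ℤ) - N) (l + N), |ω n| * (1 / η) + |E|, ⟨?_, fun t => ?_⟩,
    fun x hx => ?_⟩
  · refine Measurable.sub_const (Finset.measurable_fun_sum _ fun k _ => ?_) E
    exact (hq.piecewise.measurable.comp (by fun_prop)).const_mul _
  · refine (abs_sub _ _).trans (add_le_add ?_ le_rfl)
    refine (Finset.abs_sum_le_sum_abs _ _).trans (Finset.sum_le_sum fun k _ => ?_)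
    rw [abs_mul]
    exact mul_le_mul_of_nonneg_left (hq.bddMeas.bound _) (abs_nonneg _)
  · unfold potential
    rw [tsum_eq_sum]
    intro n hn
    rw [hq.eq_zero, mul_zero]
    intro h
    apply hn
    have h1 : ((-(l : ℤ) - N : ℤ) : ℝ) ≤ n := by push_cast; linarith [h.2, hx.1]
    have h2 : (n : ℝ) ≤ ((l + N : ℤ) : ℝ) := by push_cast; linarith [h.1, hx.2]
    exact Finset.mem_Icc.2 ⟨by exact_mod_cast h1, by exact_mod_cast h2⟩

lemma siteForm_div (hq : SingleSite q N η) (L : ℝ) (b : ℝ → ℝ) (m w₀ w₁ s : ℝ) :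
    siteForm hq L b m (w₀ / s) (w₁ / s) = siteForm hq L b m w₀ w₁ / s ^ 2 := by
  unfold siteForm; ring

lemma gradNorm_nonneg (q : ℝ → ℝ) (l j : ℕ) (ω : ℤ → ℝ) : 0 ≤ gradNorm q l j ω :=
  Finset.sum_nonneg fun _ _ => abs_nonneg _

/-- The Prüfer vectors of a solution whose energy `E` is close to `F`, expressed through the
solutions at the energy `F` with the same (normalized) Cauchy data `(w₀, w₁)` at `n₀`. The
normalization by `gradNorm` is a common factor of all sites; if `gradNorm` vanishes, division by
zero makes both the vectors and the data vanish, and the relations still hold. -/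
lemma exists_data_pruferVector (hq : SingleSite q N η) {ω : ℤ → ℝ} {E F ε : ℝ} {l : ℕ}
    {u : ℝ → ℝ} (hu : IsSolutionOn (potential q ω) E (-(l : ℝ)) l u) (j : ℕ) {n₀ : ℤ}
    (h₁ : -(l : ℤ) + 8 * N < n₀) (h₂ : n₀ < (l : ℤ) - 8 * N) (hEF : |E - F| ≤ ε) (hε : ε ≤ 1) :
    ∃ w₀ w₁ : ℝ,
      (pruferVector q N ω F l j u n₀ =
        ![√(gramA hq (7 * N) (fun t => wpot q N (window N ω n₀) t - F) 0) * (w₀ +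
            gramB hq (7 * N) (fun t => wpot q N (window N ω n₀) t - F) 0 /
            gramA hq (7 * N) (fun t => wpot q N (window N ω n₀) t - F) 0 * w₁),
          √(gramC hq (7 * N) (fun t => wpot q N (window N ω n₀) t - F) 0 -
            gramB hq (7 * N) (fun t => wpot q N (window N ω n₀) t - F) 0 ^ 2 /
            gramA hq (7 * N) (fun t => wpot q N (window N ω n₀) t - F) 0) * w₁]) ∧
      radius (pruferVector q N ω F l j u n₀) ^ 2 =
        siteForm hq (7 * N) (fun t => wpot q N (window N ω n₀) t - F) 0 w₀ w₁ ∧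
      ∀ m : ℕ, m ≤ 3 →
        |radius (pruferVector q N ω F l j u (n₀ + m)) ^ 2 -
            siteForm hq (7 * N) (fun t => wpot q N (window N ω n₀) t - F) m w₀ w₁|
          ≤ siteConst η N (7 * N) (coeffBound η (window N ω n₀) F + 1) * ε * (|w₀| + |w₁|) ^ 2 ∧
        radius (pruferVector q N ω F l j u (n₀ + m)) ^ 2
          ≤ siteConst η N (7 * N) (coeffBound η (window N ω n₀) F + 1) * (|w₀| + |w₁|) ^ 2 := by
  set x := window N ω n₀ with hx
  set L : ℝ := 7 * N with hL
  set B := coeffBound η x F + 1 with hB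
  set bF : ℝ → ℝ := fun t => wpot q N x t - F with hbF
  set bE : ℝ → ℝ := fun t => wpot q N x t - E with hbE
  have hN1 := hq.one_le_cast
  have hN0 : (0 : ℝ) ≤ N := by linarith
  have hL0 : 0 ≤ L := by rw [hL]; linarith
  have hNL : (N : ℝ) ≤ L := by rw [hL]; linarith
  have hF : BddMeas bF B := by
    have := bddMeas_wpot hq x F
    exact ⟨this.meas, fun t => (this.bound t).trans (by rw [hB]; linarith)⟩
  have hE : BddMeas bE B := by
    have := bddMeas_wpot hq x E
    refine ⟨this.meas, fun t => (this.bound t).trans ?_⟩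
    rw [hB]
    unfold coeffBound
    have h1 : |E| ≤ |E - F| + |F| := by
      have := abs_add_le (E - F) F
      rwa [sub_add_cancel] at this
    linarith
  have hbc : ∀ t, |bE t - bF t| ≤ ε := fun t => by
    rw [hbE, hbF, sub_sub_sub_cancel_left, abs_sub_comm]
    exact hEF
  -- the solution, seen from `n₀`
  have h₁' : -(l : ℝ) + 8 * N < n₀ := by exact_mod_cast h₁
  have h₂' : (n₀ : ℝ) < l - 8 * N := by exact_mod_cast h₂
  have hlpos : -(l : ℝ) < l := by linarith
  obtain ⟨b, B', hb, hbW⟩ := exists_bddMeas_potential hq ω E l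
  have hsol := hu.sol hlpos hb hbW
  set u' := derivWithin u (Icc (-(l : ℝ)) l) with hu'
  have hder : ∀ s ∈ Ioo (-(l : ℝ)) l, deriv u s = u' s := fun s hs => (hsol.hasDerivAt hs).deriv
  have hSol : Sol bE (-L) L (fun t => u (n₀ + t)) (fun t => u' (n₀ + t)) := by
    refine ((hsol.shift n₀).mono (by rw [hL]; linarith) (by rw [hL]; linarith)).congr_coeff ?_
    intro t ht
    rw [hbW _ ⟨by rw [hL] at ht; linarith [ht.1], by rw [hL] at ht; linarith [ht.2]⟩,
      potential_eq_wpot hq ω n₀ ht]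
  have hcoeff : ∀ m : ℕ, m ≤ 3 →
      coeffs q N ω F u (n₀ + m) 0 ^ 2 + coeffs q N ω F u (n₀ + m) 1 ^ 2
        = siteForm hq N (fun t => bF (m + t)) 0 (u (n₀ + m)) (u' (n₀ + m)) := by
    intro m hm
    have hm' : (m : ℝ) ≤ 3 := by exact_mod_cast hm
    have hm0 : (0 : ℝ) ≤ m := by positivity
    rw [coeffs_sq_add_sq hq (hF.comp_add m)]
    · push_cast
      rw [hder _ ⟨by linarith, by linarith⟩]
    · intro t ht
      simp only [hbF, shiftedPotential]
      rw [← potential_eq_wpot hq ω n₀ ⟨by linarith [ht.1], by linarith [ht.2]⟩]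
      push_cast
      rw [add_assoc]
  set g := gradNorm q l j ω with hg
  have hg0 : 0 ≤ g := gradNorm_nonneg q l j ω
  have hrad : ∀ m : ℕ, m ≤ 3 → radius (pruferVector q N ω F l j u (n₀ + m)) ^ 2
      = siteForm hq N (fun t => bF (m + t)) 0 (u (n₀ + m)) (u' (n₀ + m)) / g := by
    intro m hm
    rw [radius, Real.sq_sqrt (by positivity), ← hcoeff m hm]
    simp only [pruferVector, ← hg, div_pow, Real.sq_sqrt hg0]
    ring
  have hdn₀ : deriv u n₀ = u' n₀ := hder _ ⟨by linarith, by linarith⟩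
  refine ⟨u n₀ / √g, u' n₀ / √g, ?_, ?_, fun m hm => ?_⟩
  · ext i
    have hco := coeffs_eq hq hF (ω := ω) (E := F) (n := n₀) (fun t ht => by
      simp only [hbF, shiftedPotential]
      rw [potential_eq_wpot hq ω n₀ ⟨by linarith [ht.1], by linarith [ht.2]⟩]) u
    obtain ⟨gA, gB, gC⟩ := gram_eq_of_le hq hNL hF
    rw [gA, gB, gC, hdn₀] at hco
    simp only [pruferVector, hco, ← hg]
    fin_cases i <;> simp <;> ring
  · have := hrad 0 (by norm_num)
    simp only [Nat.cast_zero, add_zero, zero_add] at this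
    rw [this, siteForm_div, Real.sq_sqrt hg0, siteForm_zero_eq_of_le hq hNL hF]
  · have hm' : (m : ℝ) ≤ 3 := by exact_mod_cast hm
    have hm0 : (0 : ℝ) ≤ m := by positivity
    obtain ⟨k1, k2⟩ := siteForm_compare hq hE hF hbc (m := m)
      (by rw [abs_of_nonneg hm0, hL]; linarith) hSol
    simp only [add_zero] at k1 k2
    have hs : (|u n₀ / √g| + |u' n₀ / √g|) ^ 2 = (|u n₀| + |u' n₀|) ^ 2 / g := by
      rw [abs_div, abs_div, ← add_div, div_pow, sq_abs, Real.sq_sqrt hg0]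
    rw [hrad m hm, siteForm_div, Real.sq_sqrt hg0, hs, ← sub_div, abs_div, abs_of_nonneg hg0,
      ← mul_div_assoc, ← mul_div_assoc]
    exact ⟨div_le_div_of_nonneg_right k1 hg0, div_le_div_of_nonneg_right k2 hg0⟩

/-! ### Analytic dependence on the couplings -/

lemma BddMeas.lin {b c : ℝ → ℝ} {B C : ℝ} (hb : BddMeas b B) (hc : BddMeas c C) (p r : ℝ) :
    BddMeas (fun t => p * b t + r * c t) (|p| * B + |r| * C) := by
  refine ⟨(hb.meas.const_mul p).add (hc.meas.const_mul r), fun t => ?_⟩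
  refine (abs_add_le _ _).trans ?_
  rw [abs_mul, abs_mul]
  have := hb.bound t
  have := hc.bound t
  gcongr

lemma volterra_lin {L : ℝ} (hL : 0 ≤ L) {b c : ℝ → ℝ} {B C : ℝ} (hb : BddMeas b B)
    (hc : BddMeas c C) (p r : ℝ) :
    volterra L (fun t => p * b t + r * c t) = p • volterra L b + r • volterra L c := by
  ext y x
  simp only [_root_.add_apply, _root_.smul_apply, BoundedContinuousFunction.add_apply,
    BoundedContinuousFunction.smul_apply, smul_eq_mul]
  rw [volterra_apply hL (hb.lin hc p r), volterra_apply hL hb, volterra_apply hL hc,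
    ← intervalIntegral.integral_const_mul, ← intervalIntegral.integral_const_mul,
    ← intervalIntegral.integral_add
      (((continuous_inner_primitive hb y).intervalIntegrable _ _).const_mul p)
      (((continuous_inner_primitive hc y).intervalIntegrable _ _).const_mul r)]
  congr 1
  ext s
  rw [← intervalIntegral.integral_const_mul, ← intervalIntegral.integral_const_mul,
    ← intervalIntegral.integral_add
      ((hb.intervalIntegrable_mul y.continuous.continuousOn).const_mul p)
      ((hc.intervalIntegrable_mul y.continuous.continuousOn).const_mul r)]
  congr 1
  ext t
  ring

lemma volterra_sum {ι : Type*} {L : ℝ} (hL : 0 ≤ L) {b : ι → ℝ → ℝ} {B : ℝ}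
    (hb : ∀ i, BddMeas (b i) B) (x : ι → ℝ) (s : Finset ι) :
    (∃ C, BddMeas (fun t => ∑ i ∈ s, x i * b i t) C) ∧
      volterra L (fun t => ∑ i ∈ s, x i * b i t) = ∑ i ∈ s, x i • volterra L (b i) := by
  classical
  induction s using Finset.induction_on with
  | empty =>
    have h0 : BddMeas (fun _ => (0 : ℝ)) 0 := ⟨measurable_const, by simp⟩
    refine ⟨⟨0, by simpa using h0⟩, ?_⟩
    simpa using volterra_lin hL h0 h0 0 0
  | insert i s hi ih =>
    obtain ⟨⟨C, hC⟩, hs⟩ := ih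
    have h1 := (hb i).lin hC (x i) 1
    have h2 := volterra_lin hL (hb i) hC (x i) 1
    simp only [Finset.sum_insert hi]
    simp only [one_mul, one_smul, hs] at h1 h2
    exact ⟨⟨_, h1⟩, h2⟩

lemma volterra_wpot (hq : SingleSite q N η) {L : ℝ} (hL : 0 ≤ L) (x : Fin (16 * N + 1) → ℝ)
    (E : ℝ) : volterra L (fun t => wpot q N x t - E)
      = ∑ k : Fin (16 * N + 1), x k • volterra L (fun t => q (t + 8 * N - (k : ℕ)))
        + (-E) • volterra L (fun _ => 1) := by
  have hqk : ∀ k : Fin (16 * N + 1), BddMeas (fun t => q (t + 8 * N - (k : ℕ))) (1 / η) := fun k =>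
    ⟨hq.piecewise.measurable.comp (by fun_prop), fun t => hq.bddMeas.bound _⟩
  have h1 : BddMeas (fun _ => (1 : ℝ)) 1 := ⟨measurable_const, by simp⟩
  obtain ⟨⟨C, hC⟩, hs⟩ := volterra_sum hL hqk x Finset.univ
  have := volterra_lin hL hC h1 1 (-E)
  rw [hs] at this
  simp only [one_mul, one_smul, mul_one, ← sub_eq_add_neg] at this
  exact this

lemma analyticAt_coord_smul {ι V : Type*} [Fintype ι] [NormedAddCommGroup V] [NormedSpace ℝ V]
    (k : ι) (T : V) (x : ι → ℝ) : AnalyticAt ℝ (fun x : ι → ℝ => x k • T) x :=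
  ((ContinuousLinearMap.proj k : (ι → ℝ) →L[ℝ] ℝ).smulRight T).analyticAt x

lemma analyticOnNhd_cauchySol (hq : SingleSite q N η) {L : ℝ} (hL : 0 ≤ L) (E c₀ c₁ : ℝ) :
    AnalyticOnNhd ℝ (fun x : Fin (16 * N + 1) → ℝ =>
      cauchySol L (fun t => wpot q N x t - E) c₀ c₁) univ := by
  intro x _
  have hV : AnalyticAt ℝ (fun x : Fin (16 * N + 1) → ℝ =>
      (1 - volterra L (fun t => wpot q N x t - E) : (ℝ →ᵇ ℝ) →L[ℝ] (ℝ →ᵇ ℝ))) x := by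
    simp only [volterra_wpot hq hL]
    refine analyticAt_const.sub (AnalyticAt.add ?_ analyticAt_const)
    refine Finset.analyticAt_fun_sum _ fun k _ => ?_
    exact analyticAt_coord_smul k _ x
  obtain ⟨U, hU⟩ := isUnit_one_sub_volterra hL (bddMeas_wpot hq x E)
  have hI : AnalyticAt ℝ (Ring.inverse : ((ℝ →ᵇ ℝ) →L[ℝ] (ℝ →ᵇ ℝ)) → _)
      (1 - volterra L (fun t => wpot q N x t - E)) := by
    rw [← hU]
    exact analyticAt_inverse (𝕜 := ℝ) (A := (ℝ →ᵇ ℝ) →L[ℝ] (ℝ →ᵇ ℝ)) U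
  have hS : AnalyticAt ℝ (fun x : Fin (16 * N + 1) → ℝ =>
      solOp L (fun t => wpot q N x t - E)) x :=
    AnalyticAt.comp (g := Ring.inverse) hI hV
  exact ((ContinuousLinearMap.apply ℝ (ℝ →ᵇ ℝ) (initFun L c₀ c₁)).analyticAt _).comp hS

lemma analyticAt_siteInt_mul (hq : SingleSite q N η) {L : ℝ} (hL : 0 ≤ L) (E m c₀ c₁ d₀ d₁ : ℝ)
    (x : Fin (16 * N + 1) → ℝ) :
    AnalyticAt ℝ (fun x : Fin (16 * N + 1) → ℝ =>
      siteInt hq m (cauchySol L (fun t => wpot q N x t - E) c₀ c₁ *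
        cauchySol L (fun t => wpot q N x t - E) d₀ d₁)) x :=
  ((siteInt hq m).analyticAt _).comp
    ((analyticOnNhd_cauchySol hq hL E c₀ c₁ x (mem_univ x)).mul
      (analyticOnNhd_cauchySol hq hL E d₀ d₁ x (mem_univ x)))

lemma analyticAt_gramA (hq : SingleSite q N η) {L : ℝ} (hL : 0 ≤ L) (E m : ℝ)
    (x : Fin (16 * N + 1) → ℝ) : AnalyticAt ℝ (fun x : Fin (16 * N + 1) → ℝ =>
      gramA hq L (fun t => wpot q N x t - E) m) x :=
  analyticAt_siteInt_mul hq hL E m 1 0 1 0 x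

lemma analyticAt_gramB (hq : SingleSite q N η) {L : ℝ} (hL : 0 ≤ L) (E m : ℝ)
    (x : Fin (16 * N + 1) → ℝ) : AnalyticAt ℝ (fun x : Fin (16 * N + 1) → ℝ =>
      gramB hq L (fun t => wpot q N x t - E) m) x :=
  analyticAt_siteInt_mul hq hL E m 1 0 0 1 x

lemma analyticAt_gramC (hq : SingleSite q N η) {L : ℝ} (hL : 0 ≤ L) (E m : ℝ)
    (x : Fin (16 * N + 1) → ℝ) : AnalyticAt ℝ (fun x : Fin (16 * N + 1) → ℝ =>
      gramC hq L (fun t => wpot q N x t - E) m) x :=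
  analyticAt_siteInt_mul hq hL E m 0 1 0 1 x

lemma analyticAt_sqrt_comp {V : Type*} [NormedAddCommGroup V] [NormedSpace ℝ V] {f : V → ℝ}
    {x : V} (hf : AnalyticAt ℝ f x) (h0 : 0 < f x) : AnalyticAt ℝ (fun y => √(f y)) x :=
  AnalyticAt.comp (g := Real.sqrt) (Real.contDiffAt_sqrt h0.ne').analyticAt hf

/-! ### Functions with an analytic bound -/

/-- `C` is bounded in absolute value by a real analytic function. -/
def AnalyticallyBounded {V : Type*} [NormedAddCommGroup V] [NormedSpace ℝ V] (C : V → ℝ) : Prop :=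
  ∃ A : V → ℝ, (∀ x, AnalyticAt ℝ A x) ∧ ∀ x, |C x| ≤ A x

namespace AnalyticallyBounded

variable {V : Type*} [NormedAddCommGroup V] [NormedSpace ℝ V] {C D : V → ℝ}

lemma of_analytic (h : ∀ x, AnalyticAt ℝ C x) : AnalyticallyBounded C := by
  refine ⟨fun x => 1 + C x ^ 2, fun x => analyticAt_const.add ((h x).pow 2), fun x => ?_⟩
  have := sq_abs (C x)
  nlinarith [sq_nonneg (|C x| - 1), abs_nonneg (C x)]

lemma const (c : ℝ) : AnalyticallyBounded (fun _ : V => c) := of_analytic fun _ => analyticAt_const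

lemma add (hC : AnalyticallyBounded C) (hD : AnalyticallyBounded D) :
    AnalyticallyBounded (fun x => C x + D x) := by
  obtain ⟨A, hA, hA'⟩ := hC
  obtain ⟨B, hB, hB'⟩ := hD
  exact ⟨fun x => A x + B x, fun x => (hA x).add (hB x), fun x =>
    (abs_add_le _ _).trans (add_le_add (hA' x) (hB' x))⟩

lemma mul (hC : AnalyticallyBounded C) (hD : AnalyticallyBounded D) :
    AnalyticallyBounded (fun x => C x * D x) := by
  obtain ⟨A, hA, hA'⟩ := hC
  obtain ⟨B, hB, hB'⟩ := hD
  refine ⟨fun x => A x * B x, fun x => (hA x).mul (hB x), fun x => ?_⟩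
  rw [abs_mul]
  exact mul_le_mul (hA' x) (hB' x) (abs_nonneg _) ((abs_nonneg _).trans (hA' x))

lemma abs (hC : AnalyticallyBounded C) : AnalyticallyBounded (fun x => |C x|) := by
  obtain ⟨A, hA, hA'⟩ := hC
  exact ⟨A, hA, fun x => by rw [abs_abs]; exact hA' x⟩

lemma exp (hC : AnalyticallyBounded C) : AnalyticallyBounded (fun x => Real.exp (C x)) := by
  obtain ⟨A, hA, hA'⟩ := hC
  refine ⟨fun x => Real.exp (A x), fun x => (hA x).rexp', fun x => ?_⟩
  rw [abs_of_pos (Real.exp_pos _)]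
  exact Real.exp_le_exp.2 ((le_abs_self _).trans (hA' x))

lemma pow (hC : AnalyticallyBounded C) (n : ℕ) : AnalyticallyBounded (fun x => C x ^ n) := by
  obtain ⟨A, hA, hA'⟩ := hC
  refine ⟨fun x => A x ^ n, fun x => (hA x).pow n, fun x => ?_⟩
  rw [abs_pow]
  exact pow_le_pow_left₀ (abs_nonneg _) (hA' x) n

lemma sum {ι : Type*} {s : Finset ι} {C : ι → V → ℝ} (h : ∀ i, AnalyticallyBounded (C i)) :
    AnalyticallyBounded (fun x => ∑ i ∈ s, C i x) := by
  choose A hA hA' using h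
  exact ⟨fun x => ∑ i ∈ s, A i x, fun x => Finset.analyticAt_fun_sum _ fun i _ => hA i x, fun x =>
    (Finset.abs_sum_le_sum_abs _ _).trans (Finset.sum_le_sum fun i _ => hA' i x)⟩

/-- A function with an analytic bound is made bounded by a positive analytic factor. -/
lemma exists_damping (hC : AnalyticallyBounded C) :
    ∃ c : V → ℝ, (∀ x, AnalyticAt ℝ c x) ∧ (∀ x, 0 < c x) ∧ ∀ x, c x * C x ≤ 1 := by
  obtain ⟨A, hA, hA'⟩ := hC
  have hpos : ∀ x, 0 < 1 + A x := fun x => by linarith [(abs_nonneg _).trans (hA' x)]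
  refine ⟨fun x => (1 + A x)⁻¹, fun x => (analyticAt_const.add (hA x)).inv (hpos x).ne',
    fun x => inv_pos.2 (hpos x), fun x => ?_⟩
  rw [inv_mul_le_one₀ (hpos x)]
  linarith [le_abs_self (C x), hA' x]

end AnalyticallyBounded

lemma analyticallyBounded_coeffBound (η E : ℝ) :
    AnalyticallyBounded (fun x : Fin (16 * N + 1) → ℝ => coeffBound η x E) := by
  unfold coeffBound
  refine .add (.mul (.sum fun k => .abs (.of_analytic fun x => ?_)) (.const _)) (.const _)
  exact (ContinuousLinearMap.proj k : (Fin (16 * N + 1) → ℝ) →L[ℝ] ℝ).analyticAt x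

lemma AnalyticallyBounded.siteConst {V : Type*} [NormedAddCommGroup V] [NormedSpace ℝ V]
    {B : V → ℝ} (hB : AnalyticallyBounded B) (η : ℝ) (N : ℕ) (L : ℝ) :
    AnalyticallyBounded (fun x => Alloy.siteConst η N L (B x)) := by
  unfold Alloy.siteConst
  exact .mul (.const _) (.mul (.mul (.const _) (.pow (.mul (.exp (.mul hB (.const _))) (.const _)) 5))
    (.pow (.add (.const _) (.mul (.const _) hB)) 2))

/-! ### Constant couplings: Floquet theory below the spectrum -/

lemma wpot_const_periodic (hq : SingleSite q N η) (ω₀ : ℝ) {t : ℝ}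
    (ht : t ∈ Icc (-(7 * N : ℝ)) (7 * N - 1)) :
    wpot q N (fun _ => ω₀) (1 + t) = wpot q N (fun _ => ω₀) t := by
  unfold wpot
  rw [Fin.sum_univ_eq_sum_range (fun k : ℕ => ω₀ * q (1 + t + 8 * N - k)),
    Fin.sum_univ_eq_sum_range (fun k : ℕ => ω₀ * q (t + 8 * N - k)),
    Finset.sum_range_succ', Finset.sum_range_succ]
  congr 1
  · refine Finset.sum_congr rfl fun k _ => ?_
    congr 2
    push_cast
    ring
  · rw [hq.eq_zero (fun h => by have := h.2; push_cast at this; linarith [ht.1]),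
      hq.eq_zero (fun h => by have := h.1; push_cast at this; linarith [ht.2])]

lemma le_wpot_const (hq : SingleSite q N η) {ω₀ : ℝ} (h0 : 0 ≤ ω₀) {t : ℝ}
    (ht : t ∈ Icc (-(7 * N : ℝ)) (7 * N)) : ω₀ * η ≤ wpot q N (fun _ => ω₀) t := by
  have hN := hq.one_le_cast
  have hr := abs_le.1 (abs_sub_round t)
  have h1 : ((-(8 * N) : ℤ) : ℝ) ≤ round t := by push_cast; linarith [ht.1]
  have h2 : (round t : ℝ) ≤ ((8 * N : ℤ) : ℝ) := by push_cast; linarith [ht.2]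
  have h1' : -(8 * N : ℤ) ≤ round t := by exact_mod_cast h1
  have h2' : round t ≤ (8 * N : ℤ) := by exact_mod_cast h2
  obtain ⟨k, hk⟩ := Int.eq_ofNat_of_zero_le (show 0 ≤ round t + 8 * N by lia)
  have hkr : (round t : ℝ) = k - 8 * N := by
    have : (round t : ℤ) = k - 8 * N := by lia
    rw [this]; push_cast; ring
  have hkl : k < 16 * N + 1 := by lia
  have h3 : ω₀ * η ≤ ω₀ * q (t + 8 * N - k) := by
    refine mul_le_mul_of_nonneg_left (hq.eta_le ?_) h0
    exact ⟨by linarith [hr.1], by linarith [hr.2]⟩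
  refine h3.trans ?_
  unfold wpot
  exact Finset.single_le_sum (f := fun k : Fin (16 * N + 1) => ω₀ * q (t + 8 * N - (k : ℕ)))
    (fun i _ => mul_nonneg h0 (hq.nonneg _)) (Finset.mem_univ (⟨k, hkl⟩ : Fin (16 * N + 1)))

lemma pos_or_neg_of_ne_zero {f : ℝ → ℝ} {α β : ℝ} (hf : ContinuousOn f (Icc α β))
    (h0 : ∀ x ∈ Icc α β, f x ≠ 0) : (∀ x ∈ Icc α β, 0 < f x) ∨ (∀ x ∈ Icc α β, f x < 0) := by
  by_contra! hcon
  obtain ⟨⟨x, hx, hx0⟩, y, hy, hy0⟩ := hcon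
  obtain ⟨z, hz, hz0⟩ := isPreconnected_Icc.intermediate_value hx hy hf ⟨hx0, hy0⟩
  exact h0 z hz hz0

lemma Sol.wronskian {b y y' z z' : ℝ → ℝ} {α β B : ℝ} (hb : BddMeas b B) {S : Set ℝ}
    (hS : S.Countable) (hbS : ∀ x ∉ S, ContinuousAt b x) (h : Sol b α β y y')
    (k : Sol b α β z z') {s t : ℝ} (hs : s ∈ Icc α β) (ht : t ∈ Icc α β) :
    y' t * z t - y t * z' t = y' s * z s - y s * z' s := by
  have h1 := h.integral_by_parts hb hS hbS k hs ht
  have h2 := k.integral_by_parts hb hS hbS h hs ht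
  have h3 : ∫ x in s..t, (b x * y x * z x + y' x * z' x)
      = ∫ x in s..t, (b x * z x * y x + z' x * y' x) := by
    congr 1
    ext x
    ring
  linarith

lemma cauchySol'_apply_eq {L : ℝ} {b : ℝ → ℝ} {B : ℝ} (hb : BddMeas b B) (c₀ c₁ x : ℝ) :
    cauchySol' L b c₀ c₁ x = c₀ * cauchySol' L b 1 0 x + c₁ * cauchySol' L b 0 1 x := by
  have hi : ∀ c₀ c₁, IntervalIntegrable (fun t => b t * cauchySol L b c₀ c₁ t) volume 0 x :=
    fun c₀ c₁ => hb.intervalIntegrable_mul (cauchySol L b c₀ c₁).continuous.continuousOn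
  have e : ∀ t, b t * cauchySol L b c₀ c₁ t
      = c₀ * (b t * cauchySol L b 1 0 t) + c₁ * (b t * cauchySol L b 0 1 t) := fun t => by
    rw [cauchySol_apply_eq]; ring
  unfold cauchySol'
  simp only [e]
  rw [intervalIntegral.integral_add ((hi _ _).const_mul c₀) ((hi _ _).const_mul c₁),
    intervalIntegral.integral_const_mul, intervalIntegral.integral_const_mul]
  ring

/-- A positive 1-periodic coefficient on `[-L, L]`, so that the equation `y'' = b y` is hyperbolic:
this is the case of constant couplings with the energy below the infimum of the potential. The
coefficient is continuous off the countable set `S`, which integration by parts requires. -/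
structure Hyperbolic (b : ℝ → ℝ) (L B : ℝ) (S : Set ℝ) : Prop where
  bdd : BddMeas b B
  countable : S.Countable
  cont : ∀ x ∉ S, ContinuousAt b x
  pos : ∀ x ∈ Icc (-L) L, 0 < b x
  periodic : ∀ x ∈ Icc (-L) (L - 1), b (1 + x) = b x
  two_le : 2 ≤ L

namespace Hyperbolic

variable {b : ℝ → ℝ} {L B : ℝ} {S : Set ℝ}

lemma sol (h : Hyperbolic b L B S) (w₀ w₁ : ℝ) :
    Sol b (-L) L (cauchySol L b w₀ w₁) (cauchySol' L b w₀ w₁) :=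
  sol_cauchySol (by linarith [h.two_le]) h.bdd w₀ w₁

lemma zero_mem (h : Hyperbolic b L B S) : (0 : ℝ) ∈ Icc (-L) L := by
  have := h.two_le; exact ⟨by linarith, by linarith⟩

lemma one_mem (h : Hyperbolic b L B S) : (1 : ℝ) ∈ Icc (-L) L := by
  have := h.two_le; exact ⟨by linarith, by linarith⟩

lemma at_zero (h : Hyperbolic b L B S) (w₀ w₁ : ℝ) : cauchySol L b w₀ w₁ 0 = w₀ :=
  cauchySol_zero (by linarith [h.two_le]) h.bdd w₀ w₁

lemma nontrivial (h : Hyperbolic b L B S) {w₀ w₁ : ℝ} (hw : w₀ ≠ 0 ∨ w₁ ≠ 0) {x : ℝ}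
    (hx : x ∈ Icc (-L) L) : cauchySol L b w₀ w₁ x ≠ 0 ∨ cauchySol' L b w₀ w₁ x ≠ 0 := by
  by_contra! hcon
  have h1 := (h.sol w₀ w₁).wronskian h.bdd h.countable h.cont (h.sol 1 0) hx h.zero_mem
  have h2 := (h.sol w₀ w₁).wronskian h.bdd h.countable h.cont (h.sol 0 1) hx h.zero_mem
  simp only [h.at_zero, cauchySol'_zero, hcon.1, hcon.2] at h1 h2
  rcases hw with hw | hw
  · exact hw (by linarith)
  · exact hw (by linarith)

/-- `(y y')' = b y² + y'² > 0`. -/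
lemma mul_deriv_lt (h : Hyperbolic b L B S) {w₀ w₁ : ℝ} (hw : w₀ ≠ 0 ∨ w₁ ≠ 0) {s t : ℝ}
    (hs : s ∈ Icc (-L) L) (ht : t ∈ Icc (-L) L) (hst : s < t) :
    cauchySol' L b w₀ w₁ s * cauchySol L b w₀ w₁ s
      < cauchySol' L b w₀ w₁ t * cauchySol L b w₀ w₁ t := by
  have h1 := (h.sol w₀ w₁).integral_by_parts h.bdd h.countable h.cont (h.sol w₀ w₁) hs ht
  rw [← sub_pos, ← h1]
  refine intervalIntegral.intervalIntegral_pos_of_pos_on ?_ (fun x hx => ?_) hst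
  · refine IntervalIntegrable.add ?_ ?_
    · have := h.bdd.intervalIntegrable_mul (s := s) (t := t)
        (((cauchySol L b w₀ w₁).continuous.mul (cauchySol L b w₀ w₁).continuous).continuousOn)
      simpa only [mul_assoc, Pi.mul_apply] using this
    · exact ((cauchySol'_continuous h.bdd w₀ w₁).mul
        (cauchySol'_continuous h.bdd w₀ w₁)).intervalIntegrable _ _
  · have hx' : x ∈ Icc (-L) L := ⟨hs.1.trans hx.1.le, hx.2.le.trans ht.2⟩
    have hb := h.pos x hx'
    rw [mul_assoc]
    rcases h.nontrivial hw hx' with h2 | h2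
    · have := mul_pos hb (mul_self_pos.2 h2)
      linarith [mul_self_nonneg (cauchySol' L b w₀ w₁ x)]
    · have := mul_nonneg hb.le (mul_self_nonneg (cauchySol L b w₀ w₁ x))
      linarith [mul_self_pos.2 h2]

lemma det_eq_one (h : Hyperbolic b L B S) :
    cauchySol L b 1 0 1 * cauchySol' L b 0 1 1 - cauchySol' L b 1 0 1 * cauchySol L b 0 1 1 = 1 := by
  have h1 := (h.sol 1 0).wronskian h.bdd h.countable h.cont (h.sol 0 1) h.zero_mem h.one_mem
  simp only [h.at_zero, cauchySol'_zero] at h1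
  linarith

lemma monodromy_pos (h : Hyperbolic b L B S) :
    0 < cauchySol L b 1 0 1 ∧ 0 < cauchySol' L b 1 0 1 ∧ 0 < cauchySol L b 0 1 1 ∧
      0 < cauchySol' L b 0 1 1 := by
  have hL := h.two_le
  have hmem : ∀ x ∈ Icc (0 : ℝ) 1, x ∈ Icc (-L) L := fun x hx =>
    ⟨by linarith [hx.1], by linarith [hx.2]⟩
  have hpos : ∀ w₀ w₁ : ℝ, (w₀ ≠ 0 ∨ w₁ ≠ 0) → w₁ * w₀ = 0 → ∀ x ∈ Icc (0 : ℝ) 1, 0 < x →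
      0 < cauchySol' L b w₀ w₁ x * cauchySol L b w₀ w₁ x := by
    intro w₀ w₁ hw hw0 x hx hx0
    have := h.mul_deriv_lt hw h.zero_mem (hmem x hx) hx0
    rwa [h.at_zero, cauchySol'_zero, hw0] at this
  have one_mem : (1 : ℝ) ∈ Icc (0 : ℝ) 1 := by simp
  have zero_mem : (0 : ℝ) ∈ Icc (0 : ℝ) 1 := by simp
  have hΨ := hpos 1 0 (Or.inl one_ne_zero) (by norm_num)
  have hΦ := hpos 0 1 (Or.inr one_ne_zero) (by norm_num)
  have h1 : 0 < cauchySol L b 1 0 1 := by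
    have hne : ∀ x ∈ Icc (0 : ℝ) 1, cauchySol L b 1 0 x ≠ 0 := by
      intro x hx
      rcases hx.1.eq_or_lt with rfl | hx0
      · rw [h.at_zero]; exact one_ne_zero
      · exact right_ne_zero_of_mul (hΨ x hx hx0).ne'
    rcases pos_or_neg_of_ne_zero (cauchySol L b 1 0).continuous.continuousOn hne with h1 | h1
    · exact h1 1 one_mem
    · have := h1 0 zero_mem
      rw [h.at_zero] at this
      linarith
  have h2 : 0 < cauchySol' L b 0 1 1 := by
    have hne : ∀ x ∈ Icc (0 : ℝ) 1, cauchySol' L b 0 1 x ≠ 0 := by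
      intro x hx
      rcases hx.1.eq_or_lt with rfl | hx0
      · rw [cauchySol'_zero]; exact one_ne_zero
      · exact left_ne_zero_of_mul (hΦ x hx hx0).ne'
    rcases pos_or_neg_of_ne_zero (cauchySol'_continuous h.bdd 0 1).continuousOn hne with h1 | h1
    · exact h1 1 one_mem
    · have := h1 0 zero_mem
      rw [cauchySol'_zero] at this
      linarith
  exact ⟨h1, pos_of_mul_pos_left (hΨ 1 one_mem one_pos) h1.le,
    pos_of_mul_pos_right (hΦ 1 one_mem one_pos) h2.le, h2⟩

/-- The trace of the monodromy matrix. -/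
def trace (_ : Hyperbolic b L B S) : ℝ := cauchySol L b 1 0 1 + cauchySol' L b 0 1 1

lemma trace_pos (h : Hyperbolic b L B S) : 0 < h.trace := by
  obtain ⟨h1, -, -, h4⟩ := h.monodromy_pos
  exact add_pos h1 h4

lemma four_lt_trace_sq (h : Hyperbolic b L B S) : 4 < h.trace ^ 2 := by
  obtain ⟨h1, h2, h3, h4⟩ := h.monodromy_pos
  have hd := h.det_eq_one
  have h5 := mul_pos h2 h3
  unfold trace
  nlinarith [sq_nonneg (cauchySol L b 1 0 1 - cauchySol' L b 0 1 1)]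

lemma cauchySol_one_add (h : Hyperbolic b L B S) (w₀ w₁ : ℝ) {x : ℝ}
    (hx : x ∈ Icc (-(L - 1)) (L - 1)) :
    cauchySol L b w₀ w₁ (1 + x)
      = cauchySol L b (cauchySol L b w₀ w₁ 1) (cauchySol' L b w₀ w₁ 1) x := by
  have hL := h.two_le
  have h1 : Sol b (-(L - 1)) (L - 1) (fun t => cauchySol L b w₀ w₁ (1 + t))
      (fun t => cauchySol' L b w₀ w₁ (1 + t)) :=
    (((h.sol w₀ w₁).shift 1).mono (by linarith) le_rfl).congr_coeff fun t ht =>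
      (h.periodic t ⟨by linarith [ht.1], ht.2⟩).symm
  have h2 := h1.eq_cauchySol (by linarith) h.bdd hx
  rw [h2, cauchySol_eq_of_le (L' := L) (by linarith) (by linarith) h.bdd _ _ hx]
  simp only [add_zero]

lemma siteBilin_succ (h : Hyperbolic b L B S) (hq : SingleSite q N η) {m : ℝ} (hm0 : 0 ≤ m)
    (hm : m + 1 + N ≤ L) (w₀ w₁ v₀ v₁ : ℝ) :
    siteBilin hq L b (1 + m) w₀ w₁ v₀ v₁ =
      siteBilin hq L b m (cauchySol L b w₀ w₁ 1) (cauchySol' L b w₀ w₁ 1)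
        (cauchySol L b v₀ v₁ 1) (cauchySol' L b v₀ v₁ 1) := by
  rw [siteBilin_eq, siteBilin_eq]
  have key : ∀ w₀ w₁ : ℝ, ∀ x ∈ Icc (-(N : ℝ)) N, cauchySol L b w₀ w₁ (1 + m + x)
      = cauchySol L b (cauchySol L b w₀ w₁ 1) (cauchySol' L b w₀ w₁ 1) (m + x) := by
    intro w₀ w₁ x hx
    rw [add_assoc]
    exact h.cauchySol_one_add w₀ w₁ ⟨by linarith [hx.1], by linarith [hx.2]⟩
  exact qInner_congr (key w₀ w₁) (key v₀ v₁)

/-! ### Floquet solutions -/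

/-- The second component of the eigenvector `(Φ(1), lam - Ψ(1))` of the monodromy matrix. -/
def eig (_ : Hyperbolic b L B S) (lam : ℝ) : ℝ := lam - cauchySol L b 1 0 1

/-- The Floquet solution with multiplier `lam`. -/
def floquet (h : Hyperbolic b L B S) (lam : ℝ) : ℝ →ᵇ ℝ :=
  cauchySol L b (cauchySol L b 0 1 1) (h.eig lam)

variable {lam mu : ℝ}

lemma eig_ne_zero (h : Hyperbolic b L B S) (lam : ℝ) :
    cauchySol L b 0 1 1 ≠ 0 ∨ h.eig lam ≠ 0 := Or.inl h.monodromy_pos.2.2.1.ne'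

lemma monodromy_eig (h : Hyperbolic b L B S) (hl : lam ^ 2 - h.trace * lam + 1 = 0) :
    cauchySol L b (cauchySol L b 0 1 1) (h.eig lam) 1 = lam * cauchySol L b 0 1 1 ∧
      cauchySol' L b (cauchySol L b 0 1 1) (h.eig lam) 1 = lam * h.eig lam := by
  have hd := h.det_eq_one
  rw [cauchySol_apply_eq, cauchySol'_apply_eq h.bdd]
  unfold eig trace at *
  constructor
  · ring
  · linear_combination -hd - hl

lemma floquet_one_add (h : Hyperbolic b L B S) (hl : lam ^ 2 - h.trace * lam + 1 = 0) {x : ℝ}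
    (hx : x ∈ Icc (-(L - 1)) (L - 1)) : h.floquet lam (1 + x) = lam * h.floquet lam x := by
  unfold floquet
  rw [h.cauchySol_one_add _ _ hx, (h.monodromy_eig hl).1, (h.monodromy_eig hl).2,
    cauchySol_apply_eq, cauchySol_apply_eq L b (cauchySol L b 0 1 1)]
  ring

/-- A Floquet solution has no zeros: otherwise it would vanish at two points at distance one, where
the strictly increasing function `y y'` would vanish too. -/
lemma floquet_ne_zero (h : Hyperbolic b L B S) (hl : lam ^ 2 - h.trace * lam + 1 = 0) {x : ℝ}
    (hx : x ∈ Icc (-(L - 1)) (L - 1)) : h.floquet lam x ≠ 0 := by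
  intro h0
  have h1 : h.floquet lam (1 + x) = 0 := by rw [h.floquet_one_add hl hx, h0, mul_zero]
  have := h.mul_deriv_lt (h.eig_ne_zero lam) (s := x) (t := 1 + x)
    ⟨by linarith [hx.1], by linarith [hx.2]⟩ ⟨by linarith [hx.1], by linarith [hx.2]⟩
    (by linarith)
  unfold floquet at h0 h1
  rw [h0, h1] at this
  linarith

/-- The polar form of the site forms on two Floquet solutions. -/
def floquetBilin (h : Hyperbolic b L B S) (hq : SingleSite q N η) (m lam mu : ℝ) : ℝ :=
  siteBilin hq L b m (cauchySol L b 0 1 1) (h.eig lam) (cauchySol L b 0 1 1) (h.eig mu)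

lemma floquetBilin_succ (h : Hyperbolic b L B S) (hq : SingleSite q N η)
    (hl : lam ^ 2 - h.trace * lam + 1 = 0) (hmu : mu ^ 2 - h.trace * mu + 1 = 0) {m : ℝ}
    (hm0 : 0 ≤ m) (hm : m + 1 + N ≤ L) :
    h.floquetBilin hq (1 + m) lam mu = lam * mu * h.floquetBilin hq m lam mu := by
  unfold floquetBilin
  rw [h.siteBilin_succ hq hm0 hm, (h.monodromy_eig hl).1, (h.monodromy_eig hl).2,
    (h.monodromy_eig hmu).1, (h.monodromy_eig hmu).2]
  unfold siteBilin
  ring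

lemma floquetBilin_nat (h : Hyperbolic b L B S) (hq : SingleSite q N η) (hLN : N + 3 ≤ L)
    (hl : lam ^ 2 - h.trace * lam + 1 = 0) (hmu : mu ^ 2 - h.trace * mu + 1 = 0) {m : ℕ}
    (hm : m ≤ 3) :
    h.floquetBilin hq m lam mu = (lam * mu) ^ m * h.floquetBilin hq 0 lam mu := by
  induction m with
  | zero => simp
  | succ m ih =>
    have hm' : (m : ℝ) ≤ 2 := by exact_mod_cast (by lia : m ≤ 2)
    rw [show ((m + 1 : ℕ) : ℝ) = 1 + m by push_cast; ring,
      h.floquetBilin_succ hq hl hmu (by positivity) (by linarith), ih (by lia)]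
    ring

lemma floquetBilin_zero_ne (h : Hyperbolic b L B S) (hq : SingleSite q N η) (hLN : N + 3 ≤ L)
    (hl : lam ^ 2 - h.trace * lam + 1 = 0) (hmu : mu ^ 2 - h.trace * mu + 1 = 0) :
    h.floquetBilin hq 0 lam mu ≠ 0 := by
  have hmem : ∀ x ∈ Icc (-(N : ℝ)) N, x ∈ Icc (-(L - 1)) (L - 1) := fun x hx =>
    ⟨by linarith [hx.1], by linarith [hx.2]⟩
  have hN := hq.one_le_cast
  have e : h.floquetBilin hq 0 lam mu
      = ∫ t in (-(N : ℝ))..N, h.floquet lam t * h.floquet mu t * q t := by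
    unfold floquetBilin
    rw [siteBilin_eq]
    simp only [zero_add]
    rfl
  have hc : ContinuousOn (fun t => h.floquet lam t * h.floquet mu t) (Icc (-(N : ℝ)) N) :=
    ((h.floquet lam).continuous.mul (h.floquet mu).continuous).continuousOn
  have h0 : (0 : ℝ) ∈ Icc (-(N : ℝ)) N := ⟨by linarith, by linarith⟩
  rw [e]
  rcases pos_or_neg_of_ne_zero hc (fun x hx =>
    mul_ne_zero (h.floquet_ne_zero hl (hmem x hx)) (h.floquet_ne_zero hmu (hmem x hx)))
    with hp | hn
  · exact (hq.integral_pos hc (fun x hx => (hp x hx).le) (x₀ := 0) (by norm_num) (hp 0 h0)).ne'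
  · have := hq.integral_pos (g := fun t => -(h.floquet lam t * h.floquet mu t)) hc.neg
      (fun x hx => by linarith [hn x hx]) (x₀ := 0) (by norm_num) (by linarith [hn 0 h0])
    simp only [neg_mul, intervalIntegral.integral_neg] at this
    intro h3
    rw [h3] at this
    linarith

lemma exists_multipliers (h : Hyperbolic b L B S) : ∃ lam mu : ℝ,
    lam ^ 2 - h.trace * lam + 1 = 0 ∧ mu ^ 2 - h.trace * mu + 1 = 0 ∧ lam * mu = 1 ∧
      lam ^ 2 ≠ mu ^ 2 ∧ lam ^ 2 ≠ 1 ∧ mu ^ 2 ≠ 1 := by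
  have ht := h.trace_pos
  have ht4 := h.four_lt_trace_sq
  set τ := h.trace
  have hd : √(τ ^ 2 - 4) ^ 2 = τ ^ 2 - 4 := Real.sq_sqrt (by linarith)
  have hdpos : 0 < √(τ ^ 2 - 4) := Real.sqrt_pos.2 (by linarith)
  set d := √(τ ^ 2 - 4)
  have hprod : (τ + d) / 2 * ((τ - d) / 2) = 1 := by linear_combination -hd / 4
  have hne : ((τ + d) / 2) ^ 2 ≠ ((τ - d) / 2) ^ 2 := by
    intro h0
    have : τ * d = 0 := by linear_combination h0
    exact (mul_pos ht hdpos).ne' this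
  have hsq : ((τ + d) / 2) ^ 2 * ((τ - d) / 2) ^ 2 = 1 := by rw [← mul_pow, hprod, one_pow]
  refine ⟨(τ + d) / 2, (τ - d) / 2, by linear_combination hd / 4, by linear_combination hd / 4,
    hprod, hne, fun h1 => ?_, fun h1 => ?_⟩
  · rw [h1, one_mul] at hsq
    exact hne (h1.trans hsq.symm)
  · rw [h1, mul_one] at hsq
    exact hne (hsq.trans h1.symm)

/-- Different energies have different traces: if the traces agreed, the Wronskian of Floquet
solutions with inverse multipliers would be periodic, although its derivative has a fixed sign. -/
lemma trace_ne {c : ℝ → ℝ} {C δ : ℝ} {T : Set ℝ} (h : Hyperbolic b L B S)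
    (k : Hyperbolic c L C T) (hδ : δ ≠ 0) (hbc : ∀ x, b x - c x = δ) : h.trace ≠ k.trace := by
  intro heq
  obtain ⟨lam, mu, hl, hmu, hlm, -⟩ := h.exists_multipliers
  rw [heq] at hmu
  have hL := h.two_le
  have hS := (h.sol (cauchySol L b 0 1 1) (h.eig lam)).integral_by_parts h.bdd h.countable h.cont
    (k.sol (cauchySol L c 0 1 1) (k.eig mu)) h.zero_mem h.one_mem
  have hT := (k.sol (cauchySol L c 0 1 1) (k.eig mu)).integral_by_parts k.bdd k.countable k.cont
    (h.sol (cauchySol L b 0 1 1) (h.eig lam)) h.zero_mem h.one_mem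
  rw [(h.monodromy_eig hl).2, (k.monodromy_eig hmu).1, k.at_zero, cauchySol'_zero] at hS
  rw [(k.monodromy_eig hmu).2, (h.monodromy_eig hl).1, h.at_zero, cauchySol'_zero] at hT
  change ∫ x in (0 : ℝ)..1, (b x * h.floquet lam x * k.floquet mu x + _) = _ at hS
  change ∫ x in (0 : ℝ)..1, (c x * k.floquet mu x * h.floquet lam x + _) = _ at hT
  set φ := h.floquet lam with hφ
  set χ := k.floquet mu with hχ
  have hc1 := cauchySol'_continuous (L := L) h.bdd (cauchySol L b 0 1 1) (h.eig lam)
  have hc2 := cauchySol'_continuous (L := L) k.bdd (cauchySol L c 0 1 1) (k.eig mu)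
  have i1 : IntervalIntegrable (fun x => b x * φ x * χ x) volume 0 1 := by
    have := h.bdd.intervalIntegrable_mul (s := 0) (t := 1)
      (φ.continuous.mul χ.continuous).continuousOn
    simpa only [mul_assoc, Pi.mul_apply] using this
  have i2 : IntervalIntegrable (fun x => c x * χ x * φ x) volume 0 1 := by
    have := k.bdd.intervalIntegrable_mul (s := 0) (t := 1)
      (χ.continuous.mul φ.continuous).continuousOn
    simpa only [mul_assoc, Pi.mul_apply] using this
  have hint : ∫ x in (0 : ℝ)..1, δ * (φ x * χ x) = 0 := by
    have e1 := intervalIntegral.integral_sub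
      (i1.add ((hc1.mul hc2).intervalIntegrable 0 1))
      (i2.add ((hc2.mul hc1).intervalIntegrable 0 1))
    simp only [Pi.mul_apply] at e1
    rw [hS, hT] at e1
    have e2 : ∀ x, b x * φ x * χ x + cauchySol' L b (cauchySol L b 0 1 1) (h.eig lam) x *
        cauchySol' L c (cauchySol L c 0 1 1) (k.eig mu) x -
        (c x * χ x * φ x + cauchySol' L c (cauchySol L c 0 1 1) (k.eig mu) x *
          cauchySol' L b (cauchySol L b 0 1 1) (h.eig lam) x) = δ * (φ x * χ x) := fun x => by
      rw [← hbc x]; ring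
    simp only [e2] at e1
    rw [e1]
    linear_combination (h.eig lam * cauchySol L c 0 1 1 - k.eig mu * cauchySol L b 0 1 1) * hlm
  rw [intervalIntegral.integral_const_mul] at hint
  have hint' := (mul_eq_zero.1 hint).resolve_left hδ
  have hmem : ∀ x ∈ Icc (0 : ℝ) 1, x ∈ Icc (-(L - 1)) (L - 1) := fun x hx =>
    ⟨by linarith [hx.1], by linarith [hx.2]⟩
  have hcont : Continuous fun x => φ x * χ x := φ.continuous.mul χ.continuous
  rcases pos_or_neg_of_ne_zero hcont.continuousOn (fun x hx =>
    mul_ne_zero (h.floquet_ne_zero hl (hmem x hx)) (k.floquet_ne_zero hmu (hmem x hx)))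
    with hp | hn
  · have := intervalIntegral.intervalIntegral_pos_of_pos_on (hcont.intervalIntegrable 0 1)
      (fun x hx => hp x (Ioo_subset_Icc_self hx)) one_pos
    linarith
  · have := intervalIntegral.intervalIntegral_pos_of_pos_on (hcont.neg.intervalIntegrable 0 1)
      (fun x hx => by simpa using hn x (Ioo_subset_Icc_self hx)) one_pos
    simp only [Pi.neg_apply, intervalIntegral.integral_neg] at this
    linarith

end Hyperbolic

/-! ### Elimination of the quadratic forms at the first energy -/

/-- The determinant of the rows `(a i, b i, c i)`, `(a j, b j, c j)`, `(a k, b k, c k)`. -/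
def minor (a b c : ℕ → ℝ) (i j k : ℕ) : ℝ :=
  a i * (b j * c k - b k * c j) - a j * (b i * c k - b k * c i) + a k * (b i * c j - b j * c i)

/-- The vector of signed maximal minors of the `4 × 3` matrix with the rows `(a i, b i, c i)`; it
annihilates the three columns. -/
def cofactor (a b c : ℕ → ℝ) : ℕ → ℝ
  | 0 => minor a b c 1 2 3
  | 1 => -minor a b c 0 2 3
  | 2 => minor a b c 0 1 3
  | _ => -minor a b c 0 1 2

lemma sum_cofactor_mul (a b c : ℕ → ℝ) :
    ∑ m ∈ Finset.range 4, cofactor a b c m * a m = 0 ∧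
      ∑ m ∈ Finset.range 4, cofactor a b c m * b m = 0 ∧
      ∑ m ∈ Finset.range 4, cofactor a b c m * c m = 0 := by
  simp only [Finset.sum_range_succ, Finset.sum_range_zero, cofactor, minor]
  refine ⟨by ring, by ring, by ring⟩

/-- If the fourth row is a combination of the others, so are the cofactors. -/
lemma cofactor_of_recurrence {a b c : ℕ → ℝ} {s : ℝ} (ha : a 3 = s * a 2 - s * a 1 + a 0)
    (hb : b 3 = s * b 2 - s * b 1 + b 0) (hc : c 3 = s * c 2 - s * c 1 + c 0) :
    cofactor a b c 0 = minor a b c 0 1 2 ∧ cofactor a b c 1 = -s * minor a b c 0 1 2 ∧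
      cofactor a b c 2 = s * minor a b c 0 1 2 ∧ cofactor a b c 3 = -minor a b c 0 1 2 := by
  simp only [cofactor, minor, ha, hb, hc]
  refine ⟨by ring, by ring, by ring, trivial⟩

section

variable (hq : SingleSite q N η) (F G : ℝ) (x : Fin (16 * N + 1) → ℝ)

/-- The coefficients `κ_m`, `m = 0, …, 3`, for which `∑ κ_m ∫ y(m + t)² q(t) dt = 0` for every
solution `y` at the energy `F`. -/
def elim (m : ℕ) : ℝ :=
  cofactor (fun m => gramA hq (7 * N) (fun t => wpot q N x t - F) m)
    (fun m => gramB hq (7 * N) (fun t => wpot q N x t - F) m)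
    (fun m => gramC hq (7 * N) (fun t => wpot q N x t - F) m) m

lemma sum_elim_siteForm (w₀ w₁ : ℝ) : ∑ m ∈ Finset.range 4,
    elim hq F x m * siteForm hq (7 * N) (fun t => wpot q N x t - F) m w₀ w₁ = 0 := by
  obtain ⟨h1, h2, h3⟩ := sum_cofactor_mul
    (fun m => gramA hq (7 * N) (fun t => wpot q N x t - F) m)
    (fun m => gramB hq (7 * N) (fun t => wpot q N x t - F) m)
    (fun m => gramC hq (7 * N) (fun t => wpot q N x t - F) m)
  unfold elim siteForm
  simp only [Finset.sum_range_succ, Finset.sum_range_zero] at h1 h2 h3 ⊢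
  linear_combination w₀ ^ 2 * h1 + 2 * (w₀ * w₁) * h2 + w₁ ^ 2 * h3

/-- The quadratic form `∑ κ_m ∫ y(m + t)² q(t) dt` of the solutions at the energy `G`, as a function
of the Cauchy data. -/
def elimForm (w₀ w₁ : ℝ) : ℝ := ∑ m ∈ Finset.range 4,
  elim hq F x m * siteForm hq (7 * N) (fun t => wpot q N x t - G) m w₀ w₁

lemma analyticAt_elim (m : ℕ) :
    AnalyticAt ℝ (fun x : Fin (16 * N + 1) → ℝ => elim hq F x m) x := by
  have hL : (0 : ℝ) ≤ 7 * N := by positivity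
  have hA := fun m : ℕ => analyticAt_gramA hq hL F m x
  have hB := fun m : ℕ => analyticAt_gramB hq hL F m x
  have hC := fun m : ℕ => analyticAt_gramC hq hL F m x
  have hminor : ∀ i j k, AnalyticAt ℝ (fun x : Fin (16 * N + 1) → ℝ =>
      minor (fun m => gramA hq (7 * N) (fun t => wpot q N x t - F) m)
        (fun m => gramB hq (7 * N) (fun t => wpot q N x t - F) m)
        (fun m => gramC hq (7 * N) (fun t => wpot q N x t - F) m) i j k) x := by
    intro i j k
    unfold minor
    exact (((hA i).mul (((hB j).mul (hC k)).sub ((hB k).mul (hC j)))).sub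
      ((hA j).mul (((hB i).mul (hC k)).sub ((hB k).mul (hC i))))).add
      ((hA k).mul (((hB i).mul (hC j)).sub ((hB j).mul (hC i))))
  unfold elim
  match m with
  | 0 => exact hminor 1 2 3
  | 1 => exact (hminor 0 2 3).neg
  | 2 => exact hminor 0 1 3
  | n + 3 => exact (hminor 0 1 2).neg

/-! ### The form in Prüfer coordinates -/

/-- `∑ κ_m gramA_m`, the coefficient of `w₀²` in `elimForm`. -/
def elimA : ℝ := ∑ m ∈ Finset.range 4,
  elim hq F x m * gramA hq (7 * N) (fun t => wpot q N x t - G) m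

/-- `∑ κ_m gramB_m`, half the coefficient of `w₀ w₁` in `elimForm`. -/
def elimB : ℝ := ∑ m ∈ Finset.range 4,
  elim hq F x m * gramB hq (7 * N) (fun t => wpot q N x t - G) m

/-- `∑ κ_m gramC_m`, the coefficient of `w₁²` in `elimForm`. -/
def elimC : ℝ := ∑ m ∈ Finset.range 4,
  elim hq F x m * gramC hq (7 * N) (fun t => wpot q N x t - G) m

lemma elimForm_eq (w₀ w₁ : ℝ) : elimForm hq F G x w₀ w₁ =
    elimA hq F G x * w₀ ^ 2 + 2 * elimB hq F G x * (w₀ * w₁) + elimC hq F G x * w₁ ^ 2 := by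
  unfold elimForm elimA elimB elimC siteForm
  simp only [Finset.sum_range_succ, Finset.sum_range_zero]
  ring

/-- `‖Ψ‖_q²` at the energy `G`. -/
def normSqΨ : ℝ := gramA hq (7 * N) (fun t => wpot q N x t - G) 0

/-- The Gram–Schmidt coefficient `⟨Ψ, Φ⟩_q / ‖Ψ‖_q²` at the energy `G`. -/
def gsCoeff : ℝ := gramB hq (7 * N) (fun t => wpot q N x t - G) 0 /
  gramA hq (7 * N) (fun t => wpot q N x t - G) 0

/-- The squared norm of the part of `Φ` orthogonal to `Ψ`, at the energy `G`. -/
def normSqΦ : ℝ := gramC hq (7 * N) (fun t => wpot q N x t - G) 0 -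
  gramB hq (7 * N) (fun t => wpot q N x t - G) 0 ^ 2 /
    gramA hq (7 * N) (fun t => wpot q N x t - G) 0

lemma le_seven : (N : ℝ) ≤ 7 * N := by linarith [Nat.cast_nonneg (α := ℝ) N]

lemma normSqΨ_pos : 0 < normSqΨ hq G x := gramA_pos hq le_seven (bddMeas_wpot hq x G)

lemma normSqΦ_pos : 0 < normSqΦ hq G x := by
  have hA := gramA_pos hq le_seven (bddMeas_wpot hq x G)
  have h := gram_det_pos hq le_seven (bddMeas_wpot hq x G)
  unfold normSqΦ
  rw [sub_pos, div_lt_iff₀ hA]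
  linarith

/-- The coefficient of `A²` in the form `elimForm`, written in the Prüfer coordinates `(A, B)`. -/
def formA : ℝ := elimA hq F G x / normSqΨ hq G x

/-- The coefficient of `A B` in the form `elimForm`, written in the Prüfer coordinates `(A, B)`. -/
def formB : ℝ := (2 * elimB hq F G x - 2 * elimA hq F G x * gsCoeff hq G x) /
  (√(normSqΨ hq G x) * √(normSqΦ hq G x))

/-- The coefficient of `B²` in the form `elimForm`, written in the Prüfer coordinates `(A, B)`. -/
def formC : ℝ := (elimA hq F G x * gsCoeff hq G x ^ 2 - 2 * elimB hq F G x * gsCoeff hq G x +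
  elimC hq F G x) / normSqΦ hq G x

lemma elimForm_eq_prufer (w₀ w₁ : ℝ) : elimForm hq F G x w₀ w₁ =
    formA hq F G x * (√(normSqΨ hq G x) * (w₀ + gsCoeff hq G x * w₁)) ^ 2 +
      formB hq F G x * ((√(normSqΨ hq G x) * (w₀ + gsCoeff hq G x * w₁)) *
        (√(normSqΦ hq G x) * w₁)) +
      formC hq F G x * (√(normSqΦ hq G x) * w₁) ^ 2 := by
  have h1 := normSqΨ_pos hq G x
  have h2 := normSqΦ_pos hq G x
  have e1 := Real.sq_sqrt h1.le
  have e2 := Real.sq_sqrt h2.le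
  have s1 := Real.sqrt_pos.2 h1
  have s2 := Real.sqrt_pos.2 h2
  rw [elimForm_eq, mul_pow, mul_pow, e1, e2]
  unfold formA formB formC
  field_simp
  ring

lemma analyticAt_form :
    AnalyticAt ℝ (fun x => formA hq F G x) x ∧ AnalyticAt ℝ (fun x => formB hq F G x) x ∧
      AnalyticAt ℝ (fun x => formC hq F G x) x := by
  have hL : (0 : ℝ) ≤ 7 * N := by positivity
  have hE := fun m : ℕ => analyticAt_elim hq F x m
  have hA : AnalyticAt ℝ (fun x => elimA hq F G x) x := by
    unfold elimA
    exact Finset.analyticAt_fun_sum _ fun m _ => (hE m).mul (analyticAt_gramA hq hL G m x)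
  have hB : AnalyticAt ℝ (fun x => elimB hq F G x) x := by
    unfold elimB
    exact Finset.analyticAt_fun_sum _ fun m _ => (hE m).mul (analyticAt_gramB hq hL G m x)
  have hC : AnalyticAt ℝ (fun x => elimC hq F G x) x := by
    unfold elimC
    exact Finset.analyticAt_fun_sum _ fun m _ => (hE m).mul (analyticAt_gramC hq hL G m x)
  have hΨ : AnalyticAt ℝ (fun x => normSqΨ hq G x) x := analyticAt_gramA hq hL G 0 x
  have hΨ0 := normSqΨ_pos hq G x
  have hΦ0 := normSqΦ_pos hq G x
  have hg : AnalyticAt ℝ (fun x => gsCoeff hq G x) x :=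
    (analyticAt_gramB hq hL G 0 x).div (analyticAt_gramA hq hL G 0 x) hΨ0.ne'
  have hΦ : AnalyticAt ℝ (fun x => normSqΦ hq G x) x :=
    (analyticAt_gramC hq hL G 0 x).sub (((analyticAt_gramB hq hL G 0 x).pow 2).div
      (analyticAt_gramA hq hL G 0 x) hΨ0.ne')
  refine ⟨hA.div hΨ hΨ0.ne', ?_, ?_⟩
  · refine AnalyticAt.div ?_ ((analyticAt_sqrt_comp hΨ hΨ0).mul (analyticAt_sqrt_comp hΦ hΦ0))
      (mul_pos (Real.sqrt_pos.2 hΨ0) (Real.sqrt_pos.2 hΦ0)).ne'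
    exact (analyticAt_const.mul hB).sub ((analyticAt_const.mul hA).mul hg)
  · refine AnalyticAt.div ?_ hΦ hΦ0.ne'
    exact ((hA.mul (hg.pow 2)).sub ((analyticAt_const.mul hB).mul hg)).add hC

end

/-! ### The form does not vanish for constant couplings -/

namespace Hyperbolic

variable {b : ℝ → ℝ} {L B : ℝ} {S : Set ℝ}

/-- The Gram matrices at consecutive sites satisfy the recurrence with the characteristic roots
`lam²`, `1`, `lam⁻²`, where `lam` and `lam⁻¹` are the eigenvalues of the monodromy matrix. -/
lemma gram_recurrence (h : Hyperbolic b L B S) (hq : SingleSite q N η) (hLN : N + 3 ≤ L) :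
    (gramA hq L b 3 = (h.trace ^ 2 - 1) * gramA hq L b 2
        - (h.trace ^ 2 - 1) * gramA hq L b 1 + gramA hq L b 0) ∧
      (gramB hq L b 3 = (h.trace ^ 2 - 1) * gramB hq L b 2
        - (h.trace ^ 2 - 1) * gramB hq L b 1 + gramB hq L b 0) ∧
      (gramC hq L b 3 = (h.trace ^ 2 - 1) * gramC hq L b 2
        - (h.trace ^ 2 - 1) * gramC hq L b 1 + gramC hq L b 0) := by
  have hd := h.det_eq_one
  have hp := h.monodromy_pos.1
  have key : ∀ m : ℝ, 0 ≤ m → m ≤ 2 →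
      gramA hq L b (1 + m) = gramA hq L b m * cauchySol L b 1 0 1 ^ 2
        + 2 * gramB hq L b m * (cauchySol L b 1 0 1 * cauchySol' L b 1 0 1)
        + gramC hq L b m * cauchySol' L b 1 0 1 ^ 2 ∧
      gramB hq L b (1 + m) = gramA hq L b m * (cauchySol L b 1 0 1 * cauchySol L b 0 1 1)
        + gramB hq L b m * (cauchySol L b 1 0 1 * cauchySol' L b 0 1 1
          + cauchySol' L b 1 0 1 * cauchySol L b 0 1 1)
        + gramC hq L b m * (cauchySol' L b 1 0 1 * cauchySol' L b 0 1 1) ∧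
      gramC hq L b (1 + m) = gramA hq L b m * cauchySol L b 0 1 1 ^ 2
        + 2 * gramB hq L b m * (cauchySol L b 0 1 1 * cauchySol' L b 0 1 1)
        + gramC hq L b m * cauchySol' L b 0 1 1 ^ 2 := by
    intro m hm0 hm2
    have e1 := h.siteBilin_succ hq hm0 (by linarith) 1 0 1 0
    have e2 := h.siteBilin_succ hq hm0 (by linarith) 1 0 0 1
    have e3 := h.siteBilin_succ hq hm0 (by linarith) 0 1 0 1
    unfold siteBilin at e1 e2 e3
    exact ⟨by linear_combination e1, by linear_combination e2, by linear_combination e3⟩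
  obtain ⟨a1, b1, c1⟩ := key 0 le_rfl (by norm_num)
  obtain ⟨a2, b2, c2⟩ := key 1 (by norm_num) (by norm_num)
  obtain ⟨a3, b3, c3⟩ := key 2 (by norm_num) (by norm_num)
  norm_num at a1 b1 c1 a2 b2 c2 a3 b3 c3
  unfold trace
  generalize cauchySol L b 1 0 1 = p at *
  generalize cauchySol L b 0 1 1 = r at *
  generalize cauchySol' L b 1 0 1 = p' at *
  generalize cauchySol' L b 0 1 1 = r' at *
  have hr' : r' = (1 + p' * r) / p := by
    rw [eq_div_iff hp.ne']; linear_combination hd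
  rw [a3, b3, c3, a2, b2, c2, a1, b1, c1, hr']
  refine ⟨?_, ?_, ?_⟩ <;> field_simp <;> ring

/-- The Gram matrices at three consecutive sites are linearly independent: on the Floquet solutions
this is a Vandermonde determinant with the nodes `lam²`, `1`, `lam⁻²`. -/
lemma minor_ne_zero (h : Hyperbolic b L B S) (hq : SingleSite q N η) (hLN : N + 3 ≤ L) :
    minor (fun m => gramA hq L b m) (fun m => gramB hq L b m) (fun m => gramC hq L b m) 0 1 2
      ≠ 0 := by
  obtain ⟨lam, mu, hl, hmu, hlm, hne, hl1, hmu1⟩ := h.exists_multipliers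
  intro h0
  have P := h.floquetBilin_zero_ne hq hLN hl hl
  have X := h.floquetBilin_zero_ne hq hLN hl hmu
  have Q := h.floquetBilin_zero_ne hq hLN hmu hmu
  have P1 := h.floquetBilin_nat hq hLN hl hl (m := 1) (by norm_num)
  have P2 := h.floquetBilin_nat hq hLN hl hl (m := 2) (by norm_num)
  have X1 := h.floquetBilin_nat hq hLN hl hmu (m := 1) (by norm_num)
  have X2 := h.floquetBilin_nat hq hLN hl hmu (m := 2) (by norm_num)
  have Q1 := h.floquetBilin_nat hq hLN hmu hmu (m := 1) (by norm_num)
  have Q2 := h.floquetBilin_nat hq hLN hmu hmu (m := 2) (by norm_num)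
  rw [hlm] at X1 X2
  -- multiplicativity of the determinant
  have hmul : minor (fun m => h.floquetBilin hq m lam lam) (fun m => h.floquetBilin hq m lam mu)
      (fun m => h.floquetBilin hq m mu mu) 0 1 2 = 0 := by
    have : minor (fun m => h.floquetBilin hq m lam lam) (fun m => h.floquetBilin hq m lam mu)
        (fun m => h.floquetBilin hq m mu mu) 0 1 2
        = minor (fun m => gramA hq L b m) (fun m => gramB hq L b m) (fun m => gramC hq L b m) 0 1 2
          * (cauchySol L b 0 1 1 * (h.eig mu - h.eig lam)) ^ 3 := by
      unfold minor floquetBilin siteBilin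
      ring
    rw [this, h0, zero_mul]
  unfold minor at hmul
  simp only [P1, P2, X1, X2, Q1, Q2, Nat.cast_zero] at hmul
  have hv : h.floquetBilin hq 0 lam lam * h.floquetBilin hq 0 lam mu * h.floquetBilin hq 0 mu mu *
      ((lam ^ 2 - 1) * (mu ^ 2 - 1) * (lam ^ 2 - mu ^ 2)) = 0 := by
    linear_combination hmul
  refine mul_ne_zero (mul_ne_zero (mul_ne_zero P X) Q) (mul_ne_zero (mul_ne_zero ?_ ?_) ?_) hv
  · exact sub_ne_zero.2 hl1
  · exact sub_ne_zero.2 hmu1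
  · exact sub_ne_zero.2 hne

end Hyperbolic

lemma hyperbolic_const (hq : SingleSite q N η) {ω₀ E : ℝ} (h0 : 0 ≤ ω₀) (hE : E < ω₀ * η) :
    ∃ S, Hyperbolic (fun t => wpot q N (fun _ => ω₀) t - E) (7 * N)
      (coeffBound η (fun _ : Fin (16 * N + 1) => ω₀) E) S := by
  obtain ⟨S, hS, hc⟩ := exists_countable_continuousAt_wpot hq (fun _ => ω₀) E
  refine ⟨S, bddMeas_wpot hq _ E, hS, hc, fun t ht => ?_, fun t ht => ?_, ?_⟩
  · linarith [le_wpot_const hq h0 ht]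
  · simp only [wpot_const_periodic hq ω₀ ht]
  · linarith [hq.one_le_cast]

/-- The form at the energy `G` does not vanish on a Floquet solution: the recurrence coefficients at
the two energies differ. -/
lemma exists_elimForm_ne_zero (hq : SingleSite q N η) {F G ω₀ : ℝ} (hFG : F ≠ G) (h0 : 0 ≤ ω₀)
    (hF : F < ω₀ * η) (hG : G < ω₀ * η) :
    ∃ w₀ w₁, elimForm hq F G (fun _ => ω₀) w₀ w₁ ≠ 0 := by
  obtain ⟨S, h⟩ := hyperbolic_const hq h0 hF
  obtain ⟨T, k⟩ := hyperbolic_const hq h0 hG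
  have hLN : (N : ℝ) + 3 ≤ 7 * N := by linarith [hq.one_le_cast]
  have htr : h.trace ≠ k.trace := h.trace_ne k (δ := G - F) (sub_ne_zero.2 hFG.symm)
    (fun x => by ring)
  have htr2 : h.trace ^ 2 ≠ k.trace ^ 2 := fun e =>
    htr ((sq_eq_sq₀ h.trace_pos.le k.trace_pos.le).1 e)
  obtain ⟨lam, mu, hl, -, -, -, hl1, -⟩ := k.exists_multipliers
  have hl0 : lam ≠ 0 := by
    rintro rfl
    norm_num at hl
  have P := k.floquetBilin_zero_ne hq hLN hl hl
  have hm := h.minor_ne_zero hq hLN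
  obtain ⟨ra, rb, rc⟩ := h.gram_recurrence hq hLN
  obtain ⟨k0, k1, k2, k3⟩ := cofactor_of_recurrence
    (a := fun m => gramA hq (7 * N) (fun t => wpot q N (fun _ => ω₀) t - F) m)
    (b := fun m => gramB hq (7 * N) (fun t => wpot q N (fun _ => ω₀) t - F) m)
    (c := fun m => gramC hq (7 * N) (fun t => wpot q N (fun _ => ω₀) t - F) m)
    (s := h.trace ^ 2 - 1) (by exact_mod_cast ra) (by exact_mod_cast rb) (by exact_mod_cast rc)
  refine ⟨cauchySol (7 * N) (fun t => wpot q N (fun _ => ω₀) t - G) 0 1 1, k.eig lam, ?_⟩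
  have hval : ∀ m : ℕ, m ≤ 3 →
      siteForm hq (7 * N) (fun t => wpot q N (fun _ => ω₀) t - G) m
        (cauchySol (7 * N) (fun t => wpot q N (fun _ => ω₀) t - G) 0 1 1) (k.eig lam)
        = (lam * lam) ^ m * k.floquetBilin hq 0 lam lam := fun m hm => by
    rw [← siteBilin_self]
    exact k.floquetBilin_nat hq hLN hl hl hm
  unfold elimForm
  simp only [Finset.sum_range_succ, Finset.sum_range_zero]
  rw [hval 0 (by norm_num), hval 1 (by norm_num), hval 2 (by norm_num), hval 3 (by norm_num)]
  unfold elim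
  rw [k0, k1, k2, k3]
  generalize minor _ _ _ 0 1 2 = M at hm
  -- `lam²` is a root of the characteristic polynomial at the energy `G`
  have hroot : lam ^ 4 = (k.trace ^ 2 - 2) * lam ^ 2 - 1 := by
    linear_combination (lam ^ 2 + k.trace * lam + 1) * hl
  have e : 0 + M * ((lam * lam) ^ 0 * k.floquetBilin hq 0 lam lam)
      + -(h.trace ^ 2 - 1) * M * ((lam * lam) ^ 1 * k.floquetBilin hq 0 lam lam)
      + (h.trace ^ 2 - 1) * M * ((lam * lam) ^ 2 * k.floquetBilin hq 0 lam lam)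
      + -M * ((lam * lam) ^ 3 * k.floquetBilin hq 0 lam lam)
      = M * k.floquetBilin hq 0 lam lam * (h.trace ^ 2 - k.trace ^ 2) *
        (lam ^ 2 * (lam ^ 2 - 1)) := by
    linear_combination (-M * k.floquetBilin hq 0 lam lam * (lam ^ 2 - 1)) * hroot
  rw [e]
  exact mul_ne_zero (mul_ne_zero (mul_ne_zero hm P) (sub_ne_zero.2 htr2))
    (mul_ne_zero (pow_ne_zero 2 hl0) (sub_ne_zero.2 hl1))

lemma exists_form_ne_zero (hq : SingleSite q N η) {F G ω₀ : ℝ} (hFG : F ≠ G) (h0 : 0 ≤ ω₀)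
    (hF : F < ω₀ * η) (hG : G < ω₀ * η) :
    0 < formA hq F G (fun _ => ω₀) ^ 2 + formB hq F G (fun _ => ω₀) ^ 2
      + formC hq F G (fun _ => ω₀) ^ 2 := by
  obtain ⟨w₀, w₁, hw⟩ := exists_elimForm_ne_zero hq hFG h0 hF hG
  rw [elimForm_eq_prufer] at hw
  by_contra! hcon
  generalize formA hq F G (fun _ => ω₀) = d₀ at *
  generalize formB hq F G (fun _ => ω₀) = d₁ at *
  generalize formC hq F G (fun _ => ω₀) = d₂ at *
  have s0 := sq_nonneg d₀
  have s1 := sq_nonneg d₁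
  have s2 := sq_nonneg d₂
  have e0 : d₀ = 0 := pow_eq_zero_iff two_ne_zero |>.1 (by linarith)
  have e1 : d₁ = 0 := pow_eq_zero_iff two_ne_zero |>.1 (by linarith)
  have e2 : d₂ = 0 := pow_eq_zero_iff two_ne_zero |>.1 (by linarith)
  rw [e0, e1, e2] at hw
  simp at hw

/-! ### Prüfer angles and slopes -/

lemma sign_mul_abs_self (r : ℝ) : r.sign * |r| = r := by
  rcases lt_trichotomy r 0 with h | rfl | h
  · rw [Real.sign_of_neg h, abs_of_neg h]; ring
  · simp
  · rw [Real.sign_of_pos h, abs_of_pos h]; ring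

lemma sin_cos_angle {U : Fin 2 → ℝ} (hU : radius U ≠ 0) :
    Real.sin (angle U) = U 0 / radius U ∧ Real.cos (angle U) = U 1 / radius U := by
  have hn : ‖(⟨U 1, U 0⟩ : ℂ)‖ = radius U := by
    rw [Complex.norm_eq_sqrt_sq_add_sq, radius, add_comm]
  have hz : (⟨U 1, U 0⟩ : ℂ) ≠ 0 := by
    intro h
    rw [h, norm_zero] at hn
    exact hU hn.symm
  unfold angle
  rw [← self_sub_toIcoDiv_zsmul, Real.sin_periodic.sub_zsmul_eq, Real.cos_periodic.sub_zsmul_eq,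
    Complex.sin_arg, Complex.cos_arg hz, hn]
  exact ⟨rfl, rfl⟩

/-- The slope is the tangent when `|sin θ| ≤ |cos θ|` and the cotangent otherwise. -/
lemma slope_cases {U : Fin 2 → ℝ} (hU : radius U ≠ 0) :
    |slope U| ≤ 1 ∧ ((U 0 = U 1 * slope U ∧ radius U ^ 2 ≤ 2 * U 1 ^ 2) ∨
      (U 1 = U 0 * slope U ∧ radius U ^ 2 ≤ 2 * U 0 ^ 2)) := by
  obtain ⟨hs, hc⟩ := sin_cos_angle hU
  have hr : radius U ^ 2 = U 0 ^ 2 + U 1 ^ 2 := by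
    rw [radius, Real.sq_sqrt (by positivity)]
  have hrpos : 0 < radius U := lt_of_le_of_ne (Real.sqrt_nonneg _) hU.symm
  have hsum := Real.sin_sq_add_cos_sq (angle U)
  have e0 : U 0 = radius U * Real.sin (angle U) := by rw [hs]; field_simp
  have e1 : U 1 = radius U * Real.cos (angle U) := by rw [hc]; field_simp
  have key : |slope U| ≤ 1 ∧
      ((Real.sin (angle U) = Real.cos (angle U) * slope U ∧ 1 ≤ 2 * Real.cos (angle U) ^ 2) ∨
      (Real.cos (angle U) = Real.sin (angle U) * slope U ∧ 1 ≤ 2 * Real.sin (angle U) ^ 2)) := by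
    unfold slope
    rw [Real.tan_eq_sin_div_cos, Real.cot_eq_cos_div_sin]
    generalize Real.sin (angle U) = s at *
    generalize Real.cos (angle U) = c at *
    rcases le_or_gt |s| |c| with h | h
    · have hsq : s ^ 2 ≤ c ^ 2 := sq_le_sq.2 h
      have hc0 : c ≠ 0 := by
        rintro rfl
        nlinarith
      have hc' : 0 < |c| := abs_pos.2 hc0
      have ht : |s / c| ≤ 1 := by rw [abs_div, div_le_one hc']; exact h
      have hslope : (s / c).sign * min |s / c| |c / s| = s / c := by
        rcases eq_or_ne s 0 with rfl | hs0
        · simp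
        · have h1 : 1 ≤ |c / s| := by rw [abs_div, one_le_div (abs_pos.2 hs0)]; exact h
          rw [min_eq_left (ht.trans h1), sign_mul_abs_self]
      rw [hslope]
      exact ⟨ht, Or.inl ⟨by field_simp, by linarith⟩⟩
    · have hsq : c ^ 2 ≤ s ^ 2 := sq_le_sq.2 h.le
      have hs0 : s ≠ 0 := by
        rintro rfl
        rw [abs_zero] at h
        exact (abs_nonneg c).not_gt h
      have hs' : 0 < |s| := abs_pos.2 hs0
      have ht : |c / s| ≤ 1 := by rw [abs_div, div_le_one hs']; exact h.le
      have hslope : (s / c).sign * min |s / c| |c / s| = c / s := by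
        rcases eq_or_ne c 0 with rfl | hc0
        · simp
        · have h1 : 1 ≤ |s / c| := by rw [abs_div, one_le_div (abs_pos.2 hc0)]; exact h.le
          rw [min_eq_right (ht.trans h1), ← inv_div c s, Real.sign_inv, sign_mul_abs_self]
      rw [hslope]
      exact ⟨ht, Or.inr ⟨by field_simp, by linarith⟩⟩
  refine ⟨key.1, ?_⟩
  have hr2 : 0 ≤ radius U ^ 2 := sq_nonneg _
  rcases key.2 with ⟨h1, h2⟩ | ⟨h1, h2⟩
  · refine Or.inl ⟨?_, ?_⟩
    · rw [e0, e1, h1]; ring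
    · rw [e1, mul_pow]; nlinarith
  · refine Or.inr ⟨?_, ?_⟩
    · rw [e0, e1, h1]; ring
    · rw [e0, mul_pow]; nlinarith

/-! ### The elimination estimate -/

/-- A bound for the ratio of the squared radii at nearby sites to the squared radius at the base
point: `siteConst` bounds them by the Cauchy data, and `sq_add_sq_le_siteForm` bounds the Cauchy
data by the radius at the base point. -/
def massConst (hq : SingleSite q N η) (E : ℝ) (x : Fin (16 * N + 1) → ℝ) : ℝ :=
  siteConst η N (7 * N) (coeffBound η x E + 1) *
    (2 * ((gramA hq (7 * N) (fun t => wpot q N x t - E) 0 +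
      gramC hq (7 * N) (fun t => wpot q N x t - E) 0) /
      (gramA hq (7 * N) (fun t => wpot q N x t - E) 0 *
        gramC hq (7 * N) (fun t => wpot q N x t - E) 0 -
        gramB hq (7 * N) (fun t => wpot q N x t - E) 0 ^ 2)))

lemma massConst_nonneg (hq : SingleSite q N η) (E : ℝ) (x : Fin (16 * N + 1) → ℝ) :
    0 ≤ massConst hq E x := by
  have hb := bddMeas_wpot hq x E
  have h1 := gramA_pos hq le_seven hb
  have h2 := gramC_pos hq le_seven hb
  have h3 := gram_det_pos hq le_seven hb
  have h4 := siteConst_nonneg hq (L := 7 * N) (B := coeffBound η x E + 1) (by positivity)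
  unfold massConst
  positivity

lemma analyticallyBounded_massConst (hq : SingleSite q N η) (E : ℝ) :
    AnalyticallyBounded (fun x => massConst hq E x) := by
  have hL : (0 : ℝ) ≤ 7 * N := by positivity
  unfold massConst
  refine .mul (((analyticallyBounded_coeffBound η E).add (.const 1)).siteConst η N (7 * N))
    (.mul (.const 2) (.of_analytic fun x => ?_))
  have hA := analyticAt_gramA hq hL E 0 x
  have hB := analyticAt_gramB hq hL E 0 x
  have hC := analyticAt_gramC hq hL E 0 x
  exact (hA.add hC).div ((hA.mul hC).sub (hB.pow 2))
    (gram_det_pos hq le_seven (bddMeas_wpot hq x E)).ne'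

/-- The data of `exists_data_pruferVector`, with all errors measured by the radius at `n₀`. -/
lemma exists_data_radius (hq : SingleSite q N η) {ω : ℤ → ℝ} {E F ε : ℝ} {l : ℕ}
    {u : ℝ → ℝ} (hu : IsSolutionOn (potential q ω) E (-(l : ℝ)) l u) (j : ℕ) {n₀ : ℤ}
    (h₁ : -(l : ℤ) + 8 * N < n₀) (h₂ : n₀ < (l : ℤ) - 8 * N) (hEF : |E - F| ≤ ε) (hε : ε ≤ 1) :
    ∃ w₀ w₁ : ℝ,
      pruferVector q N ω F l j u n₀ =
        ![√(normSqΨ hq F (window N ω n₀)) * (w₀ + gsCoeff hq F (window N ω n₀) * w₁),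
          √(normSqΦ hq F (window N ω n₀)) * w₁] ∧
      ∀ m : ℕ, m ≤ 3 →
        |radius (pruferVector q N ω F l j u (n₀ + m)) ^ 2 -
            siteForm hq (7 * N) (fun t => wpot q N (window N ω n₀) t - F) m w₀ w₁|
          ≤ massConst hq F (window N ω n₀) * ε * radius (pruferVector q N ω F l j u n₀) ^ 2 ∧
        radius (pruferVector q N ω F l j u (n₀ + m)) ^ 2
          ≤ massConst hq F (window N ω n₀) * radius (pruferVector q N ω F l j u n₀) ^ 2 := by
  obtain ⟨w₀, w₁, hU, hr, hm⟩ := exists_data_pruferVector hq hu j h₁ h₂ hEF hε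
  refine ⟨w₀, w₁, hU, fun m hm3 => ?_⟩
  obtain ⟨k1, k2⟩ := hm m hm3
  have hε0 : 0 ≤ ε := (abs_nonneg _).trans hEF
  have h4 := siteConst_nonneg hq (L := 7 * N) (B := coeffBound η (window N ω n₀) F + 1)
    (by positivity)
  have h5 : (|w₀| + |w₁|) ^ 2 ≤ 2 * (w₀ ^ 2 + w₁ ^ 2) := by
    rw [← sq_abs w₀, ← sq_abs w₁]
    nlinarith [sq_nonneg (|w₀| - |w₁|)]
  have h6 := sq_add_sq_le_siteForm hq le_seven (bddMeas_wpot hq (window N ω n₀) F) w₀ w₁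
  rw [← hr] at h6
  have h7 : (|w₀| + |w₁|) ^ 2 ≤ 2 * _ := h5.trans (mul_le_mul_of_nonneg_left h6 two_pos.le)
  constructor
  · refine k1.trans ((mul_le_mul_of_nonneg_left h7 (mul_nonneg h4 hε0)).trans (le_of_eq ?_))
    unfold massConst
    ring
  · refine k2.trans ((mul_le_mul_of_nonneg_left h7 h4).trans (le_of_eq ?_))
    unfold massConst
    ring

/-- The constant in the elimination estimate. -/
def elimConst (hq : SingleSite q N η) (F G : ℝ) (x : Fin (16 * N + 1) → ℝ) : ℝ :=
  (∑ m ∈ Finset.range 4, |elim hq F x m|) * (8 * massConst hq F x + 3 * massConst hq G x + 6)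

lemma analyticallyBounded_elimConst (hq : SingleSite q N η) (F G : ℝ) :
    AnalyticallyBounded (fun x => elimConst hq F G x) := by
  unfold elimConst
  exact .mul (.sum fun m => .abs (.of_analytic fun x => analyticAt_elim hq F x m))
    (.add (.add (.mul (.const 8) (analyticallyBounded_massConst hq F))
      (.mul (.const 3) (analyticallyBounded_massConst hq G))) (.const 6))

/-- Comparison of two radii `p`, `s` at a site with the quadratic forms `P`, `Q`, where `r`, `ρ` are
the radii at the base point and `e ^ 4`, `e ^ 2`, `e` are the three scales of smallness. -/
lemma abs_sub_le_of_radii {e r ρ p s P Q K M : ℝ} (he : 0 < e) (he2 : e ≤ 1 / 2) (her : e ≤ r)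
    (hrρ : |r - ρ| ≤ e ^ 2) (hp : 0 ≤ p) (hs : 0 ≤ s) (hps : |p - s| ≤ e ^ 2) (hK : 0 ≤ K)
    (hM : 0 ≤ M) (hp2 : p ^ 2 ≤ K * r ^ 2) (hs2 : s ^ 2 ≤ M * ρ ^ 2)
    (hP : |p ^ 2 - P| ≤ K * e ^ 4 * r ^ 2) (hQ : |s ^ 2 - Q| ≤ M * e ^ 4 * ρ ^ 2) :
    |Q - P| ≤ (8 * K + 3 * M + 6) * (ρ ^ 2 * e) := by
  have hr : 0 < r := he.trans_le her
  have hee : e ^ 2 ≤ r / 2 := by nlinarith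
  obtain ⟨h1, h2⟩ := abs_le.1 hrρ
  have hr2 : r ≤ 2 * ρ := by linarith
  have hρ : 0 < ρ := by linarith
  have he2ρ : e ^ 2 ≤ 2 * ρ * e := by nlinarith
  have he4 : e ^ 4 ≤ e := by
    have : e ^ 3 ≤ 1 := pow_le_one₀ he.le (by linarith)
    nlinarith
  have hp3 : p ≤ (1 + K) * r := by
    refine le_of_sq_le_sq (hp2.trans ?_) (by positivity)
    rw [mul_pow]
    nlinarith [sq_nonneg r, mul_nonneg (sq_nonneg r) (by nlinarith : 0 ≤ (1 + K) ^ 2 - K)]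
  have hs3 : s ≤ (1 + M) * ρ := by
    refine le_of_sq_le_sq (hs2.trans ?_) (by positivity)
    rw [mul_pow]
    nlinarith [sq_nonneg ρ, mul_nonneg (sq_nonneg ρ) (by nlinarith : 0 ≤ (1 + M) ^ 2 - M)]
  have hpsum : p + s ≤ (3 + 2 * K + M) * ρ := by
    have : (1 + K) * r ≤ (1 + K) * (2 * ρ) := by gcongr
    linarith
  have hdiff : |p ^ 2 - s ^ 2| ≤ 2 * ρ * e * ((3 + 2 * K + M) * ρ) := by
    rw [sq_sub_sq, mul_comm, abs_mul, abs_of_nonneg (add_nonneg hp hs)]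
    exact mul_le_mul (hps.trans he2ρ) hpsum (add_nonneg hp hs) (by positivity)
  have hP' : |p ^ 2 - P| ≤ K * e * (2 * ρ) ^ 2 := hP.trans (by gcongr)
  have hQ' : |s ^ 2 - Q| ≤ M * e * ρ ^ 2 := hQ.trans (by gcongr)
  have htri : |Q - P| ≤ |s ^ 2 - Q| + |p ^ 2 - s ^ 2| + |p ^ 2 - P| := by
    have e1 : Q - P = -(s ^ 2 - Q) + -(p ^ 2 - s ^ 2) + (p ^ 2 - P) := by ring
    rw [e1]
    refine (abs_add_le _ _).trans (add_le_add_left ((abs_add_le _ _).trans ?_) _)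
    rw [abs_neg, abs_neg]
  calc |Q - P| ≤ M * e * ρ ^ 2 + 2 * ρ * e * ((3 + 2 * K + M) * ρ) + K * e * (2 * ρ) ^ 2 := by
        linarith
    _ = (8 * K + 3 * M + 6) * (ρ ^ 2 * e) := by ring

/-- The quadratic form with the coefficients `formA`, `formB`, `formC` is small at the Prüfer vector
of `v`: the combination `∑ κ_m r(m)²` almost vanishes for the radii of `u`, hence for those of `v`.
-/
lemma abs_form_le (hq : SingleSite q N η) {ω : ℤ → ℝ} {E E' F G e : ℝ} {l : ℕ} {u v : ℝ → ℝ}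
    (hu : IsSolutionOn (potential q ω) E (-(l : ℝ)) l u)
    (hv : IsSolutionOn (potential q ω) E' (-(l : ℝ)) l v) (j k : ℕ) {n₀ : ℤ}
    (h₁ : -(l : ℤ) + 8 * N < n₀) (h₂ : n₀ < (l : ℤ) - 8 * N) (he : 0 < e) (he2 : e ≤ 1 / 2)
    (hEF : |E - F| ≤ e ^ 4) (hEG : |E' - G| ≤ e ^ 4)
    (hr : e ≤ radius (pruferVector q N ω F l j u n₀))
    (huv : ∀ m : ℕ, m ≤ 3 → |radius (pruferVector q N ω F l j u (n₀ + m)) -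
      radius (pruferVector q N ω G l k v (n₀ + m))| ≤ e ^ 2) :
    |formA hq F G (window N ω n₀) * pruferVector q N ω G l k v n₀ 0 ^ 2 +
      formB hq F G (window N ω n₀) *
        (pruferVector q N ω G l k v n₀ 0 * pruferVector q N ω G l k v n₀ 1) +
      formC hq F G (window N ω n₀) * pruferVector q N ω G l k v n₀ 1 ^ 2|
      ≤ elimConst hq F G (window N ω n₀) *
        (radius (pruferVector q N ω G l k v n₀) ^ 2 * e) := by
  have he1 : e ^ 4 ≤ 1 := pow_le_one₀ he.le (by linarith)
  obtain ⟨w₀, w₁, -, hmu⟩ := exists_data_radius hq hu j h₁ h₂ hEF he1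
  obtain ⟨v₀, v₁, hV, hmv⟩ := exists_data_radius hq hv k h₁ h₂ hEG he1
  have hform := elimForm_eq_prufer hq F G (window N ω n₀) v₀ v₁
  have e0 : pruferVector q N ω G l k v n₀ 0 = _ := congrFun hV 0
  have e1 : pruferVector q N ω G l k v n₀ 1 = _ := congrFun hV 1
  simp only [Matrix.cons_val_zero, Matrix.cons_val_one] at e0 e1
  rw [← e0, ← e1] at hform
  rw [← hform]
  have hzero := sum_elim_siteForm hq F (window N ω n₀) w₀ w₁
  have hdiff : elimForm hq F G (window N ω n₀) v₀ v₁ = ∑ m ∈ Finset.range 4,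
      elim hq F (window N ω n₀) m *
        (siteForm hq (7 * N) (fun t => wpot q N (window N ω n₀) t - G) m v₀ v₁ -
          siteForm hq (7 * N) (fun t => wpot q N (window N ω n₀) t - F) m w₀ w₁) := by
    simp only [mul_sub, Finset.sum_sub_distrib, hzero, sub_zero]
    rfl
  rw [hdiff, elimConst, mul_assoc, Finset.sum_mul]
  refine (Finset.abs_sum_le_sum_abs _ _).trans (Finset.sum_le_sum fun m hm => ?_)
  have hm3 : m ≤ 3 := by have := Finset.mem_range.1 hm; lia
  rw [abs_mul]
  refine mul_le_mul_of_nonneg_left ?_ (abs_nonneg _)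
  have h0 := huv 0 (by norm_num)
  simp only [Nat.cast_zero, add_zero] at h0
  exact abs_sub_le_of_radii he he2 hr h0 (Real.sqrt_nonneg _) (Real.sqrt_nonneg _) (huv m hm3)
    (massConst_nonneg hq F _) (massConst_nonneg hq G _) (hmu m hm3).2 (hmv m hm3).2
    (hmu m hm3).1 (hmv m hm3).1

/-! ### The palindromic polynomial -/

/-- The coefficients of `X² (d₀ X² + d₁ X + d₂) (d₂ X² + d₁ X + d₀)`. -/
def palCoeff (d₀ d₁ d₂ : ℝ) : Fin 9 → ℝ :=
  ![0, 0, d₀ * d₂, d₁ * (d₀ + d₂), d₀ ^ 2 + d₁ ^ 2 + d₂ ^ 2, d₁ * (d₀ + d₂), d₀ * d₂, 0, 0]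

lemma palCoeff_rev (d₀ d₁ d₂ : ℝ) (i : Fin 9) :
    palCoeff d₀ d₁ d₂ (Fin.rev i) = palCoeff d₀ d₁ d₂ i := by
  fin_cases i <;> rfl

lemma sum_palCoeff (d₀ d₁ d₂ t : ℝ) : ∑ i : Fin 9, palCoeff d₀ d₁ d₂ i * t ^ (i : ℕ) =
    t ^ 2 * (d₀ * t ^ 2 + d₁ * t + d₂) * (d₂ * t ^ 2 + d₁ * t + d₀) := by
  simp [Fin.sum_univ_succ, palCoeff]
  ring

lemma polyR_coeff {N : ℕ} (f : Fin 9 → (Fin (16 * N + 1) → ℝ) → ℝ) (x : Fin (16 * N + 1) → ℝ)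
    (i : Fin 9) : (polyR f x).coeff i = f i x := by
  unfold polyR
  simp [Polynomial.coeff_C_mul, Polynomial.coeff_X_pow,
    Fin.val_inj]

lemma polyR_eval {N : ℕ} (f : Fin 9 → (Fin (16 * N + 1) → ℝ) → ℝ) (x : Fin (16 * N + 1) → ℝ)
    (t : ℝ) : (polyR f x).eval t = ∑ i : Fin 9, f i x * t ^ (i : ℕ) := by
  unfold polyR
  simp [Polynomial.eval_finsetSum]

/-- Both factors of the palindromic polynomial are bounded at the slope of a vector, and one of them
is the quadratic form evaluated at that vector, up to a factor at most `2`. -/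
lemma abs_palindrome_le {U : Fin 2 → ℝ} (hU : radius U ≠ 0) {d₀ d₁ d₂ K e : ℝ}
    (h : |d₀ * U 0 ^ 2 + d₁ * (U 0 * U 1) + d₂ * U 1 ^ 2| ≤ K * (radius U ^ 2 * e)) :
    |slope U ^ 2 * (d₀ * slope U ^ 2 + d₁ * slope U + d₂) *
      (d₂ * slope U ^ 2 + d₁ * slope U + d₀)| ≤ 2 * K * (|d₀| + |d₁| + |d₂|) * e := by
  obtain ⟨ht, hcase⟩ := slope_cases hU
  set t := slope U
  have hr : 0 < radius U ^ 2 := by positivity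
  have hKe : 0 ≤ K * e := by
    have := (abs_nonneg _).trans h
    by_contra! hcon
    nlinarith
  have ht2 : |t ^ 2| ≤ 1 := by rw [abs_pow]; exact pow_le_one₀ (abs_nonneg _) ht
  have hfac : ∀ a b c : ℝ, |a * t ^ 2 + b * t + c| ≤ |a| + |b| + |c| := by
    intro a b c
    have h1 : |a * t ^ 2| ≤ |a| := by
      rw [abs_mul]; exact mul_le_of_le_one_right (abs_nonneg _) ht2
    have h2 : |b * t| ≤ |b| := by
      rw [abs_mul]; exact mul_le_of_le_one_right (abs_nonneg _) ht
    exact (abs_add_le _ _).trans (add_le_add ((abs_add_le _ _).trans (add_le_add h1 h2)) le_rfl)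
  have hsmall : ∀ X y : ℝ, |y ^ 2 * X| ≤ K * (radius U ^ 2 * e) → radius U ^ 2 ≤ 2 * y ^ 2 →
      |X| ≤ 2 * (K * e) := by
    intro X y h1 h2
    rw [abs_mul, abs_of_nonneg (sq_nonneg y)] at h1
    have hy : 0 < y ^ 2 := by linarith
    have h3 : K * (radius U ^ 2 * e) ≤ y ^ 2 * (2 * (K * e)) := by nlinarith
    exact le_of_mul_le_mul_left (h1.trans h3) hy
  have hsum : 0 ≤ |d₀| + |d₁| + |d₂| := by positivity
  rw [abs_mul, abs_mul]
  rcases hcase with ⟨h1, h2⟩ | ⟨h1, h2⟩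
  · have h3 : |d₀ * t ^ 2 + d₁ * t + d₂| ≤ 2 * (K * e) := by
      refine hsmall _ (U 1) ?_ h2
      rw [h1] at h
      convert h using 2
      ring
    have h4 := hfac d₂ d₁ d₀
    calc _ ≤ 1 * (2 * (K * e)) * (|d₂| + |d₁| + |d₀|) := by gcongr
      _ = _ := by ring
  · have h3 : |d₂ * t ^ 2 + d₁ * t + d₀| ≤ 2 * (K * e) := by
      refine hsmall _ (U 0) ?_ h2
      rw [h1] at h
      convert h using 2
      ring
    have h4 := hfac d₀ d₁ d₂
    calc _ ≤ 1 * (|d₀| + |d₁| + |d₂|) * (2 * (K * e)) := by gcongr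
      _ = _ := by ring

lemma exp_neg_rpow_div_four_le {l : ℕ} (hl : 9 ≤ l) {β : ℝ} (hβ : 1 / 2 < β) :
    Real.exp (-(l : ℝ) ^ β / 4) ≤ 1 / 2 := by
  have hl' : (9 : ℝ) ≤ l := by exact_mod_cast hl
  have h1 : (3 : ℝ) ≤ (l : ℝ) ^ β := by
    calc (3 : ℝ) = √9 := by rw [show (9 : ℝ) = 3 ^ 2 by norm_num, Real.sqrt_sq (by norm_num)]
      _ ≤ √(l : ℝ) := Real.sqrt_le_sqrt hl'
      _ = (l : ℝ) ^ (1 / 2 : ℝ) := Real.sqrt_eq_rpow _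
      _ ≤ (l : ℝ) ^ β := Real.rpow_le_rpow_of_exponent_le (by linarith) hβ.le
  have h2 : Real.exp (-(l : ℝ) ^ β / 4) ≤ Real.exp (-Real.log 2) :=
    Real.exp_le_exp.2 (by linarith [Real.log_two_lt_d9])
  rwa [Real.exp_neg, Real.exp_log two_pos, ← one_div] at h2

end Alloy

end

theorem lemma3p7 (q : ℝ → ℝ) (N : ℕ) (η : ℝ) (hq : Alloy.SingleSite q N η)
    (F G : ℝ) (hFG : F ≠ G) :
    ∃ f : Fin 9 → (Fin (16 * N + 1) → ℝ) → ℝ,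
      (∀ i, AnalyticOnNhd ℝ (f i) Set.univ) ∧
      (∃ i x, f i x ≠ 0) ∧
      (∀ ω₀ : ℝ, 0 ≤ ω₀ → F < ω₀ * η → G < ω₀ * η → Alloy.polyR f (fun _ => ω₀) ≠ 0) ∧
      ∀ (β : ℝ) (_ : 1 / 2 < β) (l : ℕ) (ω : ℤ → ℝ) (j k : ℕ) (u v : ℝ → ℝ),
        Alloy.IsNormalizedEigenfunction q ω l (Alloy.energy q l j ω) u →
        |Alloy.energy q l j ω - F| ≤ Real.exp (-(l : ℝ) ^ β) →
        Alloy.IsNormalizedEigenfunction q ω l (Alloy.energy q l k ω) v →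
        |Alloy.energy q l k ω - G| ≤ Real.exp (-(l : ℝ) ^ β) →
        ∀ U V : ℤ → Fin 2 → ℝ,
          U = Alloy.pruferVector q N ω F l j u →
          V = Alloy.pruferVector q N ω G l k v →
          ∀ n₀ : ℤ, -(l : ℤ) + 8 * N < n₀ → n₀ < (l : ℤ) - 8 * N →
            Real.exp (-(l : ℝ) ^ β / 4) ≤ Alloy.radius (U n₀) →
            (∀ m ∈ Set.Icc (n₀ - 7 * (N : ℤ)) (n₀ + 7 * (N : ℤ)),
              |Alloy.radius (U m) - Alloy.radius (V m)| ≤ Real.exp (-(l : ℝ) ^ β / 2)) →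
            ((Alloy.SlopeIsTan (V n₀) ∧ Alloy.SlopeIsTan (U n₀)) ∨
                (Alloy.SlopeIsCot (V n₀) ∧ Alloy.SlopeIsCot (U n₀)) →
              |(Alloy.polyR f (Alloy.window N ω n₀)).eval (Alloy.slope (V n₀))|
                ≤ Real.exp (-(l : ℝ) ^ β / 4)) ∧
            (¬ ((Alloy.SlopeIsTan (V n₀) ∧ Alloy.SlopeIsTan (U n₀)) ∨
                (Alloy.SlopeIsCot (V n₀) ∧ Alloy.SlopeIsCot (U n₀))) →
              |(Alloy.polyQ f (Alloy.window N ω n₀)).eval (Alloy.slope (V n₀))|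
                ≤ Real.exp (-(l : ℝ) ^ β / 4)) := by
  have hA := fun x => (Alloy.analyticAt_form hq F G x).1
  have hB := fun x => (Alloy.analyticAt_form hq F G x).2.1
  have hC := fun x => (Alloy.analyticAt_form hq F G x).2.2
  -- the analytic factor that makes the constants of the estimate uniform in the couplings
  obtain ⟨c, hc, hcpos, hc1⟩ := Alloy.AnalyticallyBounded.exists_damping
    (C := fun x => 2 * Alloy.elimConst hq F G x * (|Alloy.formA hq F G x| +
      |Alloy.formB hq F G x| + |Alloy.formC hq F G x|))
    (.mul (.mul (.const 2) (Alloy.analyticallyBounded_elimConst hq F G))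
      (.add (.add (.abs (.of_analytic hA)) (.abs (.of_analytic hB))) (.abs (.of_analytic hC))))
  have hne : ∀ ω₀ : ℝ, 0 ≤ ω₀ → F < ω₀ * η → G < ω₀ * η →
      c (fun _ => ω₀) * Alloy.palCoeff (Alloy.formA hq F G fun _ => ω₀)
        (Alloy.formB hq F G fun _ => ω₀) (Alloy.formC hq F G fun _ => ω₀) 4 ≠ 0 :=
    fun ω₀ h0 hF hG => (mul_pos (hcpos _) (Alloy.exists_form_ne_zero hq hFG h0 hF hG)).ne'
  refine ⟨fun i x => c x * Alloy.palCoeff (Alloy.formA hq F G x) (Alloy.formB hq F G x)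
    (Alloy.formC hq F G x) i, fun i x _ => (hc x).mul ?_, ?_, fun ω₀ h0 hF hG hzero => ?_, ?_⟩
  · have h1 := (hA x).mul (hC x)
    have h2 := (hB x).mul ((hA x).add (hC x))
    have h3 := (((hA x).pow 2).add ((hB x).pow 2)).add ((hC x).pow 2)
    fin_cases i
    exacts [analyticAt_const, analyticAt_const, h1, h2, h3, h2, h1, analyticAt_const,
      analyticAt_const]
  · have hη := hq.eta_pos
    have hlarge : ∀ E : ℝ, E ≤ |F| + |G| → E < (|F| + |G| + 1) / η * η := fun E hE => by
      rw [div_mul_cancel₀ _ hη.ne']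
      linarith
    exact ⟨4, _, hne ((|F| + |G| + 1) / η) (by positivity)
      (hlarge F (by linarith [le_abs_self F, abs_nonneg G]))
      (hlarge G (by linarith [le_abs_self G, abs_nonneg F]))⟩
  · have h4 := Alloy.polyR_coeff (fun i x => c x * Alloy.palCoeff (Alloy.formA hq F G x)
      (Alloy.formB hq F G x) (Alloy.formC hq F G x) i) (fun _ => ω₀) 4
    rw [hzero, Polynomial.coeff_zero] at h4
    exact hne ω₀ h0 hF hG h4.symm
  · intro β hβ l ω j k u v hu hEF hv hEG U V hU hV n₀ h₁ h₂ hr huv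
    subst hU hV
    have hN := hq.one_le_N
    have he := Real.exp_pos (-(l : ℝ) ^ β / 4)
    have he2 := Alloy.exp_neg_rpow_div_four_le (l := l) (by lia) hβ
    have e4 : Real.exp (-(l : ℝ) ^ β) = Real.exp (-(l : ℝ) ^ β / 4) ^ 4 := by
      rw [← Real.exp_nat_mul]
      congr 1
      push_cast
      ring
    have e2 : Real.exp (-(l : ℝ) ^ β / 2) = Real.exp (-(l : ℝ) ^ β / 4) ^ 2 := by
      rw [← Real.exp_nat_mul]
      congr 1
      push_cast
      ring
    rw [e4] at hEF hEG
    simp only [e2] at huv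
    generalize Real.exp (-(l : ℝ) ^ β / 4) = e at *
    have hsmall := Alloy.abs_form_le hq hu.solution hv.solution j k h₁ h₂ he he2 hEF hEG hr
      (fun m hm => huv _ ⟨by lia, by lia⟩)
    have hVne : Alloy.radius (Alloy.pruferVector q N ω G l k v n₀) ≠ 0 := by
      intro h0
      have h1 := huv n₀ ⟨by lia, by lia⟩
      rw [h0, sub_zero] at h1
      have h2 := (le_abs_self _).trans h1
      nlinarith
    have hpal := Alloy.abs_palindrome_le hVne hsmall
    have hR : |(Alloy.polyR (fun i x => c x * Alloy.palCoeff (Alloy.formA hq F G x)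
        (Alloy.formB hq F G x) (Alloy.formC hq F G x) i) (Alloy.window N ω n₀)).eval
          (Alloy.slope (Alloy.pruferVector q N ω G l k v n₀))| ≤ e := by
      rw [Alloy.polyR_eval]
      simp only [mul_assoc (c _)]
      rw [← Finset.mul_sum, Alloy.sum_palCoeff, abs_mul, abs_of_pos (hcpos _)]
      refine (mul_le_mul_of_nonneg_left hpal (hcpos _).le).trans ?_
      rw [← mul_assoc]
      exact mul_le_of_le_one_left he.le (hc1 _)
    refine ⟨fun _ => hR, fun _ => ?_⟩
    have hQR : Alloy.polyQ (fun i x => c x * Alloy.palCoeff (Alloy.formA hq F G x)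
        (Alloy.formB hq F G x) (Alloy.formC hq F G x) i) (Alloy.window N ω n₀) =
        Alloy.polyR (fun i x => c x * Alloy.palCoeff (Alloy.formA hq F G x)
        (Alloy.formB hq F G x) (Alloy.formC hq F G x) i) (Alloy.window N ω n₀) := by
      unfold Alloy.polyQ Alloy.polyR
      simp only [Alloy.palCoeff_rev]
    rw [hQR]
    exact hR
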